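/- Let $\Omega=(0,1)^2$, let $0=x_0<\dots<x_n=1$ and $0=y_0<\dots<y_m=1$, and let $\mathcal T_h$ be the partition of $\Omega$ into the rectangles $T=[x_{i-1},x_i]\times[y_{j-1},y_j]$, with mesh size $h=\max_T \operatorname{diam} T$. The left, right, bottom and top edges of $T$ are denoted by $e_1,e_2,e_3,e_4$, and $|e|$ is the length of the edge $e$. Let $a$ be a symmetric $2\times2$ coefficient matrix that is constant on each element and satisfies $\lambda|\xi|^2\le a\xi\cdot\xi\le\Lambda|\xi|^2$ for all $\xi\in\mathbb R^2$, with $\lambda>0$. Let $f\in L^2(\Omega)$, and let $u\in H^3(\Omega)$ be a weak solution of $-\nabla\cdot(a\nabla u)=f$ in $\Omega$, $u=g$ on $\partial\Omega$ (in the sense of traces). Put $\mathbf q=(q_1,q_2)=a\nabla u$ (elementwise), and let $Q_b$ be the average over an edge (of the trace). *Weak Galerkin scheme.* Let $V_h$ be the space of all $v=\{v_0,v_b\}$ with $v_0|_T\in P_1(T)$ on each element and $v_b$ a single constant on each edge of the mesh; $V_b$ is the space of the edge components $v_b$, and $V_h^0=\{v\in V_h: v_b|_{\partial\Omega}=0\}$.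 The discrete weak gradient $\nabla_d v\in[P_0(T)]^2$ is defined on each $T$ by $(\nabla_d v,\psi)_T=-(v_0,\nabla\cdot\psi)_T+\langle v_b,\psi\cdot\mathbf n\rangle_{\partial T}$ for all $\psi\in[P_0(T)]^2$; it depends only on $v_b$. Given $\rho>0$, let $$s(w,v)=\rho h^{-1}\sum_T\langle w_b-Q_bw_0,\,v_b-Q_bv_0\rangle_{\partial T}.$$ For edgewise constant $v_b$, let $\mathcal S(v_b)\in P_1(T)$ be defined on each $T$ by $\langle\mathcal S(v_b),Q_b\phi\rangle_{\partial T}=\langle v_b,\phi\rangle_{\partial T}$ for all $\phi\in P_1(T)$, and let $$|||\mathcal S(v_b)-v_b|||^2=\rho h^{-1}\sum_T\|Q_b\mathcal S(v_b)-v_b\|^2_{L^2(\partial T)}.$$ *Correction.* Suppose that $w_b\in V_b$ is given on each element $T$ by $$w_b=\tfrac1{12}|e_s|\rho^{-1}h^{-1}\bigl(\rho h^{-1}|e_s|\,Q_b(u_{yy})|_{e_s}-6\,Q_b(q_{2y})|_{e_s}\bigr)\ \text{ on } e_s,\ s=1,2,$$ $$w_b=\tfrac1{12}|e_s|\rho^{-1}h^{-1}\bigl(\rho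 h^{-1}|e_s|\,Q_b(u_{xx})|_{e_s}-6\,Q_b(q_{1x})|_{e_s}\bigr)\ \text{ on } e_s,\ s=3,4,$$ where the traces of $q_{2y}$ and $q_{1x}$ are taken from within $T$, and the values obtained on an interior edge from its two adjacent elements coincide, as $w_b\in V_b$ requires (this is automatic where $a$ does not jump across the edge). Let $u_h=\{u_0,u_b\}\in V_h$ satisfy $u_b=Q_bg+h^2w_b$ on $\partial\Omega$ and $$\sum_T(a\nabla_du_h,\nabla_dv)_T+s(u_h,v)=(f,v_0)\qquad\text{for all } v\in V_h^0,$$ and let $\widetilde e_b=(Q_bu+h^2w_b)-u_b$. Then $$\Bigl(\sum_T\|\nabla_d\widetilde e_b\|_T^2\Bigr)^{1/2}+|||\mathcal S(\widetilde e_b)-\widetilde e_b|||\le C\,h^2\,\|u\|_{3},$$ where $\|\cdot\|_3$ is the norm of $H^3(\Omega)$ and the constant $C$ depends only on $\rho,\lambda,\Lambda$ (not on the mesh, $a$, $f$, $g$ or $u$). -/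

import Mathlib

open MeasureTheory Filter Topology
open scoped ContDiff

noncomputable section

namespace WG

/-! ### Sobolev spaces on open subsets of the plane -/

/-- The classical partial derivative in `x`. -/
def dx (φ : ℝ × ℝ → ℝ) : ℝ × ℝ → ℝ := fun p => fderiv ℝ φ p (1, 0)

/-- The classical partial derivative in `y`. -/
def dy (φ : ℝ × ℝ → ℝ) : ℝ × ℝ → ℝ := fun p => fderiv ℝ φ p (0, 1)

/-- Test functions on `U`: smooth functions with compact support contained in `U`. -/
def IsTest (U : Set (ℝ × ℝ)) (φ : ℝ × ℝ → ℝ) : Prop :=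
  ContDiff ℝ ∞ φ ∧ HasCompactSupport φ ∧ tsupport φ ⊆ U

/-- `d ∈ L²(U)` is the weak derivative `∂_x^α ∂_y^β v` in `U`. -/
def IsWeakDeriv (U : Set (ℝ × ℝ)) (α β : ℕ) (v d : ℝ × ℝ → ℝ) : Prop :=
  MemLp d 2 (volume.restrict U) ∧
    ∀ φ, IsTest U φ →
      ∫ p in U, v p * (dx^[α]) ((dy^[β]) φ) p = (-1) ^ (α + β) * ∫ p in U, d p * φ p

/-- The Sobolev space `H^s(U)`. -/
def MemH (s : ℕ) (U : Set (ℝ × ℝ)) (v : ℝ × ℝ → ℝ) : Prop :=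
  MemLp v 2 (volume.restrict U) ∧ ∀ α β, α + β ≤ s → ∃ d, IsWeakDeriv U α β v d

open Classical in
/-- The weak derivative `∂_x^α ∂_y^β v` in `U` (unique up to null sets; zero if there is none). -/
def weakDeriv (U : Set (ℝ × ℝ)) (α β : ℕ) (v : ℝ × ℝ → ℝ) : ℝ × ℝ → ℝ :=
  if h : ∃ d, IsWeakDeriv U α β v d then h.choose else 0

/-- The norm `‖v‖_{s,U}` of `H^s(U)`. -/
def sobolevNorm (s : ℕ) (U : Set (ℝ × ℝ)) (v : ℝ × ℝ → ℝ) : ℝ :=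
  Real.sqrt (∑ α ∈ Finset.range (s + 1), ∑ β ∈ Finset.range (s + 1 - α),
    ∫ p in U, (weakDeriv U α β v p) ^ 2)

/-! ### Axis-parallel segments and traces -/

/-- The segment `{c} × [lo, hi]` (if `vertical`) or `[lo, hi] × {c}` (otherwise). -/
structure Seg where
  vertical : Bool
  c : ℝ
  lo : ℝ
  hi : ℝ

/-- Arc length parametrization, on `[lo, hi]`. -/
def Seg.pt (e : Seg) (τ : ℝ) : ℝ × ℝ := if e.vertical then (e.c, τ) else (τ, e.c)

def Seg.len (e : Seg) : ℝ := e.hi - e.lo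

/-- The line integral of `g` over the segment. -/
def Seg.int (e : Seg) (g : ℝ × ℝ → ℝ) : ℝ := ∫ τ in e.lo..e.hi, g (e.pt τ)

/-- The average of `g` over the segment, i.e. the `L²` projection onto constants. -/
def Seg.mean (e : Seg) (g : ℝ × ℝ → ℝ) : ℝ := e.int g / e.len

/-- `g` (only its values on `e` matter) is the trace on the segment `e ⊆ closure U` of the function
`v ∈ H¹(U)`: some functions that are smooth up to the boundary converge to `v` in `H¹(U)` while
their restrictions to `e` converge to `g` in `L²(e)`. -/
def IsTrace (U : Set (ℝ × ℝ)) (e : Seg) (v g : ℝ × ℝ → ℝ) : Prop :=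
  MemH 1 U v ∧ MemLp (fun τ => g (e.pt τ)) 2 (volume.restrict (Set.Ioc e.lo e.hi)) ∧
    ∃ φ : ℕ → ℝ × ℝ → ℝ, (∀ k, ContDiff ℝ ∞ (φ k)) ∧
      Tendsto (fun k => eLpNorm (φ k - v) 2 (volume.restrict U)) atTop (𝓝 0) ∧
      Tendsto (fun k => eLpNorm (dx (φ k) - weakDeriv U 1 0 v) 2 (volume.restrict U))
        atTop (𝓝 0) ∧
      Tendsto (fun k => eLpNorm (dy (φ k) - weakDeriv U 0 1 v) 2 (volume.restrict U))
        atTop (𝓝 0) ∧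
      Tendsto (fun k => eLpNorm (fun τ => φ k (e.pt τ) - g (e.pt τ)) 2
        (volume.restrict (Set.Ioc e.lo e.hi))) atTop (𝓝 0)

/-- `r` is the average over `e` of the trace of `v ∈ H¹(U)`, i.e. `Q_b v = r` on `e`. -/
def HasTraceMean (U : Set (ℝ × ℝ)) (e : Seg) (v : ℝ × ℝ → ℝ) (r : ℝ) : Prop :=
  ∃ g, IsTrace U e v g ∧ r = e.mean g

/-! ### Tensor product meshes of the unit square -/

/-- The domain `Ω = (0,1)²`. -/
def Omega : Set (ℝ × ℝ) := Set.Ioo 0 1 ×ˢ Set.Ioo 0 1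

/-- The four sides of `Ω`. -/
def side : Fin 4 → Seg :=
  ![⟨true, 0, 0, 1⟩, ⟨true, 1, 0, 1⟩, ⟨false, 0, 0, 1⟩, ⟨false, 1, 0, 1⟩]

/-- Two partitions `0 = x₀ < ⋯ < x_n = 1` and `0 = y₀ < ⋯ < y_m = 1` of the unit interval. -/
structure Mesh where
  n : ℕ
  m : ℕ
  x : Fin (n + 1) → ℝ
  y : Fin (m + 1) → ℝ
  x_mono : StrictMono x
  y_mono : StrictMono y
  x_zero : x 0 = 0
  x_last : x (Fin.last n) = 1
  y_zero : y 0 = 0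
  y_last : y (Fin.last m) = 1

namespace Mesh

variable (M : Mesh)

/-- The pair `(i, j)` stands for the element `[x_i, x_{i+1}] × [y_j, y_{j+1}]`. -/
abbrev Elem : Type := Fin M.n × Fin M.m

/-- The vertical edges `{x_i} × [y_j, y_{j+1}]` and the horizontal edges
`[x_i, x_{i+1}] × {y_j}`. -/
abbrev Edge : Type := (Fin (M.n + 1) × Fin M.m) ⊕ (Fin M.n × Fin (M.m + 1))

variable {M}

/-- The interior of an element. -/
def interior (T : M.Elem) : Set (ℝ × ℝ) :=
  Set.Ioo (M.x T.1.castSucc) (M.x T.1.succ) ×ˢ Set.Ioo (M.y T.2.castSucc) (M.y T.2.succ)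

def hx (T : M.Elem) : ℝ := M.x T.1.succ - M.x T.1.castSucc

def hy (T : M.Elem) : ℝ := M.y T.2.succ - M.y T.2.castSucc

def area (T : M.Elem) : ℝ := hx T * hy T

def seg : M.Edge → Seg
  | .inl e => ⟨true, M.x e.1, M.y e.2.castSucc, M.y e.2.succ⟩
  | .inr e => ⟨false, M.y e.2, M.x e.1.castSucc, M.x e.1.succ⟩

/-- The edges `e₁` (left), `e₂` (right), `e₃` (bottom), `e₄` (top) of an element. -/
def edge (T : M.Elem) : Fin 4 → M.Edge :=
  ![.inl (T.1.castSucc, T.2), .inl (T.1.succ, T.2),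
    .inr (T.1, T.2.castSucc), .inr (T.1, T.2.succ)]

/-- The edge lies on `∂Ω`. -/
def IsBdry : M.Edge → Prop
  | .inl e => e.1 = 0 ∨ e.1 = Fin.last M.n
  | .inr e => e.2 = 0 ∨ e.2 = Fin.last M.m

variable (M)

/-- The mesh size: the largest diameter of an element. -/
def h : ℝ := ⨆ T : M.Elem, Real.sqrt (hx T ^ 2 + hy T ^ 2)

end Mesh

/-- The outward unit normals on `e₁, e₂, e₃, e₄`. -/
def normal : Fin 4 → Fin 2 → ℝ := ![![-1, 0], ![1, 0], ![0, -1], ![0, 1]]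

/-! ### The lowest order weak Galerkin scheme -/

open Mesh

/-- The polynomial `c₀ + c₁ x + c₂ y`. -/
def affine (c : Fin 3 → ℝ) (p : ℝ × ℝ) : ℝ := c 0 + c 1 * p.1 + c 2 * p.2

/-- The space `V_h` for `k = 1`: a linear polynomial on each element (given by its coefficients)
and a constant on each edge. -/
structure WeakFun (M : Mesh) where
  v0 : M.Elem → Fin 3 → ℝ
  vb : M.Edge → ℝ

variable {M : Mesh}

/-- The discrete weak gradient on the element `T`; it is constant there, and characterized by
`weakGrad_iff`. It does not depend on the interior component. -/
def weakGrad (vb : M.Edge → ℝ) (T : M.Elem) : Fin 2 → ℝ :=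
  ![(vb (edge T 1) - vb (edge T 0)) / hx T, (vb (edge T 3) - vb (edge T 2)) / hy T]

/-- The extension `S(v_b)` on `T` (coefficients of a linear polynomial), characterized by
`extS_iff`. -/
def extS (vb : M.Edge → ℝ) (T : M.Elem) : Fin 3 → ℝ :=
  let G := weakGrad vb T
  ![(hy T * (vb (edge T 0) + vb (edge T 1)) + hx T * (vb (edge T 2) + vb (edge T 3)))
        / (2 * (hx T + hy T))
      - G 0 * ((M.x T.1.castSucc + M.x T.1.succ) / 2)
      - G 1 * ((M.y T.2.castSucc + M.y T.2.succ) / 2), G 0, G 1]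

/-- The bilinear form `(a ∇_d w, ∇_d v)_h`, for `a` constant on each element. -/
def gradForm (a : M.Elem → Matrix (Fin 2) (Fin 2) ℝ) (wb vb : M.Edge → ℝ) : ℝ :=
  ∑ T : M.Elem, area T * ((a T).mulVec (weakGrad wb T) ⬝ᵥ weakGrad vb T)

/-- The stabilizer `s(w, v) = ρ h⁻¹ ∑_T ⟨w_b - Q_b w₀, v_b - Q_b v₀⟩_{∂T}`. -/
def stab (ρ : ℝ) (w v : WeakFun M) : ℝ :=
  ρ * M.h⁻¹ * ∑ T : M.Elem, ∑ s : Fin 4, (seg (edge T s)).len *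
    ((w.vb (edge T s) - (seg (edge T s)).mean (affine (w.v0 T))) *
      (v.vb (edge T s) - (seg (edge T s)).mean (affine (v.v0 T))))

/-- `uh` solves the weak Galerkin scheme with right-hand side `f` and boundary values `gb`. -/
def IsWGSolution (ρ : ℝ) (a : M.Elem → Matrix (Fin 2) (Fin 2) ℝ) (f : ℝ × ℝ → ℝ)
    (gb : M.Edge → ℝ) (uh : WeakFun M) : Prop :=
  (∀ e, IsBdry e → uh.vb e = gb e) ∧
    ∀ v : WeakFun M, (∀ e, IsBdry e → v.vb e = 0) →
      gradForm a uh.vb v.vb + stab ρ uh v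
        = ∑ T : M.Elem, ∫ p in interior T, f p * affine (v.v0 T) p

/-- The norm `‖∇_d v_b‖`. -/
def gradNorm (vb : M.Edge → ℝ) : ℝ :=
  Real.sqrt (∑ T : M.Elem, area T * (weakGrad vb T ⬝ᵥ weakGrad vb T))

/-- The quantity `|||S(v_b) - v_b|||`. -/
def stabNorm (ρ : ℝ) (vb : M.Edge → ℝ) : ℝ :=
  Real.sqrt (ρ * M.h⁻¹ * ∑ T : M.Elem, ∑ s : Fin 4, (seg (edge T s)).len *
    ((seg (edge T s)).mean (affine (extS vb T)) - vb (edge T s)) ^ 2)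

/-! ### The boundary value problem and the correction -/

/-- A symmetric coefficient tensor, constant on each element, with spectrum in `[lam, Lam]`. -/
def IsCoeff (lam Lam : ℝ) (a : M.Elem → Matrix (Fin 2) (Fin 2) ℝ) : Prop :=
  ∀ T, (a T).IsSymm ∧ ∀ ξ : Fin 2 → ℝ,
    lam * (ξ ⬝ᵥ ξ) ≤ (a T).mulVec ξ ⬝ᵥ ξ ∧ (a T).mulVec ξ ⬝ᵥ ξ ≤ Lam * (ξ ⬝ᵥ ξ)

/-- The component `q_{k+1}` of the flux `q = a ∇u` on the element `T`. -/
def flux (a : M.Elem → Matrix (Fin 2) (Fin 2) ℝ) (u : ℝ × ℝ → ℝ) (T : M.Elem) (k : Fin 2) :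
    ℝ × ℝ → ℝ :=
  fun p => a T k 0 * weakDeriv Omega 1 0 u p + a T k 1 * weakDeriv Omega 0 1 u p

/-- `-∇·(a∇u) = f` in `Ω` in the sense of distributions, and `u = g` on `∂Ω` in the sense of
traces. -/
def IsSolution (a : M.Elem → Matrix (Fin 2) (Fin 2) ℝ) (f g u : ℝ × ℝ → ℝ) : Prop :=
  (∀ φ, IsTest Omega φ →
    ∑ T : M.Elem, ∫ p in interior T, (flux a u T 0 p * dx φ p + flux a u T 1 p * dy φ p)
      = ∫ p in Omega, f p * φ p) ∧
  ∀ s, IsTrace Omega (side s) u g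

/-- `w ∈ V_b` is given on every element by the formulas that define the correction; the traces are
taken from within the element. -/
def IsCorrection (ρ : ℝ) (a : M.Elem → Matrix (Fin 2) (Fin 2) ℝ) (u : ℝ × ℝ → ℝ)
    (w : M.Edge → ℝ) : Prop :=
  ∀ T : M.Elem,
    (∀ s : Fin 4, s = 0 ∨ s = 1 → ∃ r t : ℝ,
      HasTraceMean (interior T) (seg (edge T s)) (weakDeriv Omega 0 2 u) r ∧
      HasTraceMean (interior T) (seg (edge T s)) (weakDeriv (interior T) 0 1 (flux a u T 1)) t ∧
      w (edge T s) = 1 / 12 * (seg (edge T s)).len * ρ⁻¹ * M.h⁻¹ *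
        (ρ * M.h⁻¹ * (seg (edge T s)).len * r - 6 * t)) ∧
    (∀ s : Fin 4, s = 2 ∨ s = 3 → ∃ r t : ℝ,
      HasTraceMean (interior T) (seg (edge T s)) (weakDeriv Omega 2 0 u) r ∧
      HasTraceMean (interior T) (seg (edge T s)) (weakDeriv (interior T) 1 0 (flux a u T 0)) t ∧
      w (edge T s) = 1 / 12 * (seg (edge T s)).len * ρ⁻¹ * M.h⁻¹ *
        (ρ * M.h⁻¹ * (seg (edge T s)).len * r - 6 * t))

/-- `Qu = Q_b u`: on each edge the average of the trace of `u ∈ H¹(Ω)`. -/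
def IsEdgeProjection (u : ℝ × ℝ → ℝ) (Qu : M.Edge → ℝ) : Prop :=
  ∀ e, HasTraceMean Omega (seg e) u (Qu e)

/-! ### The defining properties of the discrete weak gradient and of the extension -/

theorem hx_pos (T : M.Elem) : 0 < hx T := sub_pos.2 (M.x_mono Fin.castSucc_lt_succ)

theorem hy_pos (T : M.Elem) : 0 < hy T := sub_pos.2 (M.y_mono Fin.castSucc_lt_succ)

/-- `(∇_d v, ψ)_T = ⟨v_b, ψ·n⟩_{∂T}` for all constant `ψ` (whose divergence is zero). -/
theorem weakGrad_iff (vb : M.Edge → ℝ) (T : M.Elem) (G : Fin 2 → ℝ) :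
    (∀ ψ : Fin 2 → ℝ, area T * (G ⬝ᵥ ψ)
      = ∑ s : Fin 4, (seg (edge T s)).len * (vb (edge T s) * (ψ ⬝ᵥ normal s)))
      ↔ G = weakGrad vb T := by
  have h1 := hx_pos T
  have h2 := hy_pos T
  have e0 : (seg (edge T 0)).len = hy T := rfl
  have e1 : (seg (edge T 1)).len = hy T := rfl
  have e2 : (seg (edge T 2)).len = hx T := rfl
  have e3 : (seg (edge T 3)).len = hx T := rfl
  simp only [Fin.sum_univ_four, e0, e1, e2, e3, area, dotProduct, Fin.sum_univ_two, normal]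
  constructor
  · intro H
    have H0 := H ![1, 0]
    have H1 := H ![0, 1]
    simp at H0 H1
    funext k
    fin_cases k
    · simp only [weakGrad, Fin.zero_eta, Matrix.cons_val_zero]
      rw [eq_div_iff h1.ne']
      apply mul_left_cancel₀ h2.ne'
      linarith
    · simp only [weakGrad, Fin.mk_one, Matrix.cons_val_one, Matrix.cons_val_zero]
      rw [eq_div_iff h2.ne']
      apply mul_left_cancel₀ h1.ne'
      linarith
  · rintro rfl ψ
    simp [weakGrad]
    field_simp
    ring

theorem integral_linear (A B lo hi : ℝ) :
    ∫ τ in lo..hi, (A + B * τ) = (A + B * ((lo + hi) / 2)) * (hi - lo) := by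
  rw [intervalIntegral.integral_add (by simp) (Continuous.intervalIntegrable (by fun_prop) _ _)]
  rw [intervalIntegral.integral_const_mul, integral_id, intervalIntegral.integral_const, smul_eq_mul]
  ring

theorem mean_affine (c : Fin 3 → ℝ) (e : Seg) (he : e.lo < e.hi) :
    e.mean (affine c) = affine c (e.pt ((e.lo + e.hi) / 2)) := by
  have hne : e.hi - e.lo ≠ 0 := (sub_pos.2 he).ne'
  rcases e with ⟨b, c', lo, hi⟩
  cases b
  · have key := integral_linear (c 0 + c 2 * c') (c 1) lo hi
    have e1 : ∀ τ : ℝ, affine c ((Seg.mk false c' lo hi).pt τ) = c 0 + c 2 * c' + c 1 * τ := by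
      intro τ
      simp only [affine, Seg.pt, Bool.false_eq_true, if_false]
      ring
    simp only [Seg.mean, Seg.int, Seg.len, e1]
    rw [div_eq_iff hne, key]
  · have key := integral_linear (c 0 + c 1 * c') (c 2) lo hi
    have e1 : ∀ τ : ℝ, affine c ((Seg.mk true c' lo hi).pt τ) = c 0 + c 1 * c' + c 2 * τ := by
      intro τ
      simp only [affine, Seg.pt, if_true]
    simp only [Seg.mean, Seg.int, Seg.len, e1]
    rw [div_eq_iff hne, key]

/-- `⟨S(v_b), Q_b φ⟩_{∂T} = ⟨v_b, φ⟩_{∂T}` for all linear polynomials `φ`. -/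
theorem extS_iff (vb : M.Edge → ℝ) (T : M.Elem) (d : Fin 3 → ℝ) :
    (∀ c : Fin 3 → ℝ,
      ∑ s : Fin 4, (seg (edge T s)).int
          (fun p => affine d p * (seg (edge T s)).mean (affine c))
        = ∑ s : Fin 4, (seg (edge T s)).int (fun p => vb (edge T s) * affine c p))
      ↔ d = extS vb T := by
  have h1 := hx_pos T
  have h2 := hy_pos T
  have l0 : (seg (edge T 0)).len = hy T := rfl
  have l1 : (seg (edge T 1)).len = hy T := rfl
  have l2 : (seg (edge T 2)).len = hx T := rfl
  have l3 : (seg (edge T 3)).len = hx T := rfl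
  have hlt : ∀ s : Fin 4, (seg (edge T s)).lo < (seg (edge T s)).hi := by
    intro s
    fin_cases s
    · exact sub_pos.1 h2
    · exact sub_pos.1 h2
    · exact sub_pos.1 h1
    · exact sub_pos.1 h1
  have key : ∀ (e : Seg), e.lo < e.hi → ∀ c : Fin 3 → ℝ,
      e.int (affine c) = e.len * affine c (e.pt ((e.lo + e.hi) / 2)) := by
    intro e he c
    rw [← mean_affine c e he, Seg.mean, mul_div_cancel₀]
    exact (sub_pos.2 he).ne'
  have kl : ∀ (s : Fin 4) (c : Fin 3 → ℝ), (seg (edge T s)).int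
      (fun p => affine d p * (seg (edge T s)).mean (affine c))
      = (seg (edge T s)).len *
        affine d ((seg (edge T s)).pt (((seg (edge T s)).lo + (seg (edge T s)).hi) / 2)) *
        affine c ((seg (edge T s)).pt (((seg (edge T s)).lo + (seg (edge T s)).hi) / 2)) := by
    intro s c
    rw [mean_affine c _ (hlt s), ← key _ (hlt s)]
    simp only [Seg.int, intervalIntegral.integral_mul_const]
  have kr : ∀ (s : Fin 4) (c : Fin 3 → ℝ), (seg (edge T s)).int
      (fun p => vb (edge T s) * affine c p)
      = (seg (edge T s)).len * vb (edge T s) *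
        affine c ((seg (edge T s)).pt (((seg (edge T s)).lo + (seg (edge T s)).hi) / 2)) := by
    intro s c
    rw [mul_comm (Seg.len _), mul_assoc, ← key _ (hlt s)]
    simp only [Seg.int, intervalIntegral.integral_const_mul]
  have p0 : (seg (edge T 0)).pt (((seg (edge T 0)).lo + (seg (edge T 0)).hi) / 2)
      = (M.x T.1.castSucc, (M.y T.2.castSucc + M.y T.2.succ) / 2) := rfl
  have p1 : (seg (edge T 1)).pt (((seg (edge T 1)).lo + (seg (edge T 1)).hi) / 2)
      = (M.x T.1.succ, (M.y T.2.castSucc + M.y T.2.succ) / 2) := rfl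
  have p2 : (seg (edge T 2)).pt (((seg (edge T 2)).lo + (seg (edge T 2)).hi) / 2)
      = ((M.x T.1.castSucc + M.x T.1.succ) / 2, M.y T.2.castSucc) := rfl
  have p3 : (seg (edge T 3)).pt (((seg (edge T 3)).lo + (seg (edge T 3)).hi) / 2)
      = ((M.x T.1.castSucc + M.x T.1.succ) / 2, M.y T.2.succ) := rfl
  simp only [kl, kr, Fin.sum_univ_four, l0, l1, l2, l3, p0, p1, p2, p3]
  have hxs : M.x T.1.succ = M.x T.1.castSucc + hx T := by simp [hx]
  have hys : M.y T.2.succ = M.y T.2.castSucc + hy T := by simp [hy]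
  simp only [affine, extS, weakGrad, hxs, hys]
  generalize M.x T.1.castSucc = X
  generalize M.y T.2.castSucc = Y
  generalize vb (edge T 0) = v0
  generalize vb (edge T 1) = v1
  generalize vb (edge T 2) = v2
  generalize vb (edge T 3) = v3
  generalize hx T = A at *
  generalize hy T = B at *
  have hAB : A + B ≠ 0 := (add_pos h1 h2).ne'
  have hA := h1.ne'
  have hB := h2.ne'
  constructor
  · intro H
    have H0 := H ![1, 0, 0]
    have H1 := H ![-(X + A / 2), 1, 0]
    have H2 := H ![-(Y + B / 2), 0, 1]
    simp at H0 H1 H2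
    have g1 : d 1 = (v1 - v0) / A := by
      rw [eq_div_iff hA]
      apply mul_left_cancel₀ (mul_ne_zero hA hB)
      linear_combination 2 * H1
    have g2 : d 2 = (v3 - v2) / B := by
      rw [eq_div_iff hB]
      apply mul_left_cancel₀ (mul_ne_zero hA hB)
      linear_combination 2 * H2
    have g0 : d 0 + d 1 * (X + A / 2) + d 2 * (Y + B / 2)
        = (B * (v0 + v1) + A * (v2 + v3)) / (2 * (A + B)) := by
      rw [eq_div_iff (mul_ne_zero two_ne_zero hAB)]
      linear_combination H0
    funext k
    fin_cases k
    · simp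
      rw [← g0, ← g1, ← g2]
      ring
    · simpa using g1
    · simpa using g2
  · rintro rfl c
    simp
    field_simp
    ring

end WG

end

noncomputable section

namespace WG

/-! ### Partial derivatives of smooth functions -/

/-! The scheme is tested with `{S(e_b), e_b}`, where `e_b` is the error against `Q_b u + h² w`. By
the definition of `S`, the residual `e_b - Q_b S(e_b)` is orthogonal on `∂T` to all edge averages of
linear polynomials, so `u₀` drops out of the stabilizer (`stab_extS`) and an equation for edge
values alone remains. On a rectangle this orthogonal complement is a line: the residual is `θ|e₃|`
on vertical and `-θ|e₁|` on horizontal edges, with `θ` given by `defect`. Hence the stabilizer only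
sees the combination `z₀ + z₁ - z₂ - z₃` of the edge values.

For `Q_b u`, the discrete gradient is the exact mean of `∇u`, and `f = -∇·q` holds on each element.
Up to edge fluxes, the consistency error on `T` is therefore a combination of the centred moments `∫
∂_y q₂ (x - x_T)` and `∫ ∂_x q₁ (y - y_T)`, and of `θ` times `|e₃| ∫ ∂_x q₁ - |e₁| ∫ ∂_y q₂`
(`IsSolution.consistency`). The edge fluxes cancel in the sum over `T`: the average of the normal
flux is the same from both sides of an interior edge (`normal_flux_fst`, `normal_flux_snd`), and
`e_b = 0` on `∂Ω`.

The centred moments are small because an integration by parts turns them into integrals of third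
derivatives of `u` against a bubble of size `h²`. The `θ` terms are too large without a correction.
They contain the fluxes above and, from the stabilizer, the moments of `u_x` and `u_y`, whose
leading parts are `|e₃|²/12 ∫ u_xx` and `|e₁|²/12 ∫ u_yy` (`sq_moment_fst_sub_le`,
`sq_moment_snd_sub_le`). The correction `h² w` cancels exactly these second order terms; third
derivatives remain. Its own discrete gradient is a difference across the element and also involves
third derivatives only (`IsCorrection.vertical`, `IsCorrection.horizontal`).

Young's inequality absorbs one half of the energy of `e_b` on each element (`element_estimate`) and
leaves `h⁴` times squared norms of third derivatives. The area of `T` cancels in this step, so the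
mesh need not be shape regular.

Traces enter only through edge averages, and Green's formula expresses such an average by integrals
over an element (`HasTraceMean.eq_left` and its analogues). No trace theorem is needed. Integration
by parts against functions that merely vanish on the boundary is obtained by cutting off bubbles
near their zeros. -/

theorem dx_eq_of_hasDerivAt {φ : ℝ × ℝ → ℝ} {p : ℝ × ℝ} {D : ℝ} (hφ : DifferentiableAt ℝ φ p)
    (h : HasDerivAt (fun t => φ (t, p.2)) D p.1) : dx φ p = D := by
  have h1 : HasDerivAt (fun t : ℝ => (t, p.2)) ((1 : ℝ), (0 : ℝ)) p.1 :=
    (hasDerivAt_id p.1).prodMk (hasDerivAt_const p.1 p.2)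
  have h2 : HasDerivAt (fun t => φ (t, p.2)) (fderiv ℝ φ p (1, 0)) p.1 :=
    HasFDerivAt.comp_hasDerivAt (f := fun t : ℝ => (t, p.2)) p.1
      (by simpa using hφ.hasFDerivAt) h1
  exact h2.unique h

theorem dy_eq_of_hasDerivAt {φ : ℝ × ℝ → ℝ} {p : ℝ × ℝ} {D : ℝ} (hφ : DifferentiableAt ℝ φ p)
    (h : HasDerivAt (fun t => φ (p.1, t)) D p.2) : dy φ p = D := by
  have h1 : HasDerivAt (fun t : ℝ => (p.1, t)) ((0 : ℝ), (1 : ℝ)) p.2 :=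
    (hasDerivAt_const p.2 p.1).prodMk (hasDerivAt_id p.2)
  have h2 : HasDerivAt (fun t => φ (p.1, t)) (fderiv ℝ φ p (0, 1)) p.2 :=
    HasFDerivAt.comp_hasDerivAt (f := fun t : ℝ => (p.1, t)) p.2
      (by simpa using hφ.hasFDerivAt) h1
  exact h2.unique h

theorem hasDerivAt_dx {φ : ℝ × ℝ → ℝ} (hφ : ContDiff ℝ ∞ φ) (x y : ℝ) :
    HasDerivAt (fun t => φ (t, y)) (dx φ (x, y)) x := by
  have h1 : HasDerivAt (fun t : ℝ => (t, y)) ((1 : ℝ), (0 : ℝ)) x :=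
    (hasDerivAt_id x).prodMk (hasDerivAt_const x y)
  exact HasFDerivAt.comp_hasDerivAt (f := fun t : ℝ => (t, y)) x
    (hφ.differentiable (by simp) (x, y)).hasFDerivAt h1

theorem hasDerivAt_dy {φ : ℝ × ℝ → ℝ} (hφ : ContDiff ℝ ∞ φ) (x y : ℝ) :
    HasDerivAt (fun t => φ (x, t)) (dy φ (x, y)) y := by
  have h1 : HasDerivAt (fun t : ℝ => (x, t)) ((0 : ℝ), (1 : ℝ)) y :=
    (hasDerivAt_const y x).prodMk (hasDerivAt_id y)
  exact HasFDerivAt.comp_hasDerivAt (f := fun t : ℝ => (x, t)) y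
    (hφ.differentiable (by simp) (x, y)).hasFDerivAt h1

theorem contDiff_dx {φ : ℝ × ℝ → ℝ} (hφ : ContDiff ℝ ∞ φ) : ContDiff ℝ ∞ (dx φ) :=
  (hφ.fderiv_right (m := ∞) (by simp)).clm_apply contDiff_const

theorem contDiff_dy {φ : ℝ × ℝ → ℝ} (hφ : ContDiff ℝ ∞ φ) : ContDiff ℝ ∞ (dy φ) :=
  (hφ.fderiv_right (m := ∞) (by simp)).clm_apply contDiff_const

theorem dx_dy_comm {φ : ℝ × ℝ → ℝ} (hφ : ContDiff ℝ ∞ φ) : dx (dy φ) = dy (dx φ) := by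
  funext p
  have hs : IsSymmSndFDerivAt ℝ φ p :=
    hφ.contDiffAt.isSymmSndFDerivAt (by simp; exact WithTop.coe_le_coe.2 le_top)
  have hd : DifferentiableAt ℝ (fderiv ℝ φ) p :=
    (hφ.fderiv_right (m := ∞) (by simp)).differentiable (by simp) p
  have e1 : dx (dy φ) p = fderiv ℝ (fderiv ℝ φ) p (1, 0) (0, 1) := by
    unfold dx dy
    rw [fderiv_clm_apply hd (differentiableAt_const _)]
    simp
  have e2 : dy (dx φ) p = fderiv ℝ (fderiv ℝ φ) p (0, 1) (1, 0) := by
    unfold dx dy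
    rw [fderiv_clm_apply hd (differentiableAt_const _)]
    simp
  rw [e1, e2]
  exact hs _ _

theorem tsupport_dx_subset (φ : ℝ × ℝ → ℝ) : tsupport (dx φ) ⊆ tsupport φ :=
  tsupport_fderiv_apply_subset ℝ (1, 0)

theorem tsupport_dy_subset (φ : ℝ × ℝ → ℝ) : tsupport (dy φ) ⊆ tsupport φ :=
  tsupport_fderiv_apply_subset ℝ (0, 1)

theorem IsTest.dx {U : Set (ℝ × ℝ)} {φ : ℝ × ℝ → ℝ} (h : IsTest U φ) : IsTest U (dx φ) :=
  ⟨contDiff_dx h.1, h.2.1.of_isClosed_subset (isClosed_tsupport _) (tsupport_dx_subset φ),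
    (tsupport_dx_subset φ).trans h.2.2⟩

theorem IsTest.dy {U : Set (ℝ × ℝ)} {φ : ℝ × ℝ → ℝ} (h : IsTest U φ) : IsTest U (dy φ) :=
  ⟨contDiff_dy h.1, h.2.1.of_isClosed_subset (isClosed_tsupport _) (tsupport_dy_subset φ),
    (tsupport_dy_subset φ).trans h.2.2⟩

theorem IsTest.mono {U V : Set (ℝ × ℝ)} {φ : ℝ × ℝ → ℝ} (h : IsTest U φ) (hUV : U ⊆ V) :
    IsTest V φ :=
  ⟨h.1, h.2.1, h.2.2.trans hUV⟩

theorem IsTest.eq_zero {U : Set (ℝ × ℝ)} {φ : ℝ × ℝ → ℝ} (h : IsTest U φ) {p : ℝ × ℝ}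
    (hp : p ∉ U) : φ p = 0 :=
  image_eq_zero_of_notMem_tsupport fun h' => hp (h.2.2 h')

/-! ### Approximation by test functions -/

/-- A smooth function that vanishes on `(-∞, 1]` and has derivative one on `(2, ∞)`. -/
def ramp (s : ℝ) : ℝ := s * Real.smoothTransition (s - 1)

theorem contDiff_ramp : ContDiff ℝ ∞ ramp :=
  contDiff_id.mul (Real.smoothTransition.contDiff.comp (contDiff_id.sub contDiff_const))

theorem ramp_of_le {s : ℝ} (hs : s ≤ 1) : ramp s = 0 := by
  rw [ramp, Real.smoothTransition.zero_of_nonpos (by linarith), mul_zero]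

theorem ramp_of_ge {s : ℝ} (hs : 2 ≤ s) : ramp s = s := by
  rw [ramp, Real.smoothTransition.one_of_one_le (by linarith), mul_one]

theorem abs_ramp_le (s : ℝ) : |ramp s| ≤ |s| := by
  rw [ramp, abs_mul, abs_of_nonneg (Real.smoothTransition.nonneg _)]
  exact mul_le_of_le_one_right (abs_nonneg _) (Real.smoothTransition.le_one _)

theorem deriv_ramp_of_lt {s : ℝ} (hs : s < 1) : deriv ramp s = 0 := by
  have : ramp =ᶠ[𝓝 s] fun _ => 0 := by
    filter_upwards [eventually_lt_nhds hs] with t ht using ramp_of_le ht.le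
  rw [this.deriv_eq, deriv_const]

theorem deriv_ramp_of_gt {s : ℝ} (hs : 2 < s) : deriv ramp s = 1 := by
  have : ramp =ᶠ[𝓝 s] fun t => t := by
    filter_upwards [eventually_gt_nhds hs] with t ht using ramp_of_ge ht.le
  rw [this.deriv_eq, deriv_id'']

/-- Outside the compact interval `[1, 2]` the derivative is `0` or `1`. -/
theorem exists_abs_deriv_ramp_le : ∃ K : ℝ, ∀ s, |deriv ramp s| ≤ K := by
  have hc : Continuous (deriv ramp) := contDiff_ramp.continuous_deriv (by simp)
  obtain ⟨K, hK⟩ := (isCompact_Icc (a := (1 : ℝ)) (b := 2)).exists_bound_of_continuousOn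
    hc.continuousOn
  refine ⟨max K 1, fun s => ?_⟩
  rcases lt_or_ge s 1 with h1 | h1
  · rw [deriv_ramp_of_lt h1]; simp
  rcases lt_or_ge 2 s with h2 | h2
  · rw [deriv_ramp_of_gt h2]; simp
  · exact (hK s ⟨h1, h2⟩).trans (le_max_left _ _)

/-- `scaledRamp k t = ramp (k t) / k` (with `k + 1` in place of `k`) tends to `t` for `t > 0`. -/
def scaledRamp (k : ℕ) (t : ℝ) : ℝ := ramp ((k + 1) * t) / (k + 1)

theorem contDiff_scaledRamp (k : ℕ) : ContDiff ℝ ∞ (scaledRamp k) :=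
  (contDiff_ramp.comp (contDiff_const.mul contDiff_id)).div_const _

theorem abs_scaledRamp_le (k : ℕ) (t : ℝ) : |scaledRamp k t| ≤ |t| := by
  have hk : (0 : ℝ) < k + 1 := by positivity
  rw [scaledRamp, abs_div, abs_of_pos hk, div_le_iff₀ hk]
  refine (abs_ramp_le _).trans_eq ?_
  rw [abs_mul, abs_of_pos hk, mul_comm]

theorem hasDerivAt_scaledRamp (k : ℕ) (t : ℝ) :
    HasDerivAt (scaledRamp k) (deriv ramp ((k + 1) * t)) t := by
  have hk : (0 : ℝ) < k + 1 := by positivity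
  have h1 : HasDerivAt ramp (deriv ramp ((k + 1) * t)) ((k + 1) * t) :=
    (contDiff_ramp.differentiable (by simp) _).hasDerivAt
  have h2 : HasDerivAt (fun t : ℝ => ((k : ℝ) + 1) * t) (k + 1) t := by
    simpa using (hasDerivAt_id t).const_mul ((k : ℝ) + 1)
  have h3 := (h1.comp t h2).div_const ((k : ℝ) + 1)
  rwa [mul_div_cancel_right₀ _ hk.ne'] at h3

theorem scaledRamp_of_le {k : ℕ} {t : ℝ} (h : (k + 1) * t ≤ 1) : scaledRamp k t = 0 := by
  rw [scaledRamp, ramp_of_le h, zero_div]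

theorem eventually_lt_succ_mul {t : ℝ} (ht : 0 < t) (R : ℝ) :
    ∀ᶠ k : ℕ in atTop, R < (k + 1) * t := by
  have h : Tendsto (fun k : ℕ => ((k : ℝ) + 1) * t) atTop atTop :=
    (tendsto_atTop_add_const_right _ _ tendsto_natCast_atTop_atTop).atTop_mul_const ht
  exact h.eventually_gt_atTop R

theorem tendsto_scaledRamp {t : ℝ} (ht : 0 < t) :
    Tendsto (fun k => scaledRamp k t) atTop (𝓝 t) := by
  refine tendsto_const_nhds.congr' ?_
  filter_upwards [eventually_lt_succ_mul ht 2] with k hk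
  rw [scaledRamp, ramp_of_ge hk.le, mul_div_cancel_left₀]
  positivity

theorem tendsto_deriv_scaledRamp {t : ℝ} (ht : 0 < t) :
    Tendsto (fun k : ℕ => deriv ramp ((k + 1) * t)) atTop (𝓝 1) := by
  refine tendsto_const_nhds.congr' ?_
  filter_upwards [eventually_lt_succ_mul ht 2] with k hk
  rw [deriv_ramp_of_gt hk]

/-- The open rectangle `(a, b) × (c, d)`. -/
abbrev rect (a b c d : ℝ) : Set (ℝ × ℝ) := Set.Ioo a b ×ˢ Set.Ioo c d

/-- The bubble `(t - a) (b - t)`. -/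
def bubble (a b t : ℝ) : ℝ := (t - a) * (b - t)

theorem bubble_pos {a b t : ℝ} (h : t ∈ Set.Ioo a b) : 0 < bubble a b t :=
  mul_pos (sub_pos.2 h.1) (sub_pos.2 h.2)

theorem mem_Ioo_of_bubble_pos {a b t : ℝ} (hab : a < b) (h : 0 < bubble a b t) :
    t ∈ Set.Ioo a b := by
  rcases mul_pos_iff.1 h with h | h
  · exact ⟨by linarith [h.1], by linarith [h.2]⟩
  · linarith [h.1, h.2]

theorem contDiff_bubble (a b : ℝ) : ContDiff ℝ ∞ (bubble a b) := by
  unfold bubble; fun_prop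

theorem hasDerivAt_bubble (a b t : ℝ) : HasDerivAt (bubble a b) (a + b - 2 * t) t := by
  have := ((hasDerivAt_id t).sub_const a).mul ((hasDerivAt_id t).const_sub b)
  refine this.congr_deriv ?_
  simp; ring

/-- Approximants of `bubble a b x * bubble c d y * ψ`. -/
def bubbleTest (a b c d : ℝ) (ψ : ℝ × ℝ → ℝ) (k : ℕ) (p : ℝ × ℝ) : ℝ :=
  scaledRamp k (bubble a b p.1) * scaledRamp k (bubble c d p.2) * ψ p

theorem contDiff_bubbleTest (a b c d : ℝ) {ψ : ℝ × ℝ → ℝ} (hψ : ContDiff ℝ ∞ ψ) (k : ℕ) :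
    ContDiff ℝ ∞ (bubbleTest a b c d ψ k) :=
  ((((contDiff_scaledRamp k).comp ((contDiff_bubble a b).comp contDiff_fst))).mul
    ((contDiff_scaledRamp k).comp ((contDiff_bubble c d).comp contDiff_snd))).mul hψ

/-- Where the product is nonzero both bubbles are at least `1 / (k + 1)`. This closed condition
confines the support to the open rectangle, since a bubble is positive only inside its interval. -/
theorem isTest_bubbleTest {a b c d : ℝ} (hab : a < b) (hcd : c < d) {ψ : ℝ × ℝ → ℝ}
    (hψ : ContDiff ℝ ∞ ψ) (k : ℕ) : IsTest (rect a b c d) (bubbleTest a b c d ψ k) := by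
  have hk : (0 : ℝ) < k + 1 := by positivity
  set S : Set (ℝ × ℝ) := {p | 1 ≤ (k + 1) * bubble a b p.1} ∩ {p | 1 ≤ (k + 1) * bubble c d p.2}
  have hcx : Continuous fun p : ℝ × ℝ => ((k : ℝ) + 1) * bubble a b p.1 :=
    continuous_const.mul ((contDiff_bubble a b).continuous.comp continuous_fst)
  have hcy : Continuous fun p : ℝ × ℝ => ((k : ℝ) + 1) * bubble c d p.2 :=
    continuous_const.mul ((contDiff_bubble c d).continuous.comp continuous_snd)
  have hS : IsClosed S :=
    (isClosed_le continuous_const hcx).inter (isClosed_le continuous_const hcy)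
  have hsub : tsupport (bubbleTest a b c d ψ k) ⊆ S := by
    refine closure_minimal (fun p hp => ?_) hS
    by_contra hpS
    apply hp
    rcases not_and_or.1 hpS with h | h
    · rw [bubbleTest, scaledRamp_of_le (not_le.1 h).le]; ring
    · rw [bubbleTest, scaledRamp_of_le (t := bubble c d p.2) (not_le.1 h).le]; ring
  have hSR : S ⊆ rect a b c d := by
    rintro p ⟨h1, h2⟩
    exact ⟨mem_Ioo_of_bubble_pos hab (pos_of_mul_pos_right (zero_lt_one.trans_le h1) hk.le),
      mem_Ioo_of_bubble_pos hcd (pos_of_mul_pos_right (zero_lt_one.trans_le h2) hk.le)⟩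
  refine ⟨contDiff_bubbleTest a b c d hψ k, ?_, hsub.trans hSR⟩
  refine IsCompact.of_isClosed_subset (isCompact_Icc.prod isCompact_Icc) (isClosed_tsupport _)
    ((hsub.trans hSR).trans (Set.prod_mono Set.Ioo_subset_Icc_self Set.Ioo_subset_Icc_self))

theorem dx_bubbleTest (a b c d : ℝ) {ψ : ℝ × ℝ → ℝ} (hψ : ContDiff ℝ ∞ ψ) (k : ℕ) (p : ℝ × ℝ) :
    dx (bubbleTest a b c d ψ k) p =
      deriv ramp ((k + 1) * bubble a b p.1) * (a + b - 2 * p.1) *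
          scaledRamp k (bubble c d p.2) * ψ p +
        scaledRamp k (bubble a b p.1) * scaledRamp k (bubble c d p.2) * dx ψ p :=
  dx_eq_of_hasDerivAt ((contDiff_bubbleTest a b c d hψ k).differentiable (by simp) p)
    ((((hasDerivAt_scaledRamp k _).comp p.1 (hasDerivAt_bubble a b p.1)).mul_const
      (scaledRamp k (bubble c d p.2))).mul
      (hasDerivAt_dx hψ p.1 p.2))

theorem dy_bubbleTest (a b c d : ℝ) {ψ : ℝ × ℝ → ℝ} (hψ : ContDiff ℝ ∞ ψ) (k : ℕ) (p : ℝ × ℝ) :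
    dy (bubbleTest a b c d ψ k) p =
      scaledRamp k (bubble a b p.1) *
          (deriv ramp ((k + 1) * bubble c d p.2) * (c + d - 2 * p.2)) * ψ p +
        scaledRamp k (bubble a b p.1) * scaledRamp k (bubble c d p.2) * dy ψ p :=
  dy_eq_of_hasDerivAt ((contDiff_bubbleTest a b c d hψ k).differentiable (by simp) p)
    ((((hasDerivAt_scaledRamp k _).comp p.2 (hasDerivAt_bubble c d p.2)).const_mul
      (scaledRamp k (bubble a b p.1))).mul
      (hasDerivAt_dy hψ p.1 p.2))

/-- The product `bubble a b x * bubble c d y * ψ`. -/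
def bubbleMul (a b c d : ℝ) (ψ : ℝ × ℝ → ℝ) (p : ℝ × ℝ) : ℝ :=
  bubble a b p.1 * bubble c d p.2 * ψ p

theorem contDiff_bubbleMul (a b c d : ℝ) {ψ : ℝ × ℝ → ℝ} (hψ : ContDiff ℝ ∞ ψ) :
    ContDiff ℝ ∞ (bubbleMul a b c d ψ) :=
  (((contDiff_bubble a b).comp contDiff_fst).mul ((contDiff_bubble c d).comp contDiff_snd)).mul hψ

theorem dx_bubbleMul (a b c d : ℝ) {ψ : ℝ × ℝ → ℝ} (hψ : ContDiff ℝ ∞ ψ) (p : ℝ × ℝ) :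
    dx (bubbleMul a b c d ψ) p =
      (a + b - 2 * p.1) * bubble c d p.2 * ψ p + bubble a b p.1 * bubble c d p.2 * dx ψ p :=
  dx_eq_of_hasDerivAt ((contDiff_bubbleMul a b c d hψ).differentiable (by simp) p)
    (((hasDerivAt_bubble a b p.1).mul_const (bubble c d p.2)).mul (hasDerivAt_dx hψ p.1 p.2))

theorem dy_bubbleMul (a b c d : ℝ) {ψ : ℝ × ℝ → ℝ} (hψ : ContDiff ℝ ∞ ψ) (p : ℝ × ℝ) :
    dy (bubbleMul a b c d ψ) p =
      bubble a b p.1 * (c + d - 2 * p.2) * ψ p + bubble a b p.1 * bubble c d p.2 * dy ψ p :=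
  dy_eq_of_hasDerivAt ((contDiff_bubbleMul a b c d hψ).differentiable (by simp) p)
    (((hasDerivAt_bubble c d p.2).const_mul (bubble a b p.1)).mul (hasDerivAt_dy hψ p.1 p.2))

theorem exists_bound_on_rect (a b c d : ℝ) {ψ : ℝ × ℝ → ℝ} (hψ : Continuous ψ) :
    ∃ K : ℝ, 0 ≤ K ∧ ∀ p ∈ rect a b c d, |ψ p| ≤ K := by
  obtain ⟨K, hK⟩ := ((isCompact_Icc (a := a) (b := b)).prod
    (isCompact_Icc (a := c) (b := d))).exists_bound_of_continuousOn hψ.continuousOn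
  exact ⟨max K 0, le_max_right _ _, fun p hp => (hK p (Set.prod_mono Set.Ioo_subset_Icc_self
    Set.Ioo_subset_Icc_self hp)).trans (le_max_left _ _)⟩

theorem tendsto_bubbleTest {a b c d : ℝ} (ψ : ℝ × ℝ → ℝ) {p : ℝ × ℝ} (hp : p ∈ rect a b c d) :
    Tendsto (fun k => bubbleTest a b c d ψ k p) atTop (𝓝 (bubbleMul a b c d ψ p)) :=
  ((tendsto_scaledRamp (bubble_pos hp.1)).mul (tendsto_scaledRamp (bubble_pos hp.2))).mul_const _

theorem tendsto_dx_bubbleTest {a b c d : ℝ} {ψ : ℝ × ℝ → ℝ} (hψ : ContDiff ℝ ∞ ψ) {p : ℝ × ℝ}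
    (hp : p ∈ rect a b c d) :
    Tendsto (fun k => dx (bubbleTest a b c d ψ k) p) atTop (𝓝 (dx (bubbleMul a b c d ψ) p)) := by
  simp only [dx_bubbleTest a b c d hψ, dx_bubbleMul a b c d hψ]
  have h1 := tendsto_scaledRamp (bubble_pos hp.1)
  have h2 := tendsto_scaledRamp (bubble_pos hp.2)
  have h3 := tendsto_deriv_scaledRamp (bubble_pos hp.1)
  simpa using (((h3.mul_const _).mul h2).mul_const _).add ((h1.mul h2).mul_const (dx ψ p))

theorem tendsto_dy_bubbleTest {a b c d : ℝ} {ψ : ℝ × ℝ → ℝ} (hψ : ContDiff ℝ ∞ ψ) {p : ℝ × ℝ}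
    (hp : p ∈ rect a b c d) :
    Tendsto (fun k => dy (bubbleTest a b c d ψ k) p) atTop (𝓝 (dy (bubbleMul a b c d ψ) p)) := by
  simp only [dy_bubbleTest a b c d hψ, dy_bubbleMul a b c d hψ]
  have h1 := tendsto_scaledRamp (bubble_pos hp.1)
  have h2 := tendsto_scaledRamp (bubble_pos hp.2)
  have h3 := tendsto_deriv_scaledRamp (bubble_pos hp.2)
  simpa using ((h1.mul (h3.mul_const _)).mul_const _).add ((h1.mul h2).mul_const (dy ψ p))

/-- The bound is uniform in `k`, as dominated convergence requires: the scaling `ramp (k t) / k`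
leaves the first derivative bounded, and `|scaledRamp k t| ≤ |t|`. -/
theorem exists_bound_bubbleTest (a b c d : ℝ) {ψ : ℝ × ℝ → ℝ} (hψ : ContDiff ℝ ∞ ψ) :
    ∃ K : ℝ, ∀ k, ∀ p ∈ rect a b c d, |bubbleTest a b c d ψ k p| ≤ K ∧
      |dx (bubbleTest a b c d ψ k) p| ≤ K ∧ |dy (bubbleTest a b c d ψ k) p| ≤ K := by
  obtain ⟨R, hR⟩ := exists_abs_deriv_ramp_le
  have hR0 : 0 ≤ R := (abs_nonneg _).trans (hR 0)
  obtain ⟨K1, hK1, h1⟩ := exists_bound_on_rect a b c d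
    ((contDiff_bubble a b).continuous.comp continuous_fst)
  obtain ⟨K2, hK2, h2⟩ := exists_bound_on_rect a b c d
    ((contDiff_bubble c d).continuous.comp continuous_snd)
  obtain ⟨K3, hK3, h3⟩ := exists_bound_on_rect a b c d hψ.continuous
  obtain ⟨K4, hK4, h4⟩ := exists_bound_on_rect a b c d (contDiff_dx hψ).continuous
  obtain ⟨K5, hK5, h5⟩ := exists_bound_on_rect a b c d (contDiff_dy hψ).continuous
  obtain ⟨K6, hK6, h6⟩ := exists_bound_on_rect a b c d
    (ψ := fun p => a + b - 2 * p.1) (by fun_prop)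
  obtain ⟨K7, hK7, h7⟩ := exists_bound_on_rect a b c d
    (ψ := fun p => c + d - 2 * p.2) (by fun_prop)
  refine ⟨K1 * K2 * K3 + (R * K6 * K2 * K3 + K1 * K2 * K4)
    + (K1 * (R * K7) * K3 + K1 * K2 * K5), fun k p hp => ?_⟩
  have g1 := (abs_scaledRamp_le k (bubble a b p.1)).trans (h1 p hp)
  have g2 := (abs_scaledRamp_le k (bubble c d p.2)).trans (h2 p hp)
  have g3 := h3 p hp
  have g4 := h4 p hp
  have g5 := h5 p hp
  have g6 := h6 p hp
  have g7 := h7 p hp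
  have r1 := hR ((k + 1) * bubble a b p.1)
  have r2 := hR ((k + 1) * bubble c d p.2)
  have n1 : 0 ≤ K1 * K2 * K3 := by positivity
  have n2 : 0 ≤ R * K6 * K2 * K3 + K1 * K2 * K4 := by positivity
  have n3 : 0 ≤ K1 * (R * K7) * K3 + K1 * K2 * K5 := by positivity
  refine ⟨?_, ?_, ?_⟩
  · have : |bubbleTest a b c d ψ k p| ≤ K1 * K2 * K3 := by
      rw [bubbleTest, abs_mul, abs_mul]; gcongr
    linarith
  · have : |dx (bubbleTest a b c d ψ k) p| ≤ R * K6 * K2 * K3 + K1 * K2 * K4 := by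
      rw [dx_bubbleTest a b c d hψ]
      refine (abs_add_le _ _).trans ?_
      simp only [abs_mul]; gcongr
    linarith
  · have : |dy (bubbleTest a b c d ψ k) p| ≤ K1 * (R * K7) * K3 + K1 * K2 * K5 := by
      rw [dy_bubbleTest a b c d hψ]
      refine (abs_add_le _ _).trans ?_
      simp only [abs_mul]; gcongr
    linarith

/-! ### Weak derivatives -/

theorem IsTest.iterate {U : Set (ℝ × ℝ)} {φ : ℝ × ℝ → ℝ} (h : IsTest U φ) (α β : ℕ) :
    IsTest U ((WG.dx^[α]) ((WG.dy^[β]) φ)) := by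
  have h1 : ∀ β : ℕ, IsTest U ((WG.dy^[β]) φ) := by
    intro β
    induction β with
    | zero => exact h
    | succ n ih => rw [Function.iterate_succ_apply']; exact ih.dy
  induction α with
  | zero => exact h1 β
  | succ n ih => rw [Function.iterate_succ_apply']; exact ih.dx

/-- `IsWeakDeriv` applies the `y`-derivatives first, so a further `x`-derivative of the test
function has to be moved past them. -/
theorem iterate_dy_dx {φ : ℝ × ℝ → ℝ} (hφ : ContDiff ℝ ∞ φ) (β : ℕ) :
    (dy^[β]) (dx φ) = dx ((dy^[β]) φ) := by
  have h1 : ∀ β : ℕ, ContDiff ℝ ∞ ((dy^[β]) φ) := by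
    intro β
    induction β with
    | zero => exact hφ
    | succ n ih => rw [Function.iterate_succ_apply']; exact contDiff_dy ih
  induction β with
  | zero => rfl
  | succ n ih =>
    rw [Function.iterate_succ_apply', ih, Function.iterate_succ_apply', dx_dy_comm (h1 n)]

theorem IsTest.setIntegral_mul {U V : Set (ℝ × ℝ)} {φ : ℝ × ℝ → ℝ} (h : IsTest U φ)
    (hUV : U ⊆ V) (hV : MeasurableSet V) (v : ℝ × ℝ → ℝ) :
    ∫ p in V, v p * φ p = ∫ p in U, v p * φ p :=
  setIntegral_eq_of_subset_of_forall_sdiff_eq_zero hV hUV fun p hp => by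
    rw [h.eq_zero hp.2, mul_zero]

theorem IsTest.memLp {U : Set (ℝ × ℝ)} {φ : ℝ × ℝ → ℝ} (h : IsTest U φ) :
    MemLp φ 2 (volume.restrict U) :=
  (h.1.continuous.memLp_of_hasCompactSupport h.2.1).restrict U

theorem IsTest.integrable_mul {U : Set (ℝ × ℝ)} {φ v : ℝ × ℝ → ℝ} (h : IsTest U φ)
    (hv : MemLp v 2 (volume.restrict U)) :
    Integrable (fun p => v p * φ p) (volume.restrict U) :=
  hv.integrable_mul h.memLp

theorem IsWeakDeriv.restrict {U V : Set (ℝ × ℝ)} {α β : ℕ} {v d : ℝ × ℝ → ℝ}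
    (h : IsWeakDeriv V α β v d) (hUV : U ⊆ V) (hV : MeasurableSet V) :
    IsWeakDeriv U α β v d := by
  refine ⟨h.1.mono_measure (Measure.restrict_mono hUV le_rfl), fun φ hφ => ?_⟩
  rw [← (hφ.iterate α β).setIntegral_mul hUV hV, ← hφ.setIntegral_mul hUV hV]
  exact h.2 φ (hφ.mono hUV)

/-- With `∂_x φ` as test function for `d` and `φ` for `d'`, both definitions refer to the same
integral of `v`. -/
theorem IsWeakDeriv.succ_left {U : Set (ℝ × ℝ)} {α β : ℕ} {v d d' : ℝ × ℝ → ℝ}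
    (h : IsWeakDeriv U α β v d) (h' : IsWeakDeriv U (α + 1) β v d') : IsWeakDeriv U 1 0 d d' := by
  refine ⟨h'.1, fun φ hφ => ?_⟩
  have e1 := h.2 _ hφ.dx
  have e2 := h'.2 φ hφ
  rw [iterate_dy_dx hφ.1, ← Function.iterate_succ_apply, e2] at e1
  have hs : ((-1 : ℝ) ^ (α + β)) * (-1) ^ (α + β) = 1 := by
    rw [← mul_pow]; norm_num
  simp only [Function.iterate_zero, Function.iterate_one, id]
  calc ∫ p in U, d p * dx φ p
      = (-1) ^ (α + β) * ((-1) ^ (α + β) * ∫ p in U, d p * dx φ p) := by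
        rw [← mul_assoc, hs, one_mul]
    _ = (-1) ^ (α + β) * ((-1) ^ (α + 1 + β) * ∫ p in U, d' p * φ p) := by rw [← e1]
    _ = (-1) ^ (1 + 0) * ∫ p in U, d' p * φ p := by
        rw [add_right_comm, pow_succ, ← mul_assoc, ← mul_assoc, hs]; norm_num

theorem IsWeakDeriv.succ_right {U : Set (ℝ × ℝ)} {α β : ℕ} {v d d' : ℝ × ℝ → ℝ}
    (h : IsWeakDeriv U α β v d) (h' : IsWeakDeriv U α (β + 1) v d') : IsWeakDeriv U 0 1 d d' := by
  refine ⟨h'.1, fun φ hφ => ?_⟩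
  have e1 := h.2 _ hφ.dy
  have e2 := h'.2 φ hφ
  rw [← Function.iterate_succ_apply, e2] at e1
  have hs : ((-1 : ℝ) ^ (α + β)) * (-1) ^ (α + β) = 1 := by
    rw [← mul_pow]; norm_num
  simp only [Function.iterate_zero, Function.iterate_one, id]
  calc ∫ p in U, d p * dy φ p
      = (-1) ^ (α + β) * ((-1) ^ (α + β) * ∫ p in U, d p * dy φ p) := by
        rw [← mul_assoc, hs, one_mul]
    _ = (-1) ^ (α + β) * ((-1) ^ (α + (β + 1)) * ∫ p in U, d' p * φ p) := by rw [← e1]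
    _ = (-1) ^ (0 + 1) * ∫ p in U, d' p * φ p := by
        rw [← add_assoc, pow_succ, ← mul_assoc, ← mul_assoc, hs]; norm_num

theorem IsWeakDeriv.congr {U : Set (ℝ × ℝ)} {α β : ℕ} {v v' d : ℝ × ℝ → ℝ}
    (h : IsWeakDeriv U α β v d) (hv : v =ᵐ[volume.restrict U] v') : IsWeakDeriv U α β v' d := by
  refine ⟨h.1, fun φ hφ => ?_⟩
  rw [← h.2 φ hφ]
  refine integral_congr_ae ?_
  filter_upwards [hv] with p hp
  rw [hp]

theorem IsWeakDeriv.linearComb {U : Set (ℝ × ℝ)} {α β : ℕ} {v v' d d' : ℝ × ℝ → ℝ}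
    (h : IsWeakDeriv U α β v d) (h' : IsWeakDeriv U α β v' d')
    (hv : MemLp v 2 (volume.restrict U)) (hv' : MemLp v' 2 (volume.restrict U)) (r r' : ℝ) :
    IsWeakDeriv U α β (fun p => r * v p + r' * v' p) (fun p => r * d p + r' * d' p) := by
  refine ⟨(h.1.const_mul r).add (h'.1.const_mul r'), fun φ hφ => ?_⟩
  have hi := hφ.iterate α β
  simp only [add_mul, mul_assoc]
  rw [integral_add ((hi.integrable_mul hv).const_mul r) ((hi.integrable_mul hv').const_mul r'),
    integral_add ((hφ.integrable_mul h.1).const_mul r) ((hφ.integrable_mul h'.1).const_mul r')]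
  simp only [integral_const_mul]
  rw [h.2 φ hφ, h'.2 φ hφ]
  ring

/-- The fundamental lemma of the calculus of variations for `d - d'`, which is square integrable and
hence integrable on compact subsets of `U`. -/
theorem ae_eq_of_forall_test {U : Set (ℝ × ℝ)} (hU : IsOpen U) {d d' : ℝ × ℝ → ℝ}
    (hd : MemLp d 2 (volume.restrict U)) (hd' : MemLp d' 2 (volume.restrict U))
    (h : ∀ φ, IsTest U φ → ∫ p in U, d p * φ p = ∫ p in U, d' p * φ p) :
    d =ᵐ[volume.restrict U] d' := by
  have hloc : LocallyIntegrableOn (d - d') U volume := by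
    intro x hx
    obtain ⟨K, hK, hxK, hKU⟩ : ∃ K, IsCompact K ∧ K ∈ 𝓝 x ∧ K ⊆ U := by
      obtain ⟨K, hK, hKU, hc⟩ := local_compact_nhds (hU.mem_nhds hx)
      exact ⟨K, hc, hK, hKU⟩
    refine ⟨K, mem_nhdsWithin_of_mem_nhds hxK, ?_⟩
    have : IsFiniteMeasure (volume.restrict K) := ⟨by simpa using hK.measure_lt_top⟩
    exact (((hd.sub hd').mono_measure (Measure.restrict_mono hKU le_rfl)).integrable
      (by norm_num))
  have key := hU.ae_eq_zero_of_integral_contDiff_smul_eq_zero hloc fun φ h1 h2 h3 => by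
    have ht : IsTest U φ := ⟨h1, h2, h3⟩
    have e1 : ∫ p, φ p • (d - d') p = ∫ p in U, (d p * φ p - d' p * φ p) := by
      rw [← setIntegral_eq_integral_of_forall_compl_eq_zero (s := U)]
      · refine integral_congr_ae (Eventually.of_forall fun p => ?_)
        simp only [Pi.sub_apply, smul_eq_mul]; ring
      · intro p hp
        rw [ht.eq_zero hp, zero_smul]
    rw [e1, integral_sub (ht.integrable_mul hd) (ht.integrable_mul hd'), h φ ht, sub_self]
  rw [EventuallyEq, ae_restrict_iff' hU.measurableSet]
  filter_upwards [key] with p hp hpU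
  exact sub_eq_zero.1 (hp hpU)

theorem IsWeakDeriv.ae_eq {U : Set (ℝ × ℝ)} (hU : IsOpen U) {α β : ℕ} {v d d' : ℝ × ℝ → ℝ}
    (h : IsWeakDeriv U α β v d) (h' : IsWeakDeriv U α β v d') :
    d =ᵐ[volume.restrict U] d' := by
  refine ae_eq_of_forall_test hU h.1 h'.1 fun φ hφ => ?_
  have e := (h.2 φ hφ).symm.trans (h'.2 φ hφ)
  exact mul_left_cancel₀ (pow_ne_zero _ (by norm_num)) e

theorem IsWeakDeriv.weakDeriv {U : Set (ℝ × ℝ)} {α β : ℕ} {v d : ℝ × ℝ → ℝ}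
    (h : IsWeakDeriv U α β v d) : IsWeakDeriv U α β v (weakDeriv U α β v) := by
  have hex : ∃ d, IsWeakDeriv U α β v d := ⟨d, h⟩
  rw [WG.weakDeriv, dif_pos hex]
  exact hex.choose_spec

theorem MemH.isWeakDeriv {s : ℕ} {U : Set (ℝ × ℝ)} {v : ℝ × ℝ → ℝ} (h : MemH s U v) {α β : ℕ}
    (hαβ : α + β ≤ s) : IsWeakDeriv U α β v (weakDeriv U α β v) :=
  (h.2 α β hαβ).choose_spec.weakDeriv

/-! ### Integration by parts on rectangles -/

theorem measurableSet_rect (a b c d : ℝ) : MeasurableSet (rect a b c d) :=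
  measurableSet_Ioo.prod measurableSet_Ioo

theorem isOpen_rect (a b c d : ℝ) : IsOpen (rect a b c d) := isOpen_Ioo.prod isOpen_Ioo

theorem volume_rect_lt_top (a b c d : ℝ) : volume (rect a b c d) < ⊤ := by
  rw [Measure.volume_eq_prod, Measure.prod_prod, Real.volume_Ioo, Real.volume_Ioo]
  exact ENNReal.mul_lt_top ENNReal.ofReal_lt_top ENNReal.ofReal_lt_top

instance isFiniteMeasure_restrict_rect (a b c d : ℝ) :
    IsFiniteMeasure (volume.restrict (rect a b c d)) :=
  ⟨by simpa using volume_rect_lt_top a b c d⟩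

theorem tendsto_setIntegral_mul {S : Set (ℝ × ℝ)} (hS : MeasurableSet S) {v : ℝ × ℝ → ℝ}
    (hv : IntegrableOn v S) {Φ : ℕ → ℝ × ℝ → ℝ} {Ψ : ℝ × ℝ → ℝ} {K : ℝ}
    (hc : ∀ k, Continuous (Φ k)) (hK : ∀ k, ∀ p ∈ S, |Φ k p| ≤ K)
    (hΦ : ∀ p ∈ S, Tendsto (fun k => Φ k p) atTop (𝓝 (Ψ p))) :
    Tendsto (fun k => ∫ p in S, v p * Φ k p) atTop (𝓝 (∫ p in S, v p * Ψ p)) := by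
  refine tendsto_integral_of_dominated_convergence (fun p => |v p| * K)
    (fun k => hv.aestronglyMeasurable.mul (hc k).aestronglyMeasurable) (hv.abs.mul_const K)
    (fun k => ?_) ?_
  · filter_upwards [ae_restrict_mem hS] with p hp
    rw [Real.norm_eq_abs, abs_mul]
    exact mul_le_mul_of_nonneg_left (hK k p hp) (abs_nonneg _)
  · filter_upwards [ae_restrict_mem hS] with p hp
    exact (hΦ p hp).const_mul _

section Rect

variable {a b c d : ℝ} {S : Set (ℝ × ℝ)} {v d' ψ : ℝ × ℝ → ℝ}

theorem tendsto_setIntegral_bubbleTest (hS : MeasurableSet S) (hSR : S ⊆ rect a b c d)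
    (hv : IntegrableOn v S) (hψ : ContDiff ℝ ∞ ψ) :
    Tendsto (fun k => ∫ p in S, v p * bubbleTest a b c d ψ k p) atTop
      (𝓝 (∫ p in S, v p * bubbleMul a b c d ψ p)) := by
  obtain ⟨K, hK⟩ := exists_bound_bubbleTest a b c d hψ
  exact tendsto_setIntegral_mul hS hv (fun k => (contDiff_bubbleTest a b c d hψ k).continuous)
    (fun k p hp => (hK k p (hSR hp)).1) fun p hp => tendsto_bubbleTest ψ (hSR hp)

theorem tendsto_setIntegral_dx_bubbleTest (hS : MeasurableSet S) (hSR : S ⊆ rect a b c d)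
    (hv : IntegrableOn v S) (hψ : ContDiff ℝ ∞ ψ) :
    Tendsto (fun k => ∫ p in S, v p * dx (bubbleTest a b c d ψ k) p) atTop
      (𝓝 (∫ p in S, v p * dx (bubbleMul a b c d ψ) p)) := by
  obtain ⟨K, hK⟩ := exists_bound_bubbleTest a b c d hψ
  exact tendsto_setIntegral_mul hS hv
    (fun k => (contDiff_dx (contDiff_bubbleTest a b c d hψ k)).continuous)
    (fun k p hp => (hK k p (hSR hp)).2.1) fun p hp => tendsto_dx_bubbleTest hψ (hSR hp)

theorem tendsto_setIntegral_dy_bubbleTest (hS : MeasurableSet S) (hSR : S ⊆ rect a b c d)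
    (hv : IntegrableOn v S) (hψ : ContDiff ℝ ∞ ψ) :
    Tendsto (fun k => ∫ p in S, v p * dy (bubbleTest a b c d ψ k) p) atTop
      (𝓝 (∫ p in S, v p * dy (bubbleMul a b c d ψ) p)) := by
  obtain ⟨K, hK⟩ := exists_bound_bubbleTest a b c d hψ
  exact tendsto_setIntegral_mul hS hv
    (fun k => (contDiff_dy (contDiff_bubbleTest a b c d hψ k)).continuous)
    (fun k p hp => (hK k p (hSR hp)).2.2) fun p hp => tendsto_dy_bubbleTest hψ (hSR hp)

/-- `t / (t² + 1 / (l + 1))`, a smooth approximation of `1 / t`. -/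
def recip (l : ℕ) (t : ℝ) : ℝ := t / (t ^ 2 + 1 / (l + 1))

theorem contDiff_recip (l : ℕ) : ContDiff ℝ ∞ (recip l) := by
  unfold recip
  refine contDiff_id.div ((contDiff_id.pow 2).add contDiff_const) fun t => ?_
  positivity

theorem abs_mul_recip_le (l : ℕ) (t : ℝ) : |t * recip l t| ≤ 1 := by
  have h : (0 : ℝ) < t ^ 2 + 1 / (l + 1) := by positivity
  have h0 : (0 : ℝ) < 1 / ((l : ℝ) + 1) := by positivity
  have e : t * recip l t = t ^ 2 / (t ^ 2 + 1 / (l + 1)) := by rw [recip]; ring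
  rw [e, abs_of_nonneg (by positivity), div_le_one h]
  linarith

theorem tendsto_mul_recip {t : ℝ} (ht : 0 < t) :
    Tendsto (fun l => t * recip l t) atTop (𝓝 1) := by
  have h1 : Tendsto (fun l : ℕ => t ^ 2 / (t ^ 2 + 1 / ((l : ℝ) + 1))) atTop
      (𝓝 (t ^ 2 / (t ^ 2 + 0))) :=
    tendsto_const_nhds.div (tendsto_const_nhds.add tendsto_one_div_add_atTop_nhds_zero_nat)
      (by positivity)
  rw [add_zero, div_self (by positivity)] at h1
  refine h1.congr fun l => ?_
  rw [recip]; ring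

/-- Serves to remove a factor that vanishes for `y = c` and `y = d`: the weight `t * recip l t` is
bounded by one and tends to one for `t > 0`. -/
theorem tendsto_setIntegral_recip_snd (hS : MeasurableSet S) (hSR : S ⊆ rect a b c d)
    (hv : IntegrableOn v S) (hψ : Continuous ψ) :
    Tendsto (fun l => ∫ p in S, v p * (ψ p * (bubble c d p.2 * recip l (bubble c d p.2)))) atTop
      (𝓝 (∫ p in S, v p * ψ p)) := by
  obtain ⟨K, hK0, hK⟩ := exists_bound_on_rect a b c d hψ
  have hb := (contDiff_bubble c d).continuous
  refine tendsto_setIntegral_mul hS hv (K := K) (fun l => ?_) (fun l p hp => ?_) fun p hp => ?_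
  · have := (contDiff_recip l).continuous
    fun_prop
  · rw [abs_mul]
    exact (mul_le_of_le_one_right (abs_nonneg _) (abs_mul_recip_le l _)).trans (hK p (hSR hp))
  · simpa using (tendsto_mul_recip (bubble_pos (hSR hp).2)).const_mul (ψ p)

theorem tendsto_setIntegral_recip_fst (hS : MeasurableSet S) (hSR : S ⊆ rect a b c d)
    (hv : IntegrableOn v S) (hψ : Continuous ψ) :
    Tendsto (fun l => ∫ p in S, v p * (ψ p * (bubble a b p.1 * recip l (bubble a b p.1)))) atTop
      (𝓝 (∫ p in S, v p * ψ p)) := by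
  obtain ⟨K, hK0, hK⟩ := exists_bound_on_rect a b c d hψ
  have hb := (contDiff_bubble a b).continuous
  refine tendsto_setIntegral_mul hS hv (K := K) (fun l => ?_) (fun l p hp => ?_) fun p hp => ?_
  · have := (contDiff_recip l).continuous
    fun_prop
  · rw [abs_mul]
    exact (mul_le_of_le_one_right (abs_nonneg _) (abs_mul_recip_le l _)).trans (hK p (hSR hp))
  · simpa using (tendsto_mul_recip (bubble_pos (hSR hp).1)).const_mul (ψ p)

/-- A function that merely vanishes on the boundary is admissible as a limit of `bubbleTest`, whose
values and first derivatives converge boundedly. -/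
theorem IsWeakDeriv.integral_dx_bubbleMul (hab : a < b) (hcd : c < d)
    (hd : IsWeakDeriv (rect a b c d) 1 0 v d') (hv : MemLp v 2 (volume.restrict (rect a b c d)))
    (hψ : ContDiff ℝ ∞ ψ) :
    ∫ p in rect a b c d, v p * dx (bubbleMul a b c d ψ) p =
      -∫ p in rect a b c d, d' p * bubbleMul a b c d ψ p := by
  have hR := measurableSet_rect a b c d
  refine tendsto_nhds_unique (tendsto_setIntegral_dx_bubbleTest hR subset_rfl
    (hv.integrable (by norm_num)) hψ) ?_
  refine (tendsto_setIntegral_bubbleTest hR subset_rfl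
    (hd.1.integrable (by norm_num)) hψ).neg.congr fun k => ?_
  have := hd.2 _ (isTest_bubbleTest hab hcd hψ k)
  simp only [Function.iterate_zero, Function.iterate_one, id] at this
  rw [this]; norm_num

theorem IsWeakDeriv.integral_dy_bubbleMul (hab : a < b) (hcd : c < d)
    (hd : IsWeakDeriv (rect a b c d) 0 1 v d') (hv : MemLp v 2 (volume.restrict (rect a b c d)))
    (hψ : ContDiff ℝ ∞ ψ) :
    ∫ p in rect a b c d, v p * dy (bubbleMul a b c d ψ) p =
      -∫ p in rect a b c d, d' p * bubbleMul a b c d ψ p := by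
  have hR := measurableSet_rect a b c d
  refine tendsto_nhds_unique (tendsto_setIntegral_dy_bubbleTest hR subset_rfl
    (hv.integrable (by norm_num)) hψ) ?_
  refine (tendsto_setIntegral_bubbleTest hR subset_rfl
    (hd.1.integrable (by norm_num)) hψ).neg.congr fun k => ?_
  have := hd.2 _ (isTest_bubbleTest hab hcd hψ k)
  simp only [Function.iterate_zero, Function.iterate_one, id] at this
  rw [this]; norm_num

/-- Integration by parts in `x` against a function that vanishes for `x = a` and `x = b`. -/
theorem IsWeakDeriv.integral_bubble_fst (hab : a < b) (hcd : c < d)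
    (hd : IsWeakDeriv (rect a b c d) 1 0 v d') (hv : MemLp v 2 (volume.restrict (rect a b c d)))
    (hψ : ContDiff ℝ ∞ ψ) :
    ∫ p in rect a b c d, v p * ((a + b - 2 * p.1) * ψ p + bubble a b p.1 * dx ψ p) =
      -∫ p in rect a b c d, d' p * (bubble a b p.1 * ψ p) := by
  have hR := measurableSet_rect a b c d
  have hb := (contDiff_bubble a b).continuous
  have hdψ := (contDiff_dx hψ).continuous
  have hψc := hψ.continuous
  refine tendsto_nhds_unique (tendsto_setIntegral_recip_snd hR subset_rfl
    (hv.integrable (by norm_num)) (by fun_prop)) ?_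
  refine (tendsto_setIntegral_recip_snd hR subset_rfl
    (hd.1.integrable (by norm_num)) (by fun_prop)).neg.congr fun l => ?_
  have hr : ContDiff ℝ ∞ fun p : ℝ × ℝ => recip l (bubble c d p.2) :=
    (contDiff_recip l).comp ((contDiff_bubble c d).comp contDiff_snd)
  have hψl : ContDiff ℝ ∞ fun p : ℝ × ℝ => ψ p * recip l (bubble c d p.2) := hψ.mul hr
  have e := hd.integral_dx_bubbleMul hab hcd hv hψl
  -- The regularized reciprocal depends on `y` only, so it is a constant factor for the derivative
  -- in `x`.
  have e1 : ∀ p : ℝ × ℝ, dx (fun p => ψ p * recip l (bubble c d p.2)) p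
      = dx ψ p * recip l (bubble c d p.2) := fun p =>
    dx_eq_of_hasDerivAt (hψl.differentiable (by simp) p)
      ((hasDerivAt_dx hψ p.1 p.2).mul_const (recip l (bubble c d p.2)))
  simp only [dx_bubbleMul a b c d hψl, e1, bubbleMul] at e
  convert e.symm using 3 with p
  · funext p; ring
  · ring

/-- Integration by parts in `y` against a function that vanishes for `y = c` and `y = d`. -/
theorem IsWeakDeriv.integral_bubble_snd (hab : a < b) (hcd : c < d)
    (hd : IsWeakDeriv (rect a b c d) 0 1 v d') (hv : MemLp v 2 (volume.restrict (rect a b c d)))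
    (hψ : ContDiff ℝ ∞ ψ) :
    ∫ p in rect a b c d, v p * ((c + d - 2 * p.2) * ψ p + bubble c d p.2 * dy ψ p) =
      -∫ p in rect a b c d, d' p * (bubble c d p.2 * ψ p) := by
  have hR := measurableSet_rect a b c d
  have hb := (contDiff_bubble c d).continuous
  have hdψ := (contDiff_dy hψ).continuous
  have hψc := hψ.continuous
  refine tendsto_nhds_unique (tendsto_setIntegral_recip_fst hR subset_rfl
    (hv.integrable (by norm_num)) (by fun_prop)) ?_
  refine (tendsto_setIntegral_recip_fst hR subset_rfl
    (hd.1.integrable (by norm_num)) (by fun_prop)).neg.congr fun l => ?_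
  have hr : ContDiff ℝ ∞ fun p : ℝ × ℝ => recip l (bubble a b p.1) :=
    (contDiff_recip l).comp ((contDiff_bubble a b).comp contDiff_fst)
  have hψl : ContDiff ℝ ∞ fun p : ℝ × ℝ => ψ p * recip l (bubble a b p.1) := hψ.mul hr
  have e := hd.integral_dy_bubbleMul hab hcd hv hψl
  have e1 : ∀ p : ℝ × ℝ, dy (fun p => ψ p * recip l (bubble a b p.1)) p
      = dy ψ p * recip l (bubble a b p.1) := fun p =>
    dy_eq_of_hasDerivAt (hψl.differentiable (by simp) p)
      ((hasDerivAt_dy hψ p.1 p.2).mul_const (recip l (bubble a b p.1)))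
  simp only [dy_bubbleMul a b c d hψl, e1, bubbleMul] at e
  convert e.symm using 3 with p
  · funext p; ring
  · ring

end Rect

/-! ### Traces -/

/-- Hölder's inequality turns `L²` convergence into `L¹` convergence of the products with `κ`. -/
theorem tendsto_integral_mul_of_tendsto_eLpNorm {α : Type*} [MeasurableSpace α] {μ : Measure α}
    {F : ℕ → α → ℝ} {f κ : α → ℝ} (hF : ∀ k, MemLp (F k) 2 μ) (hf : MemLp f 2 μ)
    (hκ : MemLp κ 2 μ) (h : Tendsto (fun k => eLpNorm (F k - f) 2 μ) atTop (𝓝 0)) :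
    Tendsto (fun k => ∫ p, F k p * κ p ∂μ) atTop (𝓝 (∫ p, f p * κ p ∂μ)) := by
  refine tendsto_integral_of_L1' _ (hf.integrable_mul hκ).aestronglyMeasurable
    (Eventually.of_forall fun k => (hF k).integrable_mul hκ) ?_
  have hb : ∀ k, eLpNorm ((fun p => F k p * κ p) - fun p => f p * κ p) 1 μ
      ≤ eLpNorm (F k - f) 2 μ * eLpNorm κ 2 μ := by
    intro k
    have := eLpNorm_le_eLpNorm_mul_eLpNorm_of_nnnorm (p := 2) (q := 2) (r := 1)
      ((hF k).sub hf).aestronglyMeasurable hκ.aestronglyMeasurable (fun x y : ℝ => x * y) 1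
      (Eventually.of_forall fun x => by simp)
    rw [ENNReal.coe_one, one_mul] at this
    refine le_trans (le_of_eq ?_) this
    congr 1
    funext p
    simp [sub_mul]
  have h0 : Tendsto (fun k => eLpNorm (F k - f) 2 μ * eLpNorm κ 2 μ) atTop (𝓝 0) := by
    simpa using ENNReal.Tendsto.mul_const h (Or.inr hκ.eLpNorm_ne_top)
  exact tendsto_of_tendsto_of_tendsto_of_le_of_le tendsto_const_nhds h0 (fun k => zero_le)
    hb

theorem memLp_rect_of_continuous {φ : ℝ × ℝ → ℝ} (hφ : Continuous φ) (a b c d : ℝ) :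
    MemLp φ 2 (volume.restrict (rect a b c d)) := by
  obtain ⟨K, -, hK⟩ := exists_bound_on_rect a b c d hφ
  refine MemLp.of_bound hφ.aestronglyMeasurable K ?_
  filter_upwards [ae_restrict_mem (measurableSet_rect a b c d)] with p hp using hK p hp

theorem Seg.continuous_pt (e : Seg) : Continuous e.pt := by
  unfold Seg.pt
  split_ifs <;> fun_prop

/-- A formula for the integral over a segment of smooth functions extends to traces. -/
theorem IsTrace.integral_eq {U : Set (ℝ × ℝ)} {e : Seg} {v g κ κ' : ℝ × ℝ → ℝ} {a b c d r : ℝ}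
    (h : IsTrace U e v g) (hle : e.lo ≤ e.hi) (hRU : rect a b c d ⊆ U) (hκ : Continuous κ)
    (hκ' : Continuous κ')
    (H : ∀ φ : ℝ × ℝ → ℝ, ContDiff ℝ ∞ φ → r * e.int φ =
      ∫ p in rect a b c d, (dx φ p * κ p + dy φ p * κ' p + φ p)) :
    r * e.int g = ∫ p in rect a b c d,
      (weakDeriv U 1 0 v p * κ p + weakDeriv U 0 1 v p * κ' p + v p) := by
  obtain ⟨hv, hg, φ, hφ, h0, h1, h2, h3⟩ := h
  have hm := Measure.restrict_mono (μ := (volume : Measure (ℝ × ℝ))) hRU le_rfl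
  have m0 := hv.1.mono_measure hm
  have m1 := (hv.isWeakDeriv (α := 1) (β := 0) le_rfl).1.mono_measure hm
  have m2 := (hv.isWeakDeriv (α := 0) (β := 1) le_rfl).1.mono_measure hm
  have hsq : ∀ {F : ℕ → ℝ × ℝ → ℝ} {f : ℝ × ℝ → ℝ},
      Tendsto (fun k => eLpNorm (F k - f) 2 (volume.restrict U)) atTop (𝓝 0) →
      Tendsto (fun k => eLpNorm (F k - f) 2 (volume.restrict (rect a b c d))) atTop (𝓝 0) :=
    fun hF => tendsto_of_tendsto_of_tendsto_of_le_of_le tendsto_const_nhds hF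
      (fun k => zero_le) fun k => eLpNorm_mono_measure _ hm
  have c1 := memLp_rect_of_continuous hκ a b c d
  have c2 := memLp_rect_of_continuous hκ' a b c d
  have c0 : MemLp (fun _ : ℝ × ℝ => (1 : ℝ)) 2 (volume.restrict (rect a b c d)) := memLp_const 1
  have f0 := fun k => memLp_rect_of_continuous (hφ k).continuous a b c d
  have f1 := fun k => memLp_rect_of_continuous (contDiff_dx (hφ k)).continuous a b c d
  have f2 := fun k => memLp_rect_of_continuous (contDiff_dy (hφ k)).continuous a b c d
  have t0 := tendsto_integral_mul_of_tendsto_eLpNorm f0 m0 c0 (hsq h0)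
  have t1 := tendsto_integral_mul_of_tendsto_eLpNorm f1 m1 c1 (hsq h1)
  have t2 := tendsto_integral_mul_of_tendsto_eLpNorm f2 m2 c2 (hsq h2)
  have t3 : Tendsto (fun k => e.int (φ k)) atTop (𝓝 (e.int g)) := by
    have hc : ∀ k, MemLp (fun τ => φ k (e.pt τ)) 2 (volume.restrict (Set.Ioc e.lo e.hi)) := by
      intro k
      have hcont : Continuous fun τ => φ k (e.pt τ) :=
        (hφ k).continuous.comp e.continuous_pt
      obtain ⟨K, hK⟩ := (isCompact_Icc (a := e.lo) (b := e.hi)).exists_bound_of_continuousOn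
        hcont.continuousOn
      refine MemLp.of_bound hcont.aestronglyMeasurable K ?_
      filter_upwards [ae_restrict_mem measurableSet_Ioc] with τ hτ
      exact hK τ (Set.Ioc_subset_Icc_self hτ)
    have := tendsto_integral_mul_of_tendsto_eLpNorm hc hg (memLp_const 1) h3
    simpa only [mul_one, Seg.int, intervalIntegral.integral_of_le hle] using this
  have hsplit : ∀ {A A' B : ℝ × ℝ → ℝ}, MemLp A 2 (volume.restrict (rect a b c d)) →
      MemLp A' 2 (volume.restrict (rect a b c d)) → MemLp B 2 (volume.restrict (rect a b c d)) →
      ∫ p in rect a b c d, (A p * κ p + A' p * κ' p + B p) =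
        (∫ p in rect a b c d, A p * κ p) + (∫ p in rect a b c d, A' p * κ' p)
          + ∫ p in rect a b c d, B p * 1 := by
    intro A A' B hA hA' hB
    simp only [mul_one]
    have i1 : Integrable (fun p => A p * κ p) (volume.restrict (rect a b c d)) :=
      hA.integrable_mul c1
    have i2 : Integrable (fun p => A' p * κ' p) (volume.restrict (rect a b c d)) :=
      hA'.integrable_mul c2
    rw [integral_add (f := fun p => A p * κ p + A' p * κ' p) (i1.add i2)
      (hB.integrable (by norm_num)), integral_add i1 i2]
  rw [hsplit m1 m2 m0]
  refine tendsto_nhds_unique (t3.const_mul r) (((t1.add t2).add t0).congr fun k => ?_)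
  rw [H _ (hφ k), hsplit (f1 k) (f2 k) (f0 k)]

/-! ### Green's formulas on a rectangle and averages of traces -/

/-- The integrand is `∂_x ((x - s) φ)`. Placing `s` on one vertical side removes that side and
isolates the integral over the opposite one. -/
theorem integral_rect_dx {a b c d : ℝ} (hab : a ≤ b) (hcd : c ≤ d) {φ : ℝ × ℝ → ℝ}
    (hφ : ContDiff ℝ ∞ φ) (s : ℝ) :
    ∫ p in rect a b c d, (dx φ p * (p.1 - s) + φ p) =
      (b - s) * (∫ τ in c..d, φ (b, τ)) - (a - s) * ∫ τ in c..d, φ (a, τ) := by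
  have hc := hφ.continuous
  have hdc := (contDiff_dx hφ).continuous
  have hint : Integrable (fun p : ℝ × ℝ => dx φ p * (p.1 - s) + φ p)
      (volume.restrict (rect a b c d)) :=
    (memLp_rect_of_continuous (by fun_prop) a b c d).integrable (by norm_num)
  rw [Measure.volume_eq_prod, ← Measure.prod_restrict] at hint ⊢
  rw [integral_prod_symm _ hint]
  have inner : ∀ y : ℝ, ∫ x in Set.Ioo a b, (dx φ (x, y) * (x - s) + φ (x, y))
      = (b - s) * φ (b, y) - (a - s) * φ (a, y) := by
    intro y
    rw [← integral_Ioc_eq_integral_Ioo, ← intervalIntegral.integral_of_le hab]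
    rw [intervalIntegral.integral_eq_sub_of_hasDerivAt (f := fun x => (x - s) * φ (x, y))]
    · intro x _
      have := ((hasDerivAt_id x).sub_const s).mul (hasDerivAt_dx hφ x y)
      refine this.congr_deriv ?_
      simp only [id]; ring
    · exact Continuous.intervalIntegrable (by fun_prop) _ _
  simp only [inner]
  rw [← integral_Ioc_eq_integral_Ioo, ← intervalIntegral.integral_of_le hcd,
    intervalIntegral.integral_sub (Continuous.intervalIntegrable (by fun_prop) _ _)
      (Continuous.intervalIntegrable (by fun_prop) _ _),
    intervalIntegral.integral_const_mul, intervalIntegral.integral_const_mul]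

theorem integral_rect_dy {a b c d : ℝ} (hab : a ≤ b) (hcd : c ≤ d) {φ : ℝ × ℝ → ℝ}
    (hφ : ContDiff ℝ ∞ φ) (s : ℝ) :
    ∫ p in rect a b c d, (dy φ p * (p.2 - s) + φ p) =
      (d - s) * (∫ τ in a..b, φ (τ, d)) - (c - s) * ∫ τ in a..b, φ (τ, c) := by
  have hc := hφ.continuous
  have hdc := (contDiff_dy hφ).continuous
  have hint : Integrable (fun p : ℝ × ℝ => dy φ p * (p.2 - s) + φ p)
      (volume.restrict (rect a b c d)) :=
    (memLp_rect_of_continuous (by fun_prop) a b c d).integrable (by norm_num)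
  rw [Measure.volume_eq_prod, ← Measure.prod_restrict] at hint ⊢
  rw [integral_prod _ hint]
  have inner : ∀ x : ℝ, ∫ y in Set.Ioo c d, (dy φ (x, y) * (y - s) + φ (x, y))
      = (d - s) * φ (x, d) - (c - s) * φ (x, c) := by
    intro x
    rw [← integral_Ioc_eq_integral_Ioo, ← intervalIntegral.integral_of_le hcd]
    rw [intervalIntegral.integral_eq_sub_of_hasDerivAt (f := fun y => (y - s) * φ (x, y))]
    · intro y _
      have := ((hasDerivAt_id y).sub_const s).mul (hasDerivAt_dy hφ x y)
      refine this.congr_deriv ?_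
      simp only [id]; ring
    · exact Continuous.intervalIntegrable (by fun_prop) _ _
  simp only [inner]
  rw [← integral_Ioc_eq_integral_Ioo, ← intervalIntegral.integral_of_le hab,
    intervalIntegral.integral_sub (Continuous.intervalIntegrable (by fun_prop) _ _)
      (Continuous.intervalIntegrable (by fun_prop) _ _),
    intervalIntegral.integral_const_mul, intervalIntegral.integral_const_mul]

section TraceMean

variable {U : Set (ℝ × ℝ)} {v vx vy : ℝ × ℝ → ℝ} {a b c d r : ℝ}

/-- Obtained from smooth functions by passing to the limit in the definition of a trace. The
right-hand side no longer mentions a trace, so all later arguments work with integrals over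
elements. -/
theorem HasTraceMean.eq_left (hab : a < b) (hcd : c < d) (hRU : rect a b c d ⊆ U)
    (h : HasTraceMean U ⟨true, a, c, d⟩ v r)
    (hvx : weakDeriv U 1 0 v =ᵐ[volume.restrict (rect a b c d)] vx) :
    (b - a) * (d - c) * r = ∫ p in rect a b c d, (vx p * (p.1 - b) + v p) := by
  obtain ⟨g, hg, rfl⟩ := h
  have key := hg.integral_eq (r := b - a) (κ := fun p => p.1 - b) (κ' := fun _ => 0) hcd.le hRU
    (by fun_prop) (by fun_prop) fun φ hφ => by
      have := integral_rect_dx hab.le hcd.le hφ b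
      simp only [mul_zero, add_zero]
      rw [this]
      simp only [Seg.int, Seg.pt, if_true]
      ring
  simp only [Seg.mean, Seg.len]
  rw [mul_assoc, mul_div_cancel₀ _ (sub_pos.2 hcd).ne', key]
  refine integral_congr_ae ?_
  filter_upwards [hvx] with p hp
  rw [hp]; ring

theorem HasTraceMean.eq_right (hab : a < b) (hcd : c < d) (hRU : rect a b c d ⊆ U)
    (h : HasTraceMean U ⟨true, b, c, d⟩ v r)
    (hvx : weakDeriv U 1 0 v =ᵐ[volume.restrict (rect a b c d)] vx) :
    (b - a) * (d - c) * r = ∫ p in rect a b c d, (vx p * (p.1 - a) + v p) := by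
  obtain ⟨g, hg, rfl⟩ := h
  have key := hg.integral_eq (r := b - a) (κ := fun p => p.1 - a) (κ' := fun _ => 0) hcd.le hRU
    (by fun_prop) (by fun_prop) fun φ hφ => by
      have := integral_rect_dx hab.le hcd.le hφ a
      simp only [mul_zero, add_zero]
      rw [this]
      simp only [Seg.int, Seg.pt, if_true]
      ring
  simp only [Seg.mean, Seg.len]
  rw [mul_assoc, mul_div_cancel₀ _ (sub_pos.2 hcd).ne', key]
  refine integral_congr_ae ?_
  filter_upwards [hvx] with p hp
  rw [hp]; ring

theorem HasTraceMean.eq_bottom (hab : a < b) (hcd : c < d) (hRU : rect a b c d ⊆ U)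
    (h : HasTraceMean U ⟨false, c, a, b⟩ v r)
    (hvy : weakDeriv U 0 1 v =ᵐ[volume.restrict (rect a b c d)] vy) :
    (b - a) * (d - c) * r = ∫ p in rect a b c d, (vy p * (p.2 - d) + v p) := by
  obtain ⟨g, hg, rfl⟩ := h
  have key := hg.integral_eq (r := d - c) (κ := fun _ => 0) (κ' := fun p => p.2 - d) hab.le hRU
    (by fun_prop) (by fun_prop) fun φ hφ => by
      have := integral_rect_dy hab.le hcd.le hφ d
      simp only [mul_zero, zero_add]
      rw [this]
      simp only [Seg.int, Seg.pt, Bool.false_eq_true, if_false]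
      ring
  simp only [Seg.mean, Seg.len]
  rw [mul_comm (b - a), mul_assoc, mul_div_cancel₀ _ (sub_pos.2 hab).ne', key]
  refine integral_congr_ae ?_
  filter_upwards [hvy] with p hp
  rw [hp]; ring

theorem HasTraceMean.eq_top (hab : a < b) (hcd : c < d) (hRU : rect a b c d ⊆ U)
    (h : HasTraceMean U ⟨false, d, a, b⟩ v r)
    (hvy : weakDeriv U 0 1 v =ᵐ[volume.restrict (rect a b c d)] vy) :
    (b - a) * (d - c) * r = ∫ p in rect a b c d, (vy p * (p.2 - c) + v p) := by
  obtain ⟨g, hg, rfl⟩ := h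
  have key := hg.integral_eq (r := d - c) (κ := fun _ => 0) (κ' := fun p => p.2 - c) hab.le hRU
    (by fun_prop) (by fun_prop) fun φ hφ => by
      have := integral_rect_dy hab.le hcd.le hφ c
      simp only [mul_zero, zero_add]
      rw [this]
      simp only [Seg.int, Seg.pt, Bool.false_eq_true, if_false]
      ring
  simp only [Seg.mean, Seg.len]
  rw [mul_comm (b - a), mul_assoc, mul_div_cancel₀ _ (sub_pos.2 hab).ne', key]
  refine integral_congr_ae ?_
  filter_upwards [hvy] with p hp
  rw [hp]; ring

end TraceMean

theorem IsTrace.subsegment {U : Set (ℝ × ℝ)} {v g : ℝ × ℝ → ℝ} {t : Bool} {c lo hi lo' hi' : ℝ}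
    (h : IsTrace U ⟨t, c, lo, hi⟩ v g) (hlo : lo ≤ lo') (hhi : hi' ≤ hi) :
    IsTrace U ⟨t, c, lo', hi'⟩ v g := by
  obtain ⟨hv, hg, φ, hφ, h0, h1, h2, h3⟩ := h
  have hm := Measure.restrict_mono (μ := (volume : Measure ℝ))
    (Set.Ioc_subset_Ioc hlo hhi) le_rfl
  exact ⟨hv, hg.mono_measure hm, φ, hφ, h0, h1, h2,
    tendsto_of_tendsto_of_tendsto_of_le_of_le tendsto_const_nhds h3 (fun k => zero_le)
      fun k => eLpNorm_mono_measure _ hm⟩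

/-! ### A Cauchy–Schwarz inequality -/

theorem volume_real_rect {a b c d : ℝ} (hab : a ≤ b) (hcd : c ≤ d) :
    volume.real (rect a b c d) = (b - a) * (d - c) := by
  rw [Measure.real, Measure.volume_eq_prod, Measure.prod_prod, Real.volume_Ioo, Real.volume_Ioo,
    ENNReal.toReal_mul, ENNReal.toReal_ofReal (sub_nonneg.2 hab),
    ENNReal.toReal_ofReal (sub_nonneg.2 hcd)]

/-- The variance of `v κ` about its mean `I / A` is nonnegative, where `A` is the area; this gives
`I² / A ≤ ∫ (v κ)²`. -/
theorem sq_integral_mul_le {a b c d : ℝ} (hab : a < b) (hcd : c < d) {v κ : ℝ × ℝ → ℝ}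
    (hv : MemLp v 2 (volume.restrict (rect a b c d))) (hκ : Continuous κ) {K : ℝ}
    (hK : ∀ p ∈ rect a b c d, |κ p| ≤ K) :
    (∫ p in rect a b c d, v p * κ p) ^ 2 ≤
      K ^ 2 * ((b - a) * (d - c)) * ∫ p in rect a b c d, v p ^ 2 := by
  set A := (b - a) * (d - c) with hA
  have hA0 : 0 < A := mul_pos (sub_pos.2 hab) (sub_pos.2 hcd)
  set I := ∫ p in rect a b c d, v p * κ p with hI
  have hvκ : MemLp (fun p => v p * κ p) 2 (volume.restrict (rect a b c d)) := by
    refine MemLp.of_le_mul (c := K) hv (hv.aestronglyMeasurable.mul hκ.aestronglyMeasurable) ?_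
    filter_upwards [ae_restrict_mem (measurableSet_rect a b c d)] with p hp
    rw [norm_mul, mul_comm]
    exact mul_le_mul_of_nonneg_right (hK p hp) (norm_nonneg _)
  have i1 : Integrable (fun p => v p * κ p) (volume.restrict (rect a b c d)) :=
    hvκ.integrable (by norm_num)
  have i2 : Integrable (fun p => (v p * κ p) ^ 2) (volume.restrict (rect a b c d)) :=
    hvκ.integrable_sq
  have h1 : 0 ≤ ∫ p in rect a b c d, (v p * κ p - I / A) ^ 2 :=
    integral_nonneg fun p => sq_nonneg _
  have h2 : ∫ p in rect a b c d, (v p * κ p - I / A) ^ 2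
      = (∫ p in rect a b c d, (v p * κ p) ^ 2) - I ^ 2 / A := by
    have e : ∀ p, (v p * κ p - I / A) ^ 2
        = (v p * κ p) ^ 2 - 2 * (I / A) * (v p * κ p) + (I / A) ^ 2 := fun p => by ring
    simp only [e]
    rw [integral_add (f := fun p => (v p * κ p) ^ 2 - 2 * (I / A) * (v p * κ p))
        (i2.sub (i1.const_mul _)) (integrable_const _),
      integral_sub i2 (i1.const_mul _), integral_const_mul, ← hI, integral_const, smul_eq_mul,
      Measure.real, Measure.restrict_apply_univ, ← Measure.real, volume_real_rect hab.le hcd.le,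
      ← hA]
    field_simp
    ring
  have h3 : ∫ p in rect a b c d, (v p * κ p) ^ 2 ≤ K ^ 2 * ∫ p in rect a b c d, v p ^ 2 := by
    rw [← integral_const_mul]
    refine integral_mono_ae i2 (hv.integrable_sq.const_mul _) ?_
    filter_upwards [ae_restrict_mem (measurableSet_rect a b c d)] with p hp
    rw [mul_pow, mul_comm]
    exact mul_le_mul_of_nonneg_right (sq_le_sq' (neg_le_of_abs_le (hK p hp))
      (le_of_abs_le (hK p hp))) (sq_nonneg _)
  have h4 : I ^ 2 / A ≤ K ^ 2 * ∫ p in rect a b c d, v p ^ 2 := by linarith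
  rw [div_le_iff₀ hA0] at h4
  linarith

/-! ### Continuity of the normal flux -/

section Flux

variable {a b c d e : ℝ} {q₁ q₂ qx qy p₁ p₂ px py : ℝ × ℝ → ℝ}

/-- If the piecewise `H¹` field `(q₁, q₂)`, `(p₁, p₂)` has its elementwise divergence as weak
divergence, the averages of its normal component from both sides of the line `x = b` agree. -/
theorem normal_flux_fst (hab : a < b) (hbe : b < e) (hcd : c < d)
    (hq₁ : MemLp q₁ 2 (volume.restrict (rect a b c d)))
    (hq₂ : MemLp q₂ 2 (volume.restrict (rect a b c d)))
    (hp₁ : MemLp p₁ 2 (volume.restrict (rect b e c d)))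
    (hp₂ : MemLp p₂ 2 (volume.restrict (rect b e c d)))
    (hqx : IsWeakDeriv (rect a b c d) 1 0 q₁ qx) (hqy : IsWeakDeriv (rect a b c d) 0 1 q₂ qy)
    (hpx : IsWeakDeriv (rect b e c d) 1 0 p₁ px) (hpy : IsWeakDeriv (rect b e c d) 0 1 p₂ py)
    (H : ∀ φ, IsTest (rect a e c d) φ →
      ((∫ p in rect a b c d, q₁ p * dx φ p) + (∫ p in rect a b c d, q₂ p * dy φ p)
        + (∫ p in rect a b c d, qx p * φ p) + ∫ p in rect a b c d, qy p * φ p)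
      + ((∫ p in rect b e c d, p₁ p * dx φ p) + (∫ p in rect b e c d, p₂ p * dy φ p)
        + (∫ p in rect b e c d, px p * φ p) + ∫ p in rect b e c d, py p * φ p) = 0) :
    (e - b) * ∫ p in rect a b c d, (qx p * (p.1 - a) + q₁ p)
      = (b - a) * ∫ p in rect b e c d, (px p * (p.1 - e) + p₁ p) := by
  have hae := hab.trans hbe
  have s1 : rect a b c d ⊆ rect a e c d :=
    Set.prod_mono (Set.Ioo_subset_Ioo_right hbe.le) subset_rfl
  have s2 : rect b e c d ⊆ rect a e c d := Set.prod_mono (Set.Ioo_subset_Ioo_left hab.le) subset_rfl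
  have r1 := measurableSet_rect a b c d
  have r2 := measurableSet_rect b e c d
  have iq₁ := hq₁.integrable (q := 2) (by norm_num)
  have iq₂ := hq₂.integrable (q := 2) (by norm_num)
  have ip₁ := hp₁.integrable (q := 2) (by norm_num)
  have ip₂ := hp₂.integrable (q := 2) (by norm_num)
  have iqx := hqx.1.integrable (q := 2) (by norm_num)
  have iqy := hqy.1.integrable (q := 2) (by norm_num)
  have ipx := hpx.1.integrable (q := 2) (by norm_num)
  have ipy := hpy.1.integrable (q := 2) (by norm_num)
  -- The test function is a bubble in `x` over the whole interval `(a, e)`, times a factor in `y`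
  -- that vanishes for `y = c` and `y = d`. On each half the terms with `q₂`, `qy` and `p₂`, `py`
  -- therefore cancel by integration by parts in `y`, and no term from the line `x = b` arises
  -- there.
  have step : ∀ l : ℕ,
      ((∫ p in rect a b c d, q₁ p * ((a + e - 2 * p.1) *
          (bubble c d p.2 * recip l (bubble c d p.2))))
        + ∫ p in rect a b c d, qx p * (bubble a e p.1 *
          (bubble c d p.2 * recip l (bubble c d p.2))))
      + ((∫ p in rect b e c d, p₁ p * ((a + e - 2 * p.1) *
          (bubble c d p.2 * recip l (bubble c d p.2))))
        + ∫ p in rect b e c d, px p * (bubble a e p.1 *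
          (bubble c d p.2 * recip l (bubble c d p.2)))) = 0 := by
    intro l
    have hψ : ContDiff ℝ ∞ fun p : ℝ × ℝ => recip l (bubble c d p.2) :=
      (contDiff_recip l).comp ((contDiff_bubble c d).comp contDiff_snd)
    have hχ : ContDiff ℝ ∞ fun p : ℝ × ℝ => bubble a e p.1 * recip l (bubble c d p.2) :=
      ((contDiff_bubble a e).comp contDiff_fst).mul hψ
    have lim := (((tendsto_setIntegral_dx_bubbleTest r1 s1 iq₁ hψ).add
      (tendsto_setIntegral_dy_bubbleTest r1 s1 iq₂ hψ)).add
      (tendsto_setIntegral_bubbleTest r1 s1 iqx hψ)).add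
      (tendsto_setIntegral_bubbleTest r1 s1 iqy hψ) |>.add
      ((((tendsto_setIntegral_dx_bubbleTest r2 s2 ip₁ hψ).add
      (tendsto_setIntegral_dy_bubbleTest r2 s2 ip₂ hψ)).add
      (tendsto_setIntegral_bubbleTest r2 s2 ipx hψ)).add
      (tendsto_setIntegral_bubbleTest r2 s2 ipy hψ))
    simp only [H _ (isTest_bubbleTest hae hcd hψ _)] at lim
    have e0 := tendsto_nhds_unique lim tendsto_const_nhds
    have b1 := hqy.integral_bubble_snd hab hcd hq₂ hχ
    have b2 := hpy.integral_bubble_snd hbe hcd hp₂ hχ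
    have d1 : ∀ p : ℝ × ℝ, dx (fun p : ℝ × ℝ => recip l (bubble c d p.2)) p = 0 := fun p =>
      dx_eq_of_hasDerivAt (hψ.differentiable (by simp) p)
        (hasDerivAt_const p.1 (recip l (bubble c d p.2)))
    have d2 : ∀ p : ℝ × ℝ, dy (fun p : ℝ × ℝ => bubble a e p.1 * recip l (bubble c d p.2)) p
        = bubble a e p.1 * dy (fun p : ℝ × ℝ => recip l (bubble c d p.2)) p := fun p =>
      dy_eq_of_hasDerivAt (hχ.differentiable (by simp) p)
        ((hasDerivAt_dy hψ p.1 p.2).const_mul (bubble a e p.1))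
    have y1 : ∀ p : ℝ × ℝ, dx (bubbleMul a e c d fun p => recip l (bubble c d p.2)) p
        = (a + e - 2 * p.1) * (bubble c d p.2 * recip l (bubble c d p.2)) := fun p => by
      rw [dx_bubbleMul a e c d hψ, d1]; ring
    have y2 : ∀ p : ℝ × ℝ, dy (bubbleMul a e c d fun p => recip l (bubble c d p.2)) p
        = (c + d - 2 * p.2) * (bubble a e p.1 * recip l (bubble c d p.2)) + bubble c d p.2 *
        (bubble a e p.1 * dy (fun p : ℝ × ℝ => recip l (bubble c d p.2)) p) := fun p => by
      rw [dy_bubbleMul a e c d hψ]; ring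
    have y3 : ∀ p : ℝ × ℝ, bubbleMul a e c d (fun p => recip l (bubble c d p.2)) p
        = bubble a e p.1 * (bubble c d p.2 * recip l (bubble c d p.2)) := fun p => by
      simp only [bubbleMul]; ring
    have y4 : ∀ p : ℝ × ℝ, bubble c d p.2 * (bubble a e p.1 * recip l (bubble c d p.2))
        = bubble a e p.1 * (bubble c d p.2 * recip l (bubble c d p.2)) := fun p => by ring
    simp only [d2, y4] at b1 b2
    simp only [y1, y2, y3, b1, b2] at e0
    linarith
  have hcb := (contDiff_bubble a e).continuous
  have lim2 := ((tendsto_setIntegral_recip_snd r1 subset_rfl iq₁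
      (ψ := fun p => a + e - 2 * p.1) (by fun_prop)).add
    (tendsto_setIntegral_recip_snd r1 subset_rfl iqx
      (ψ := fun p => bubble a e p.1) (by fun_prop))).add
    ((tendsto_setIntegral_recip_snd r2 subset_rfl ip₁
      (ψ := fun p => a + e - 2 * p.1) (by fun_prop)).add
    (tendsto_setIntegral_recip_snd r2 subset_rfl ipx
      (ψ := fun p => bubble a e p.1) (by fun_prop)))
  simp only [step] at lim2
  have e1 := tendsto_nhds_unique lim2 tendsto_const_nhds
  have z : ∀ p : ℝ × ℝ, dx (fun _ : ℝ × ℝ => (1 : ℝ)) p = 0 := fun p => by simp [dx]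
  have b1 := hqx.integral_bubble_fst hab hcd hq₁ (ψ := fun _ => 1) contDiff_const
  have b2 := hpx.integral_bubble_fst hbe hcd hp₁ (ψ := fun _ => 1) contDiff_const
  simp only [z, mul_one, mul_zero, add_zero] at b1 b2
  have hcb1 := (contDiff_bubble a b).continuous
  have hcb2 := (contDiff_bubble b e).continuous
  have im : ∀ {v κ : ℝ × ℝ → ℝ} {a b : ℝ}, MemLp v 2 (volume.restrict (rect a b c d)) →
      Continuous κ → Integrable (fun p => v p * κ p) (volume.restrict (rect a b c d)) :=
    fun hv hκ => hv.integrable_mul (memLp_rect_of_continuous hκ _ _ _ _)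
  -- On the left half `bubble a e x = bubble a b x + (e - b) (x - a)`, on the right half `bubble a e
  -- x = bubble b e x - (b - a) (x - e)`. The small bubbles vanish at both ends and contribute
  -- nothing by `b1`, `b2`. The linear parts vanish only on the outer sides and leave the averages
  -- on `x = b`.
  have w1 : (∫ p in rect a b c d, q₁ p * (a + e - 2 * p.1))
      = (∫ p in rect a b c d, q₁ p * (a + b - 2 * p.1)) + (e - b) * ∫ p in rect a b c d, q₁ p := by
    rw [← integral_const_mul, ← integral_add (im hq₁ (by fun_prop)) (iq₁.const_mul _)]
    congr 1; funext p; ring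
  have w2 : (∫ p in rect a b c d, qx p * bubble a e p.1)
      = (∫ p in rect a b c d, qx p * bubble a b p.1)
        + (e - b) * ∫ p in rect a b c d, qx p * (p.1 - a) := by
    rw [← integral_const_mul, ← integral_add (im hqx.1 (by fun_prop))
      ((im hqx.1 (by fun_prop)).const_mul _)]
    congr 1; funext p; simp only [bubble]; ring
  have w3 : (∫ p in rect b e c d, p₁ p * (a + e - 2 * p.1))
      = (∫ p in rect b e c d, p₁ p * (b + e - 2 * p.1))
        + (-(b - a)) * ∫ p in rect b e c d, p₁ p := by
    rw [← integral_const_mul, ← integral_add (im hp₁ (by fun_prop)) (ip₁.const_mul _)]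
    congr 1; funext p; ring
  have w4 : (∫ p in rect b e c d, px p * bubble a e p.1)
      = (∫ p in rect b e c d, px p * bubble b e p.1)
        + (-(b - a)) * ∫ p in rect b e c d, px p * (p.1 - e) := by
    rw [← integral_const_mul, ← integral_add (im hpx.1 (by fun_prop))
      ((im hpx.1 (by fun_prop)).const_mul _)]
    congr 1; funext p; simp only [bubble]; ring
  rw [integral_add (im hqx.1 (by fun_prop)) iq₁, integral_add (im hpx.1 (by fun_prop)) ip₁]
  rw [w1, w2, w3, w4] at e1
  linarith

/-- If the piecewise `H¹` field `(q₁, q₂)`, `(p₁, p₂)` has its elementwise divergence as weak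
divergence, the averages of its normal component from both sides of the line `y = b` agree. -/
theorem normal_flux_snd (hab : a < b) (hbe : b < e) (hcd : c < d)
    (hq₁ : MemLp q₁ 2 (volume.restrict (rect c d a b)))
    (hq₂ : MemLp q₂ 2 (volume.restrict (rect c d a b)))
    (hp₁ : MemLp p₁ 2 (volume.restrict (rect c d b e)))
    (hp₂ : MemLp p₂ 2 (volume.restrict (rect c d b e)))
    (hqx : IsWeakDeriv (rect c d a b) 0 1 q₁ qx) (hqy : IsWeakDeriv (rect c d a b) 1 0 q₂ qy)
    (hpx : IsWeakDeriv (rect c d b e) 0 1 p₁ px) (hpy : IsWeakDeriv (rect c d b e) 1 0 p₂ py)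
    (H : ∀ φ, IsTest (rect c d a e) φ →
      ((∫ p in rect c d a b, q₁ p * dy φ p) + (∫ p in rect c d a b, q₂ p * dx φ p)
        + (∫ p in rect c d a b, qx p * φ p) + ∫ p in rect c d a b, qy p * φ p)
      + ((∫ p in rect c d b e, p₁ p * dy φ p) + (∫ p in rect c d b e, p₂ p * dx φ p)
        + (∫ p in rect c d b e, px p * φ p) + ∫ p in rect c d b e, py p * φ p) = 0) :
    (e - b) * ∫ p in rect c d a b, (qx p * (p.2 - a) + q₁ p)
      = (b - a) * ∫ p in rect c d b e, (px p * (p.2 - e) + p₁ p) := by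
  -- The coordinates are exchanged: `q₁`, `p₁` are the components in `y`, `qx`, `px` their
  -- derivatives in `y`, and `(c, d)` is the interval for `x`.
  have hae := hab.trans hbe
  have s1 : rect c d a b ⊆ rect c d a e :=
    Set.prod_mono subset_rfl (Set.Ioo_subset_Ioo_right hbe.le)
  have s2 : rect c d b e ⊆ rect c d a e := Set.prod_mono subset_rfl (Set.Ioo_subset_Ioo_left hab.le)
  have r1 := measurableSet_rect c d a b
  have r2 := measurableSet_rect c d b e
  have iq₁ := hq₁.integrable (q := 2) (by norm_num)
  have iq₂ := hq₂.integrable (q := 2) (by norm_num)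
  have ip₁ := hp₁.integrable (q := 2) (by norm_num)
  have ip₂ := hp₂.integrable (q := 2) (by norm_num)
  have iqx := hqx.1.integrable (q := 2) (by norm_num)
  have iqy := hqy.1.integrable (q := 2) (by norm_num)
  have ipx := hpx.1.integrable (q := 2) (by norm_num)
  have ipy := hpy.1.integrable (q := 2) (by norm_num)
  have step : ∀ l : ℕ,
      ((∫ p in rect c d a b, q₁ p * ((a + e - 2 * p.2) *
          (bubble c d p.1 * recip l (bubble c d p.1))))
        + ∫ p in rect c d a b, qx p * (bubble a e p.2 *
          (bubble c d p.1 * recip l (bubble c d p.1))))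
      + ((∫ p in rect c d b e, p₁ p * ((a + e - 2 * p.2) *
          (bubble c d p.1 * recip l (bubble c d p.1))))
        + ∫ p in rect c d b e, px p * (bubble a e p.2 *
          (bubble c d p.1 * recip l (bubble c d p.1)))) = 0 := by
    intro l
    have hψ : ContDiff ℝ ∞ fun p : ℝ × ℝ => recip l (bubble c d p.1) :=
      (contDiff_recip l).comp ((contDiff_bubble c d).comp contDiff_fst)
    have hχ : ContDiff ℝ ∞ fun p : ℝ × ℝ => bubble a e p.2 * recip l (bubble c d p.1) :=
      ((contDiff_bubble a e).comp contDiff_snd).mul hψ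
    have lim := (((tendsto_setIntegral_dy_bubbleTest r1 s1 iq₁ hψ).add
      (tendsto_setIntegral_dx_bubbleTest r1 s1 iq₂ hψ)).add
      (tendsto_setIntegral_bubbleTest r1 s1 iqx hψ)).add
      (tendsto_setIntegral_bubbleTest r1 s1 iqy hψ) |>.add
      ((((tendsto_setIntegral_dy_bubbleTest r2 s2 ip₁ hψ).add
      (tendsto_setIntegral_dx_bubbleTest r2 s2 ip₂ hψ)).add
      (tendsto_setIntegral_bubbleTest r2 s2 ipx hψ)).add
      (tendsto_setIntegral_bubbleTest r2 s2 ipy hψ))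
    simp only [H _ (isTest_bubbleTest hcd hae hψ _)] at lim
    have e0 := tendsto_nhds_unique lim tendsto_const_nhds
    have b1 := hqy.integral_bubble_fst hcd hab hq₂ hχ
    have b2 := hpy.integral_bubble_fst hcd hbe hp₂ hχ
    have d1 : ∀ p : ℝ × ℝ, dy (fun p : ℝ × ℝ => recip l (bubble c d p.1)) p = 0 := fun p =>
      dy_eq_of_hasDerivAt (hψ.differentiable (by simp) p)
        (hasDerivAt_const p.2 (recip l (bubble c d p.1)))
    have d2 : ∀ p : ℝ × ℝ, dx (fun p : ℝ × ℝ => bubble a e p.2 * recip l (bubble c d p.1)) p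
        = bubble a e p.2 * dx (fun p : ℝ × ℝ => recip l (bubble c d p.1)) p := fun p =>
      dx_eq_of_hasDerivAt (hχ.differentiable (by simp) p)
        ((hasDerivAt_dx hψ p.1 p.2).const_mul (bubble a e p.2))
    have y1 : ∀ p : ℝ × ℝ, dy (bubbleMul c d a e fun p => recip l (bubble c d p.1)) p
        = (a + e - 2 * p.2) * (bubble c d p.1 * recip l (bubble c d p.1)) := fun p => by
      rw [dy_bubbleMul c d a e hψ, d1]; ring
    have y2 : ∀ p : ℝ × ℝ, dx (bubbleMul c d a e fun p => recip l (bubble c d p.1)) p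
        = (c + d - 2 * p.1) * (bubble a e p.2 * recip l (bubble c d p.1)) + bubble c d p.1 *
        (bubble a e p.2 * dx (fun p : ℝ × ℝ => recip l (bubble c d p.1)) p) := fun p => by
      rw [dx_bubbleMul c d a e hψ]; ring
    have y3 : ∀ p : ℝ × ℝ, bubbleMul c d a e (fun p => recip l (bubble c d p.1)) p
        = bubble a e p.2 * (bubble c d p.1 * recip l (bubble c d p.1)) := fun p => by
      simp only [bubbleMul]; ring
    have y4 : ∀ p : ℝ × ℝ, bubble c d p.1 * (bubble a e p.2 * recip l (bubble c d p.1))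
        = bubble a e p.2 * (bubble c d p.1 * recip l (bubble c d p.1)) := fun p => by ring
    simp only [d2, y4] at b1 b2
    simp only [y1, y2, y3, b1, b2] at e0
    linarith
  have hcb := (contDiff_bubble a e).continuous
  have lim2 := ((tendsto_setIntegral_recip_fst r1 subset_rfl iq₁
      (ψ := fun p => a + e - 2 * p.2) (by fun_prop)).add
    (tendsto_setIntegral_recip_fst r1 subset_rfl iqx
      (ψ := fun p => bubble a e p.2) (by fun_prop))).add
    ((tendsto_setIntegral_recip_fst r2 subset_rfl ip₁
      (ψ := fun p => a + e - 2 * p.2) (by fun_prop)).add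
    (tendsto_setIntegral_recip_fst r2 subset_rfl ipx
      (ψ := fun p => bubble a e p.2) (by fun_prop)))
  simp only [step] at lim2
  have e1 := tendsto_nhds_unique lim2 tendsto_const_nhds
  have z : ∀ p : ℝ × ℝ, dy (fun _ : ℝ × ℝ => (1 : ℝ)) p = 0 := fun p => by simp [dy]
  have b1 := hqx.integral_bubble_snd hcd hab hq₁ (ψ := fun _ => 1) contDiff_const
  have b2 := hpx.integral_bubble_snd hcd hbe hp₁ (ψ := fun _ => 1) contDiff_const
  simp only [z, mul_one, mul_zero, add_zero] at b1 b2
  have hcb1 := (contDiff_bubble a b).continuous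
  have hcb2 := (contDiff_bubble b e).continuous
  have im : ∀ {v κ : ℝ × ℝ → ℝ} {a b : ℝ}, MemLp v 2 (volume.restrict (rect c d a b)) →
      Continuous κ → Integrable (fun p => v p * κ p) (volume.restrict (rect c d a b)) :=
    fun hv hκ => hv.integrable_mul (memLp_rect_of_continuous hκ _ _ _ _)
  have w1 : (∫ p in rect c d a b, q₁ p * (a + e - 2 * p.2))
      = (∫ p in rect c d a b, q₁ p * (a + b - 2 * p.2)) + (e - b) * ∫ p in rect c d a b, q₁ p := by
    rw [← integral_const_mul, ← integral_add (im hq₁ (by fun_prop)) (iq₁.const_mul _)]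
    congr 1; funext p; ring
  have w2 : (∫ p in rect c d a b, qx p * bubble a e p.2)
      = (∫ p in rect c d a b, qx p * bubble a b p.2)
        + (e - b) * ∫ p in rect c d a b, qx p * (p.2 - a) := by
    rw [← integral_const_mul, ← integral_add (im hqx.1 (by fun_prop))
      ((im hqx.1 (by fun_prop)).const_mul _)]
    congr 1; funext p; simp only [bubble]; ring
  have w3 : (∫ p in rect c d b e, p₁ p * (a + e - 2 * p.2))
      = (∫ p in rect c d b e, p₁ p * (b + e - 2 * p.2))
        + (-(b - a)) * ∫ p in rect c d b e, p₁ p := by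
    rw [← integral_const_mul, ← integral_add (im hp₁ (by fun_prop)) (ip₁.const_mul _)]
    congr 1; funext p; ring
  have w4 : (∫ p in rect c d b e, px p * bubble a e p.2)
      = (∫ p in rect c d b e, px p * bubble b e p.2)
        + (-(b - a)) * ∫ p in rect c d b e, px p * (p.2 - e) := by
    rw [← integral_const_mul, ← integral_add (im hpx.1 (by fun_prop))
      ((im hpx.1 (by fun_prop)).const_mul _)]
    congr 1; funext p; simp only [bubble]; ring
  rw [integral_add (im hqx.1 (by fun_prop)) iq₁, integral_add (im hpx.1 (by fun_prop)) ip₁]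
  rw [w1, w2, w3, w4] at e1
  linarith

end Flux

/-! ### Moments and traces on a rectangle -/

section Moments

variable {U : Set (ℝ × ℝ)} {v vx vxx : ℝ × ℝ → ℝ} {a b c d r r' : ℝ}

theorem integrable_mul_continuous {κ : ℝ × ℝ → ℝ}
    (hv : MemLp v 2 (volume.restrict (rect a b c d))) (hκ : Continuous κ) :
    Integrable (fun p => v p * κ p) (volume.restrict (rect a b c d)) :=
  hv.integrable_mul (memLp_rect_of_continuous hκ _ _ _ _)

theorem abs_sub_midpoint_le {a b t : ℝ} (ht : t ∈ Set.Ioo a b) : |t - (a + b) / 2| ≤ (b - a) / 2 :=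
  abs_le.2 ⟨by linarith [ht.1], by linarith [ht.2]⟩

theorem abs_bubble_le {a b t : ℝ} (ht : t ∈ Set.Ioo a b) : |bubble a b t| ≤ (b - a) ^ 2 / 4 := by
  rw [abs_of_pos (bubble_pos ht), bubble]
  nlinarith [sq_nonneg (t - (a + b) / 2)]

/-- Splitting `x - s` at the midpoint separates the two averages: their difference sees only `∫ vx`,
while their mean sees the centred moment of `vx` and `∫ v`. -/
theorem integral_traces_fst (hv : MemLp v 2 (volume.restrict (rect a b c d)))
    (hvx : MemLp vx 2 (volume.restrict (rect a b c d)))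
    (hl : (b - a) * (d - c) * r = ∫ p in rect a b c d, (vx p * (p.1 - b) + v p))
    (hr : (b - a) * (d - c) * r' = ∫ p in rect a b c d, (vx p * (p.1 - a) + v p)) :
    (b - a) * (d - c) * (r' - r) = (b - a) * (∫ p in rect a b c d, vx p) ∧
      (b - a) * (d - c) * ((r + r') / 2) =
        (∫ p in rect a b c d, vx p * (p.1 - (a + b) / 2)) + ∫ p in rect a b c d, v p := by
  have i0 := hv.integrable (q := 2) (by norm_num)
  have i1 := hvx.integrable (q := 2) (by norm_num)
  have im := integrable_mul_continuous hvx (κ := fun p => p.1 - (a + b) / 2) (by fun_prop)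
  have e : ∀ s : ℝ, ∫ p in rect a b c d, (vx p * (p.1 - s) + v p) =
      (∫ p in rect a b c d, vx p * (p.1 - (a + b) / 2))
        + ((a + b) / 2 - s) * (∫ p in rect a b c d, vx p) + ∫ p in rect a b c d, v p := by
    intro s
    rw [← integral_const_mul, ← integral_add im (i1.const_mul _),
      ← integral_add (f := fun p => vx p * (p.1 - (a + b) / 2) + ((a + b) / 2 - s) * vx p)
        (im.add (i1.const_mul _)) i0]
    congr 1; funext p; ring
  rw [e] at hl hr
  constructor <;> linarith

/-- The first moment in `x` of a function with a weak derivative in `x`. -/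
theorem IsWeakDeriv.moment_fst (hab : a < b) (hcd : c < d)
    (hvx : IsWeakDeriv (rect a b c d) 1 0 v vx) (hv : MemLp v 2 (volume.restrict (rect a b c d))) :
    ∫ p in rect a b c d, v p * (p.1 - (a + b) / 2) =
      (∫ p in rect a b c d, vx p * bubble a b p.1) / 2 := by
  have e := hvx.integral_bubble_fst hab hcd hv (ψ := fun _ => 1) contDiff_const
  have z : ∀ p : ℝ × ℝ, dx (fun _ : ℝ × ℝ => (1 : ℝ)) p = 0 := fun p => by simp [dx]
  simp only [z, mul_one, mul_zero, add_zero] at e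
  have e2 : ∫ p in rect a b c d, v p * (a + b - 2 * p.1) =
      (-2) * ∫ p in rect a b c d, v p * (p.1 - (a + b) / 2) := by
    rw [← integral_const_mul]
    congr 1; funext p; ring
  linarith

/-- Passing to the bubble, of size `(b - a)² / 4`, gains two powers of the width at the cost of one
derivative; the plain Cauchy–Schwarz bound in `sq_integral_sub_midpoint_fst_le` gains one power. -/
theorem IsWeakDeriv.sq_moment_fst_le (hab : a < b) (hcd : c < d)
    (hvx : IsWeakDeriv (rect a b c d) 1 0 v vx) (hv : MemLp v 2 (volume.restrict (rect a b c d))) :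
    (∫ p in rect a b c d, v p * (p.1 - (a + b) / 2)) ^ 2 ≤
      (b - a) ^ 4 * ((b - a) * (d - c)) * ∫ p in rect a b c d, vx p ^ 2 := by
  have hcb := (contDiff_bubble a b).continuous
  have h := sq_integral_mul_le hab hcd hvx.1 (κ := fun p => bubble a b p.1) (by fun_prop)
    fun p hp => abs_bubble_le hp.1
  have h0 : 0 ≤ (b - a) ^ 4 * ((b - a) * (d - c)) * ∫ p in rect a b c d, vx p ^ 2 :=
    mul_nonneg (mul_nonneg (by positivity) (mul_pos (sub_pos.2 hab) (sub_pos.2 hcd)).le)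
      (integral_nonneg fun p => sq_nonneg _)
  rw [hvx.moment_fst hab hcd hv]
  linarith

theorem sq_integral_sub_midpoint_fst_le (hab : a < b) (hcd : c < d)
    (hv : MemLp v 2 (volume.restrict (rect a b c d))) :
    (∫ p in rect a b c d, v p * (p.1 - (a + b) / 2)) ^ 2 ≤
      (b - a) ^ 2 * ((b - a) * (d - c)) * ∫ p in rect a b c d, v p ^ 2 := by
  have h := sq_integral_mul_le hab hcd hv (κ := fun p => p.1 - (a + b) / 2) (by fun_prop)
    fun p hp => abs_sub_midpoint_le hp.1
  have h0 : 0 ≤ (b - a) ^ 2 * ((b - a) * (d - c)) * ∫ p in rect a b c d, v p ^ 2 :=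
    mul_nonneg (mul_nonneg (by positivity) (mul_pos (sub_pos.2 hab) (sub_pos.2 hcd)).le)
      (integral_nonneg fun p => sq_nonneg _)
  linarith

/-- The moment is half the integral of `vx` against the bubble. The bubble has mean `(b - a)² / 6`,
which produces the factor `1 / 12` of the correction, and its deviation from the mean is a
derivative: `3 * bubble - (b - a)² / 2` is the derivative of `bubble * (x - (a + b) / 2)`. -/
theorem sq_moment_fst_sub_le (hab : a < b) (hcd : c < d)
    (hvx : IsWeakDeriv (rect a b c d) 1 0 v vx) (hvxx : IsWeakDeriv (rect a b c d) 1 0 vx vxx)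
    (hv : MemLp v 2 (volume.restrict (rect a b c d))) :
    ((∫ p in rect a b c d, v p * (p.1 - (a + b) / 2))
        - (b - a) ^ 2 / 12 * ∫ p in rect a b c d, vx p) ^ 2 ≤
      (b - a) ^ 6 / 4 * ((b - a) * (d - c)) * ∫ p in rect a b c d, vxx p ^ 2 := by
  have hcb := (contDiff_bubble a b).continuous
  have hψ : ContDiff ℝ ∞ fun p : ℝ × ℝ => p.1 - (a + b) / 2 := by fun_prop
  have e := hvxx.integral_bubble_fst hab hcd hvx.1 hψ
  have z : ∀ p : ℝ × ℝ, dx (fun p : ℝ × ℝ => p.1 - (a + b) / 2) p = 1 := fun p =>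
    dx_eq_of_hasDerivAt (hψ.differentiable (by simp) p)
      ((hasDerivAt_id p.1).sub_const ((a + b) / 2))
  have ib := integrable_mul_continuous hvx.1 (κ := fun p => bubble a b p.1) (by fun_prop)
  have i1 := hvx.1.integrable (q := 2) (by norm_num)
  have e2 : ∫ p in rect a b c d, vx p * ((a + b - 2 * p.1) * (p.1 - (a + b) / 2) +
      bubble a b p.1 * 1) = 3 * (∫ p in rect a b c d, vx p * bubble a b p.1)
        - (b - a) ^ 2 / 2 * ∫ p in rect a b c d, vx p := by
    rw [← integral_const_mul, ← integral_const_mul,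
      ← integral_sub (ib.const_mul _) (i1.const_mul _)]
    congr 1; funext p; simp only [bubble]; ring
  simp only [z] at e
  rw [e2] at e
  have h := sq_integral_mul_le hab hcd hvxx.1 (K := (b - a) ^ 2 / 4 * ((b - a) / 2))
    (κ := fun p => bubble a b p.1 * (p.1 - (a + b) / 2)) (by fun_prop) fun p hp => by
      rw [abs_mul]
      exact mul_le_mul (abs_bubble_le hp.1) (abs_sub_midpoint_le hp.1) (abs_nonneg _)
        (by positivity)
  have h0 : 0 ≤ (b - a) ^ 6 * ((b - a) * (d - c)) * ∫ p in rect a b c d, vxx p ^ 2 :=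
    mul_nonneg (mul_nonneg (by positivity) (mul_pos (sub_pos.2 hab) (sub_pos.2 hcd)).le)
      (integral_nonneg fun p => sq_nonneg _)
  rw [hvx.moment_fst hab hcd hv]
  have e3 : (∫ p in rect a b c d, vx p * bubble a b p.1) / 2
      - (b - a) ^ 2 / 12 * ∫ p in rect a b c d, vx p
      = -(1 / 6) * ∫ p in rect a b c d, vxx p * (bubble a b p.1 * (p.1 - (a + b) / 2)) := by
    linarith
  rw [e3]
  nlinarith

variable {vy vyy : ℝ × ℝ → ℝ}

theorem integral_traces_snd (hv : MemLp v 2 (volume.restrict (rect a b c d)))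
    (hvy : MemLp vy 2 (volume.restrict (rect a b c d)))
    (hl : (b - a) * (d - c) * r = ∫ p in rect a b c d, (vy p * (p.2 - d) + v p))
    (hr : (b - a) * (d - c) * r' = ∫ p in rect a b c d, (vy p * (p.2 - c) + v p)) :
    (b - a) * (d - c) * (r' - r) = (d - c) * (∫ p in rect a b c d, vy p) ∧
      (b - a) * (d - c) * ((r + r') / 2) =
        (∫ p in rect a b c d, vy p * (p.2 - (c + d) / 2)) + ∫ p in rect a b c d, v p := by
  have i0 := hv.integrable (q := 2) (by norm_num)
  have i1 := hvy.integrable (q := 2) (by norm_num)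
  have im := integrable_mul_continuous hvy (κ := fun p => p.2 - (c + d) / 2) (by fun_prop)
  have e : ∀ s : ℝ, ∫ p in rect a b c d, (vy p * (p.2 - s) + v p) =
      (∫ p in rect a b c d, vy p * (p.2 - (c + d) / 2))
        + ((c + d) / 2 - s) * (∫ p in rect a b c d, vy p) + ∫ p in rect a b c d, v p := by
    intro s
    rw [← integral_const_mul, ← integral_add im (i1.const_mul _),
      ← integral_add (f := fun p => vy p * (p.2 - (c + d) / 2) + ((c + d) / 2 - s) * vy p)
        (im.add (i1.const_mul _)) i0]
    congr 1; funext p; ring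
  rw [e] at hl hr
  constructor <;> linarith

/-- The first moment in `y` of a function with a weak derivative in `y`. -/
theorem IsWeakDeriv.moment_snd (hab : a < b) (hcd : c < d)
    (hvy : IsWeakDeriv (rect a b c d) 0 1 v vy) (hv : MemLp v 2 (volume.restrict (rect a b c d))) :
    ∫ p in rect a b c d, v p * (p.2 - (c + d) / 2) =
      (∫ p in rect a b c d, vy p * bubble c d p.2) / 2 := by
  have e := hvy.integral_bubble_snd hab hcd hv (ψ := fun _ => 1) contDiff_const
  have z : ∀ p : ℝ × ℝ, dy (fun _ : ℝ × ℝ => (1 : ℝ)) p = 0 := fun p => by simp [dy]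
  simp only [z, mul_one, mul_zero, add_zero] at e
  have e2 : ∫ p in rect a b c d, v p * (c + d - 2 * p.2) =
      (-2) * ∫ p in rect a b c d, v p * (p.2 - (c + d) / 2) := by
    rw [← integral_const_mul]
    congr 1; funext p; ring
  linarith

theorem IsWeakDeriv.sq_moment_snd_le (hab : a < b) (hcd : c < d)
    (hvy : IsWeakDeriv (rect a b c d) 0 1 v vy) (hv : MemLp v 2 (volume.restrict (rect a b c d))) :
    (∫ p in rect a b c d, v p * (p.2 - (c + d) / 2)) ^ 2 ≤
      (d - c) ^ 4 * ((b - a) * (d - c)) * ∫ p in rect a b c d, vy p ^ 2 := by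
  have hcb := (contDiff_bubble c d).continuous
  have h := sq_integral_mul_le hab hcd hvy.1 (κ := fun p => bubble c d p.2) (by fun_prop)
    fun p hp => abs_bubble_le hp.2
  have h0 : 0 ≤ (d - c) ^ 4 * ((b - a) * (d - c)) * ∫ p in rect a b c d, vy p ^ 2 :=
    mul_nonneg (mul_nonneg (by positivity) (mul_pos (sub_pos.2 hab) (sub_pos.2 hcd)).le)
      (integral_nonneg fun p => sq_nonneg _)
  rw [hvy.moment_snd hab hcd hv]
  linarith

theorem sq_integral_sub_midpoint_snd_le (hab : a < b) (hcd : c < d)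
    (hv : MemLp v 2 (volume.restrict (rect a b c d))) :
    (∫ p in rect a b c d, v p * (p.2 - (c + d) / 2)) ^ 2 ≤
      (d - c) ^ 2 * ((b - a) * (d - c)) * ∫ p in rect a b c d, v p ^ 2 := by
  have h := sq_integral_mul_le hab hcd hv (κ := fun p => p.2 - (c + d) / 2) (by fun_prop)
    fun p hp => abs_sub_midpoint_le hp.2
  have h0 : 0 ≤ (d - c) ^ 2 * ((b - a) * (d - c)) * ∫ p in rect a b c d, v p ^ 2 :=
    mul_nonneg (mul_nonneg (by positivity) (mul_pos (sub_pos.2 hab) (sub_pos.2 hcd)).le)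
      (integral_nonneg fun p => sq_nonneg _)
  linarith

theorem sq_moment_snd_sub_le (hab : a < b) (hcd : c < d)
    (hvy : IsWeakDeriv (rect a b c d) 0 1 v vy) (hvyy : IsWeakDeriv (rect a b c d) 0 1 vy vyy)
    (hv : MemLp v 2 (volume.restrict (rect a b c d))) :
    ((∫ p in rect a b c d, v p * (p.2 - (c + d) / 2))
        - (d - c) ^ 2 / 12 * ∫ p in rect a b c d, vy p) ^ 2 ≤
      (d - c) ^ 6 / 4 * ((b - a) * (d - c)) * ∫ p in rect a b c d, vyy p ^ 2 := by
  have hcb := (contDiff_bubble c d).continuous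
  have hψ : ContDiff ℝ ∞ fun p : ℝ × ℝ => p.2 - (c + d) / 2 := by fun_prop
  have e := hvyy.integral_bubble_snd hab hcd hvy.1 hψ
  have z : ∀ p : ℝ × ℝ, dy (fun p : ℝ × ℝ => p.2 - (c + d) / 2) p = 1 := fun p =>
    dy_eq_of_hasDerivAt (hψ.differentiable (by simp) p)
      ((hasDerivAt_id p.2).sub_const ((c + d) / 2))
  have ib := integrable_mul_continuous hvy.1 (κ := fun p => bubble c d p.2) (by fun_prop)
  have i1 := hvy.1.integrable (q := 2) (by norm_num)
  have e2 : ∫ p in rect a b c d, vy p * ((c + d - 2 * p.2) * (p.2 - (c + d) / 2) +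
      bubble c d p.2 * 1) = 3 * (∫ p in rect a b c d, vy p * bubble c d p.2)
        - (d - c) ^ 2 / 2 * ∫ p in rect a b c d, vy p := by
    rw [← integral_const_mul, ← integral_const_mul,
      ← integral_sub (ib.const_mul _) (i1.const_mul _)]
    congr 1; funext p; simp only [bubble]; ring
  simp only [z] at e
  rw [e2] at e
  have h := sq_integral_mul_le hab hcd hvyy.1 (K := (d - c) ^ 2 / 4 * ((d - c) / 2))
    (κ := fun p => bubble c d p.2 * (p.2 - (c + d) / 2)) (by fun_prop) fun p hp => by
      rw [abs_mul]
      exact mul_le_mul (abs_bubble_le hp.2) (abs_sub_midpoint_le hp.2) (abs_nonneg _)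
        (by positivity)
  have h0 : 0 ≤ (d - c) ^ 6 * ((b - a) * (d - c)) * ∫ p in rect a b c d, vyy p ^ 2 :=
    mul_nonneg (mul_nonneg (by positivity) (mul_pos (sub_pos.2 hab) (sub_pos.2 hcd)).le)
      (integral_nonneg fun p => sq_nonneg _)
  rw [hvy.moment_snd hab hcd hv]
  have e3 : (∫ p in rect a b c d, vy p * bubble c d p.2) / 2
      - (d - c) ^ 2 / 12 * ∫ p in rect a b c d, vy p
      = -(1 / 6) * ∫ p in rect a b c d, vyy p * (bubble c d p.2 * (p.2 - (c + d) / 2)) := by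
    linarith
  rw [e3]
  nlinarith

end Moments

open Mesh

variable {M : Mesh}

/-! ### Geometry of the mesh -/

theorem interior_eq_rect (T : M.Elem) : interior T =
    rect (M.x T.1.castSucc) (M.x T.1.succ) (M.y T.2.castSucc) (M.y T.2.succ) := rfl

theorem measurableSet_interior (T : M.Elem) : MeasurableSet (interior T) :=
  measurableSet_rect _ _ _ _

theorem isOpen_interior (T : M.Elem) : IsOpen (interior T) := isOpen_rect _ _ _ _

theorem measurableSet_Omega : MeasurableSet Omega := measurableSet_rect _ _ _ _

instance isFiniteMeasure_restrict_interior (T : M.Elem) :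
    IsFiniteMeasure (volume.restrict (interior T)) :=
  isFiniteMeasure_restrict_rect _ _ _ _

theorem x_lt (T : M.Elem) : M.x T.1.castSucc < M.x T.1.succ := M.x_mono Fin.castSucc_lt_succ

theorem y_lt (T : M.Elem) : M.y T.2.castSucc < M.y T.2.succ := M.y_mono Fin.castSucc_lt_succ

theorem zero_le_x (i : Fin (M.n + 1)) : 0 ≤ M.x i :=
  M.x_zero ▸ M.x_mono.monotone (Fin.zero_le i)

theorem x_le_one (i : Fin (M.n + 1)) : M.x i ≤ 1 :=
  M.x_last ▸ M.x_mono.monotone (Fin.le_last i)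

theorem zero_le_y (i : Fin (M.m + 1)) : 0 ≤ M.y i :=
  M.y_zero ▸ M.y_mono.monotone (Fin.zero_le i)

theorem y_le_one (i : Fin (M.m + 1)) : M.y i ≤ 1 :=
  M.y_last ▸ M.y_mono.monotone (Fin.le_last i)

theorem interior_subset_Omega (T : M.Elem) : interior T ⊆ Omega :=
  Set.prod_mono (Set.Ioo_subset_Ioo (zero_le_x _) (x_le_one _))
    (Set.Ioo_subset_Ioo (zero_le_y _) (y_le_one _))

theorem disjoint_Ioo_of_ne {n : ℕ} {x : Fin (n + 1) → ℝ} (hx : StrictMono x) {i j : Fin n}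
    (hij : i ≠ j) :
    Disjoint (Set.Ioo (x i.castSucc) (x i.succ)) (Set.Ioo (x j.castSucc) (x j.succ)) := by
  have key : ∀ i j : Fin n, i < j →
      Disjoint (Set.Ioo (x i.castSucc) (x i.succ)) (Set.Ioo (x j.castSucc) (x j.succ)) := by
    intro i j h
    rw [Set.disjoint_left]
    intro t h1 h2
    have : x i.succ ≤ x j.castSucc := hx.monotone (Fin.succ_le_castSucc_iff.2 h)
    linarith [h1.2, h2.1]
  rcases lt_or_gt_of_ne hij with h | h
  · exact key i j h
  · exact (key j i h).symm

theorem disjoint_interior {T T' : M.Elem} (h : T ≠ T') : Disjoint (interior T) (interior T') := by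
  by_cases h1 : T.1 = T'.1
  · have h2 : T.2 ≠ T'.2 := fun h2 => h (Prod.ext h1 h2)
    exact Set.disjoint_prod.2 (Or.inr (disjoint_Ioo_of_ne M.y_mono h2))
  · exact Set.disjoint_prod.2 (Or.inl (disjoint_Ioo_of_ne M.x_mono h1))

theorem sum_setIntegral_interior_le {F : ℝ × ℝ → ℝ} (hF : ∀ p, 0 ≤ F p)
    (hi : IntegrableOn F Omega) :
    ∑ T : M.Elem, ∫ p in interior T, F p ≤ ∫ p in Omega, F p := by
  rw [← integral_biUnion_finset Finset.univ (fun T _ => measurableSet_interior T)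
    (fun T _ T' _ h => disjoint_interior h)
    fun T _ => hi.mono_set (interior_subset_Omega T)]
  refine setIntegral_mono_set hi (Eventually.of_forall hF) (LE.le.eventuallyLE ?_)
  exact Set.iUnion₂_subset fun T _ => interior_subset_Omega T

theorem n_pos (M : Mesh) : 0 < M.n := by
  rcases Nat.eq_zero_or_pos M.n with h | h
  · exfalso
    have h0 : (0 : Fin (M.n + 1)) = Fin.last M.n := by
      apply Fin.ext; simp [h]
    have := M.x_zero
    rw [h0, M.x_last] at this
    norm_num at this
  · exact h

theorem m_pos (M : Mesh) : 0 < M.m := by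
  rcases Nat.eq_zero_or_pos M.m with h | h
  · exfalso
    have h0 : (0 : Fin (M.m + 1)) = Fin.last M.m := by
      apply Fin.ext; simp [h]
    have := M.y_zero
    rw [h0, M.y_last] at this
    norm_num at this
  · exact h

theorem sqrt_le_h (T : M.Elem) : Real.sqrt (hx T ^ 2 + hy T ^ 2) ≤ M.h :=
  le_ciSup (f := fun T : M.Elem => Real.sqrt (hx T ^ 2 + hy T ^ 2))
    (Set.finite_range _).bddAbove T

theorem hx_le_h (T : M.Elem) : hx T ≤ M.h :=
  (Real.le_sqrt_of_sq_le (by linarith [sq_nonneg (hy T)])).trans (sqrt_le_h T)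

theorem hy_le_h (T : M.Elem) : hy T ≤ M.h :=
  (Real.le_sqrt_of_sq_le (by linarith [sq_nonneg (hx T)])).trans (sqrt_le_h T)

theorem h_pos (M : Mesh) : 0 < M.h :=
  (hx_pos (M := M) (⟨0, n_pos M⟩, ⟨0, m_pos M⟩)).trans_le (hx_le_h _)

theorem exists_edge_eq (e : M.Edge) : ∃ (T : M.Elem) (s : Fin 4), edge T s = e := by
  rcases e with ⟨i, j⟩ | ⟨i, j⟩
  · rcases i.eq_castSucc_or_eq_last with ⟨i', rfl⟩ | rfl
    · exact ⟨(i', j), 0, rfl⟩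
    · refine ⟨(⟨M.n - 1, Nat.sub_lt (n_pos M) one_pos⟩, j), 1, ?_⟩
      have : (⟨M.n - 1, Nat.sub_lt (n_pos M) one_pos⟩ : Fin M.n).succ = Fin.last M.n :=
        Fin.ext (Nat.sub_add_cancel (n_pos M))
      rw [← this]; rfl
  · rcases j.eq_castSucc_or_eq_last with ⟨j', rfl⟩ | rfl
    · exact ⟨(i, j'), 2, rfl⟩
    · refine ⟨(i, ⟨M.m - 1, Nat.sub_lt (m_pos M) one_pos⟩), 3, ?_⟩
      have : (⟨M.m - 1, Nat.sub_lt (m_pos M) one_pos⟩ : Fin M.m).succ = Fin.last M.m :=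
        Fin.ext (Nat.sub_add_cancel (m_pos M))
      rw [← this]; rfl

/-! ### Averages of traces over the edges of an element -/

def xMid (T : M.Elem) : ℝ := (M.x T.1.castSucc + M.x T.1.succ) / 2

def yMid (T : M.Elem) : ℝ := (M.y T.2.castSucc + M.y T.2.succ) / 2

theorem area_pos (T : M.Elem) : 0 < area T := mul_pos (hx_pos T) (hy_pos T)

section Traces

variable {U : Set (ℝ × ℝ)} {v v' vx vy : ℝ × ℝ → ℝ} {r r' : ℝ} {T : M.Elem}

/-- The almost everywhere equalities allow weak derivatives chosen on `Ω` or on the element to be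
replaced by explicit representatives. -/
theorem traceMeans_vertical (hTU : interior T ⊆ U)
    (hvx : weakDeriv U 1 0 v =ᵐ[volume.restrict (interior T)] vx)
    (hv : v =ᵐ[volume.restrict (interior T)] v') (m : MemLp v' 2 (volume.restrict (interior T)))
    (mx : MemLp vx 2 (volume.restrict (interior T)))
    (h : HasTraceMean U (seg (edge T 0)) v r) (h' : HasTraceMean U (seg (edge T 1)) v r') :
    hy T * (r' - r) = (∫ p in interior T, vx p) ∧
      area T * ((r + r') / 2) =
        (∫ p in interior T, vx p * (p.1 - xMid T)) + ∫ p in interior T, v' p := by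
  have h0 := HasTraceMean.eq_left (x_lt T) (y_lt T) hTU h hvx
  have h1 := HasTraceMean.eq_right (x_lt T) (y_lt T) hTU h' hvx
  have m0 : MemLp v 2 (volume.restrict (interior T)) := m.ae_eq hv.symm
  have := integral_traces_fst m0 mx h0 h1
  have hA : M.x T.1.succ - M.x T.1.castSucc = hx T := rfl
  have hB : M.y T.2.succ - M.y T.2.castSucc = hy T := rfl
  rw [← interior_eq_rect, hA, hB, integral_congr_ae hv] at this
  refine ⟨?_, this.2⟩
  exact mul_left_cancel₀ (hx_pos T).ne' (by linarith [this.1])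

theorem traceMeans_horizontal (hTU : interior T ⊆ U)
    (hvy : weakDeriv U 0 1 v =ᵐ[volume.restrict (interior T)] vy)
    (hv : v =ᵐ[volume.restrict (interior T)] v') (m : MemLp v' 2 (volume.restrict (interior T)))
    (my : MemLp vy 2 (volume.restrict (interior T)))
    (h : HasTraceMean U (seg (edge T 2)) v r) (h' : HasTraceMean U (seg (edge T 3)) v r') :
    hx T * (r' - r) = (∫ p in interior T, vy p) ∧
      area T * ((r + r') / 2) =
        (∫ p in interior T, vy p * (p.2 - yMid T)) + ∫ p in interior T, v' p := by
  have h0 := HasTraceMean.eq_bottom (x_lt T) (y_lt T) hTU h hvy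
  have h1 := HasTraceMean.eq_top (x_lt T) (y_lt T) hTU h' hvy
  have m0 : MemLp v 2 (volume.restrict (interior T)) := m.ae_eq hv.symm
  have := integral_traces_snd m0 my h0 h1
  have hA : M.x T.1.succ - M.x T.1.castSucc = hx T := rfl
  have hB : M.y T.2.succ - M.y T.2.castSucc = hy T := rfl
  rw [← interior_eq_rect, hA, hB, integral_congr_ae hv] at this
  refine ⟨?_, this.2⟩
  exact mul_left_cancel₀ (hy_pos T).ne' (by linarith [this.1])

end Traces

/-- Every edge belongs to some element, and over that element Green's formula expresses the average
by an integral in which the trace does not occur. -/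
theorem HasTraceMean.unique {v : ℝ × ℝ → ℝ} {e : M.Edge} {r r' : ℝ}
    (h : HasTraceMean Omega (seg e) v r) (h' : HasTraceMean Omega (seg e) v r') : r = r' := by
  obtain ⟨T, s, rfl⟩ := exists_edge_eq e
  have hT : interior T ⊆ Omega := interior_subset_Omega T
  have hA := mul_pos (sub_pos.2 (x_lt T)) (sub_pos.2 (y_lt T))
  refine mul_left_cancel₀ hA.ne' ?_
  fin_cases s
  · exact (HasTraceMean.eq_left (x_lt T) (y_lt T) hT h ae_eq_rfl).trans
      (HasTraceMean.eq_left (x_lt T) (y_lt T) hT h' ae_eq_rfl).symm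
  · exact (HasTraceMean.eq_right (x_lt T) (y_lt T) hT h ae_eq_rfl).trans
      (HasTraceMean.eq_right (x_lt T) (y_lt T) hT h' ae_eq_rfl).symm
  · exact (HasTraceMean.eq_bottom (x_lt T) (y_lt T) hT h ae_eq_rfl).trans
      (HasTraceMean.eq_bottom (x_lt T) (y_lt T) hT h' ae_eq_rfl).symm
  · exact (HasTraceMean.eq_top (x_lt T) (y_lt T) hT h ae_eq_rfl).trans
      (HasTraceMean.eq_top (x_lt T) (y_lt T) hT h' ae_eq_rfl).symm

theorem IsEdgeProjection.eq_mean_of_isBdry {u g : ℝ × ℝ → ℝ} {Qu : M.Edge → ℝ}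
    (hQ : IsEdgeProjection u Qu) (hg : ∀ s, IsTrace Omega (side s) u g) {e : M.Edge}
    (he : IsBdry e) : Qu e = (seg e).mean g := by
  refine HasTraceMean.unique (hQ e) ⟨g, ?_, rfl⟩
  rcases e with ⟨i, j⟩ | ⟨i, j⟩
  · have hlo := zero_le_y (M := M) j.castSucc
    have hhi := y_le_one (M := M) j.succ
    rcases he with he | he <;> simp only at he <;> subst he
    · have := (hg 0).subsegment hlo hhi
      simpa [seg, M.x_zero] using this
    · have := (hg 1).subsegment hlo hhi
      simpa [seg, M.x_last] using this
  · have hlo := zero_le_x (M := M) i.castSucc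
    have hhi := x_le_one (M := M) i.succ
    rcases he with he | he <;> simp only at he <;> subst he
    · have := (hg 2).subsegment hlo hhi
      simpa [seg, M.y_zero] using this
    · have := (hg 3).subsegment hlo hhi
      simpa [seg, M.y_last] using this

/-! ### The flux -/

variable {a : M.Elem → Matrix (Fin 2) (Fin 2) ℝ} {f g u : ℝ × ℝ → ℝ}

/-- `∂_x q₁` on the element `T`. -/
def fluxDx (a : M.Elem → Matrix (Fin 2) (Fin 2) ℝ) (u : ℝ × ℝ → ℝ) (T : M.Elem) (p : ℝ × ℝ) : ℝ :=
  a T 0 0 * weakDeriv Omega 2 0 u p + a T 0 1 * weakDeriv Omega 1 1 u p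

/-- `∂_y q₂` on the element `T`. -/
def fluxDy (a : M.Elem → Matrix (Fin 2) (Fin 2) ℝ) (u : ℝ × ℝ → ℝ) (T : M.Elem) (p : ℝ × ℝ) : ℝ :=
  a T 1 0 * weakDeriv Omega 1 1 u p + a T 1 1 * weakDeriv Omega 0 2 u p

/-- `∂_x ∂_y q_{k+1}` on the element `T`. -/
def fluxDxy (a : M.Elem → Matrix (Fin 2) (Fin 2) ℝ) (u : ℝ × ℝ → ℝ) (T : M.Elem) (k : Fin 2)
    (p : ℝ × ℝ) : ℝ :=
  a T k 0 * weakDeriv Omega 2 1 u p + a T k 1 * weakDeriv Omega 1 2 u p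

theorem memLp_weakDeriv (hu : MemH 3 Omega u) (T : M.Elem) {α β : ℕ} (h : α + β ≤ 3) :
    MemLp (weakDeriv Omega α β u) 2 (volume.restrict (interior T)) :=
  (hu.isWeakDeriv h).1.mono_measure (Measure.restrict_mono (interior_subset_Omega T) le_rfl)

theorem isWeakDeriv_succ_left (hu : MemH 3 Omega u) (T : M.Elem) {α β : ℕ} (h : α + 1 + β ≤ 3) :
    IsWeakDeriv (interior T) 1 0 (weakDeriv Omega α β u) (weakDeriv Omega (α + 1) β u) :=
  ((hu.isWeakDeriv (by omega)).succ_left (hu.isWeakDeriv h)).restrict (interior_subset_Omega T)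
    measurableSet_Omega

theorem isWeakDeriv_succ_right (hu : MemH 3 Omega u) (T : M.Elem) {α β : ℕ} (h : α + (β + 1) ≤ 3) :
    IsWeakDeriv (interior T) 0 1 (weakDeriv Omega α β u) (weakDeriv Omega α (β + 1) u) :=
  ((hu.isWeakDeriv (by omega)).succ_right (hu.isWeakDeriv h)).restrict (interior_subset_Omega T)
    measurableSet_Omega

theorem memLp_flux (hu : MemH 3 Omega u) (T : M.Elem)
    (a : M.Elem → Matrix (Fin 2) (Fin 2) ℝ) (k : Fin 2) :
    MemLp (flux a u T k) 2 (volume.restrict (interior T)) :=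
  ((memLp_weakDeriv hu T (by norm_num)).const_mul _).add
    ((memLp_weakDeriv hu T (by norm_num)).const_mul _)

theorem isWeakDeriv_fluxDx (hu : MemH 3 Omega u) (T : M.Elem)
    (a : M.Elem → Matrix (Fin 2) (Fin 2) ℝ) :
    IsWeakDeriv (interior T) 1 0 (flux a u T 0) (fluxDx a u T) :=
  (isWeakDeriv_succ_left hu T (by norm_num)).linearComb
    (isWeakDeriv_succ_left hu T (by norm_num)) (memLp_weakDeriv hu T (by norm_num))
    (memLp_weakDeriv hu T (by norm_num)) _ _

theorem isWeakDeriv_fluxDy (hu : MemH 3 Omega u) (T : M.Elem)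
    (a : M.Elem → Matrix (Fin 2) (Fin 2) ℝ) :
    IsWeakDeriv (interior T) 0 1 (flux a u T 1) (fluxDy a u T) :=
  (isWeakDeriv_succ_right hu T (by norm_num)).linearComb
    (isWeakDeriv_succ_right hu T (by norm_num)) (memLp_weakDeriv hu T (by norm_num))
    (memLp_weakDeriv hu T (by norm_num)) _ _

theorem isWeakDeriv_fluxDxy_zero (hu : MemH 3 Omega u) (T : M.Elem)
    (a : M.Elem → Matrix (Fin 2) (Fin 2) ℝ) :
    IsWeakDeriv (interior T) 0 1 (fluxDx a u T) (fluxDxy a u T 0) :=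
  (isWeakDeriv_succ_right hu T (by norm_num)).linearComb
    (isWeakDeriv_succ_right hu T (by norm_num)) (memLp_weakDeriv hu T (by norm_num))
    (memLp_weakDeriv hu T (by norm_num)) _ _

theorem isWeakDeriv_fluxDxy_one (hu : MemH 3 Omega u) (T : M.Elem)
    (a : M.Elem → Matrix (Fin 2) (Fin 2) ℝ) :
    IsWeakDeriv (interior T) 1 0 (fluxDy a u T) (fluxDxy a u T 1) :=
  (isWeakDeriv_succ_left hu T (by norm_num)).linearComb
    (isWeakDeriv_succ_left hu T (by norm_num)) (memLp_weakDeriv hu T (by norm_num))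
    (memLp_weakDeriv hu T (by norm_num)) _ _

theorem integrable_mul_interior {T : M.Elem} {v κ : ℝ × ℝ → ℝ}
    (hv : MemLp v 2 (volume.restrict (interior T))) (hκ : Continuous κ) :
    Integrable (fun p => v p * κ p) (volume.restrict (interior T)) :=
  integrable_mul_continuous hv hκ

/-! ### The equation on one and on two elements -/

theorem setIntegral_flux_eq_zero {U : Set (ℝ × ℝ)} {T : M.Elem} (h : Disjoint (interior T) U)
    {φ : ℝ × ℝ → ℝ} (hφ : IsTest U φ) :
    ∫ p in interior T, (flux a u T 0 p * dx φ p + flux a u T 1 p * dy φ p) = 0 := by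
  refine setIntegral_eq_zero_of_forall_eq_zero fun p hp => ?_
  have hpU : p ∉ U := Set.disjoint_left.1 h hp
  rw [hφ.dx.eq_zero hpU, hφ.dy.eq_zero hpU, mul_zero, mul_zero, add_zero]

theorem setIntegral_flux (hu : MemH 3 Omega u) {U : Set (ℝ × ℝ)} {T : M.Elem}
    {φ : ℝ × ℝ → ℝ} (hφ : IsTest U φ) :
    ∫ p in interior T, (flux a u T 0 p * dx φ p + flux a u T 1 p * dy φ p) =
      (∫ p in interior T, flux a u T 0 p * dx φ p)
        + ∫ p in interior T, flux a u T 1 p * dy φ p :=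
  integral_add
    (integrable_mul_interior (memLp_flux hu T a 0) (contDiff_dx hφ.1).continuous)
    (integrable_mul_interior (memLp_flux hu T a 1) (contDiff_dy hφ.1).continuous)

/-- Test functions supported in one element see a constant coefficient, so the distributional
equation becomes `f = -∇·q` almost everywhere there. -/
theorem IsSolution.ae_eq (hs : IsSolution a f g u) (hf : MemLp f 2 (volume.restrict Omega))
    (hu : MemH 3 Omega u) (T : M.Elem) :
    f =ᵐ[volume.restrict (interior T)] fun p => -(fluxDx a u T p + fluxDy a u T p) := by
  have hT := interior_subset_Omega T
  have hfT := hf.mono_measure (Measure.restrict_mono hT le_rfl)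
  have hX := isWeakDeriv_fluxDx hu T a
  have hY := isWeakDeriv_fluxDy hu T a
  refine ae_eq_of_forall_test (isOpen_interior T) hfT (hX.1.add hY.1).neg fun φ hφ => ?_
  have e := hs.1 φ (hφ.mono hT)
  rw [hφ.setIntegral_mul hT measurableSet_Omega, Finset.sum_eq_single T
    (fun T' _ h => setIntegral_flux_eq_zero (disjoint_interior h) hφ)
    (fun h => (h (Finset.mem_univ T)).elim), setIntegral_flux hu hφ] at e
  have eX := hX.2 φ hφ
  have eY := hY.2 φ hφ
  simp only [Function.iterate_zero, Function.iterate_one, id] at eX eY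
  rw [← e, eX, eY]
  have e2 : ∀ p, -(fluxDx a u T p + fluxDy a u T p) * φ p
      = -(fluxDx a u T p * φ p + fluxDy a u T p * φ p) := fun p => by ring
  simp only [e2]
  rw [integral_neg, integral_add (hφ.integrable_mul hX.1) (hφ.integrable_mul hY.1)]
  ring

/-- The support of `φ` may cross the common edge of `T` and `T'`. With `f` replaced by the
elementwise divergence, the equation says that this edge carries no source; this is the hypothesis
`H` of `normal_flux_fst` and `normal_flux_snd`. -/
theorem IsSolution.two_elements (hs : IsSolution a f g u)
    (hf : MemLp f 2 (volume.restrict Omega)) (hu : MemH 3 Omega u) {T T' : M.Elem} (hne : T ≠ T')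
    {U : Set (ℝ × ℝ)} (hU : U ⊆ Omega) (hT : interior T ⊆ U)
    (hT' : interior T' ⊆ U) (hd : ∀ S : M.Elem, S ≠ T → S ≠ T' → Disjoint (interior S) U)
    (hnull : volume (U \ (interior T ∪ interior T')) = 0) {φ : ℝ × ℝ → ℝ} (hφ : IsTest U φ) :
    ((∫ p in interior T, flux a u T 0 p * dx φ p) + (∫ p in interior T, flux a u T 1 p * dy φ p)
        + (∫ p in interior T, fluxDx a u T p * φ p) + ∫ p in interior T, fluxDy a u T p * φ p)
      + ((∫ p in interior T', flux a u T' 0 p * dx φ p)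
        + (∫ p in interior T', flux a u T' 1 p * dy φ p)
        + (∫ p in interior T', fluxDx a u T' p * φ p)
        + ∫ p in interior T', fluxDy a u T' p * φ p) = 0 := by
  have e := hs.1 φ (hφ.mono hU)
  have hsum : ∑ S : M.Elem, ∫ p in interior S, (flux a u S 0 p * dx φ p + flux a u S 1 p * dy φ p)
      = (∫ p in interior T, (flux a u T 0 p * dx φ p + flux a u T 1 p * dy φ p))
        + ∫ p in interior T', (flux a u T' 0 p * dx φ p + flux a u T' 1 p * dy φ p) :=
    Finset.sum_eq_add T T' hne
      (fun S _ h => setIntegral_flux_eq_zero (hd S h.1 h.2) hφ)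
      (fun h => (h (Finset.mem_univ T)).elim) (fun h => (h (Finset.mem_univ T')).elim)
  have hfφ : ∀ S : M.Elem, Integrable (fun p => f p * φ p) (volume.restrict (interior S)) :=
    fun S => integrable_mul_continuous
      (hf.mono_measure (Measure.restrict_mono (interior_subset_Omega S) le_rfl)) hφ.1.continuous
  have hrhs : ∫ p in Omega, f p * φ p
      = (∫ p in interior T, f p * φ p) + ∫ p in interior T', f p * φ p := by
    rw [hφ.setIntegral_mul hU measurableSet_Omega,
      ← setIntegral_union (disjoint_interior hne) (measurableSet_interior T') (hfφ T) (hfφ T')]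
    refine setIntegral_congr_set ?_
    refine Filter.EventuallyEq.symm (eventuallyLE_antisymm_iff.2 ⟨?_, ?_⟩)
    · exact LE.le.eventuallyLE (Set.union_subset hT hT')
    · exact ae_le_set.2 hnull
  have hel : ∀ S : M.Elem, ∫ p in interior S, f p * φ p
      = -((∫ p in interior S, fluxDx a u S p * φ p) + ∫ p in interior S, fluxDy a u S p * φ p) := by
    intro S
    rw [← integral_add
      (integrable_mul_interior (isWeakDeriv_fluxDx hu S a).1 hφ.1.continuous)
      (integrable_mul_interior (isWeakDeriv_fluxDy hu S a).1 hφ.1.continuous), ← integral_neg]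
    refine integral_congr_ae ?_
    filter_upwards [hs.ae_eq hf hu S] with p hp
    rw [hp]; ring
  rw [hsum, hrhs, hel T, hel T', setIntegral_flux hu hφ, setIntegral_flux hu hφ] at e
  linarith

/-! ### Continuity of the normal flux across the edges -/

/-- The integral over the edge `e_{s+1}` of `T` of the trace from within `T` of `q₁`
(vertical edges) or `q₂` (horizontal edges). -/
def edgeFlux (a : M.Elem → Matrix (Fin 2) (Fin 2) ℝ) (u : ℝ × ℝ → ℝ) (T : M.Elem) : Fin 4 → ℝ :=
  ![(∫ p in interior T, (fluxDx a u T p * (p.1 - M.x T.1.succ) + flux a u T 0 p)) / hx T,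
    (∫ p in interior T, (fluxDx a u T p * (p.1 - M.x T.1.castSucc) + flux a u T 0 p)) / hx T,
    (∫ p in interior T, (fluxDy a u T p * (p.2 - M.y T.2.succ) + flux a u T 1 p)) / hy T,
    (∫ p in interior T, (fluxDy a u T p * (p.2 - M.y T.2.castSucc) + flux a u T 1 p)) / hy T]

theorem volume_vertical_line (b : ℝ) (s : Set ℝ) : volume (({b} : Set ℝ) ×ˢ s) = 0 := by
  rw [Measure.volume_eq_prod, Measure.prod_prod, Real.volume_singleton, zero_mul]

theorem volume_horizontal_line (b : ℝ) (s : Set ℝ) : volume (s ×ˢ ({b} : Set ℝ)) = 0 := by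
  rw [Measure.volume_eq_prod, Measure.prod_prod, Real.volume_singleton, mul_zero]

theorem Ioo_sdiff_subset {a b c t : ℝ} (h : t ∈ Set.Ioo a c) (h1 : t ∉ Set.Ioo a b)
    (h2 : t ∉ Set.Ioo b c) : t = b := by
  by_contra hne
  rcases lt_or_gt_of_ne hne with h' | h'
  · exact h1 ⟨h.1, h'⟩
  · exact h2 ⟨h', h.2⟩

theorem disjoint_Ioo_adjacent {n : ℕ} {x : Fin (n + 1) → ℝ} (hx : StrictMono x) {i i' k : Fin n}
    (hii : i.succ = i'.castSucc) (h1 : k ≠ i) (h2 : k ≠ i') :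
    Disjoint (Set.Ioo (x k.castSucc) (x k.succ)) (Set.Ioo (x i.castSucc) (x i'.succ)) := by
  rw [Set.disjoint_left]
  intro t ht ht'
  have hv : (i : ℕ) + 1 = i' := by simpa [Fin.ext_iff] using hii
  rcases lt_or_gt_of_ne h1 with h | h
  · have : x k.succ ≤ x i.castSucc := hx.monotone (Fin.succ_le_castSucc_iff.2 h)
    linarith [ht.2, ht'.1]
  · have h3 : i' < k := lt_of_le_of_ne (by rw [Fin.le_def, ← hv]; exact h) (Ne.symm h2)
    have : x i'.succ ≤ x k.castSucc := hx.monotone (Fin.succ_le_castSucc_iff.2 h3)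
    linarith [ht.1, ht'.2]

theorem IsSolution.edgeFlux_vertical (hs : IsSolution a f g u)
    (hf : MemLp f 2 (volume.restrict Omega)) (hu : MemH 3 Omega u) {i i' : Fin M.n} (j : Fin M.m)
    (hii : i.succ = i'.castSucc) : edgeFlux a u (i, j) 1 = edgeFlux a u (i', j) 0 := by
  have hlt : i < i' := by
    have hv : (i : ℕ) + 1 = i' := by simpa [Fin.ext_iff] using hii
    rw [Fin.lt_def]; omega
  have hne : ((i, j) : M.Elem) ≠ (i', j) := fun h => hlt.ne (congrArg Prod.fst h)
  have hl := x_lt (M := M) (i, j)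
  have hr := x_lt (M := M) (i', j)
  have hy' := y_lt (M := M) (i, j)
  simp only at hl hr hy'
  have hr2 : M.x i.succ < M.x i'.succ := by rw [hii]; exact hr
  have er : interior ((i', j) : M.Elem)
      = rect (M.x i.succ) (M.x i'.succ) (M.y j.castSucc) (M.y j.succ) := by
    rw [interior_eq_rect, hii]
  have el : interior ((i, j) : M.Elem)
      = rect (M.x i.castSucc) (M.x i.succ) (M.y j.castSucc) (M.y j.succ) := rfl
  have key := normal_flux_fst (q₁ := flux a u (i, j) 0) (q₂ := flux a u (i, j) 1)
    (p₁ := flux a u (i', j) 0) (p₂ := flux a u (i', j) 1) (qx := fluxDx a u (i, j))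
    (qy := fluxDy a u (i, j)) (px := fluxDx a u (i', j)) (py := fluxDy a u (i', j)) hl hr2 hy'
    (memLp_flux hu (i, j) a 0) (memLp_flux hu (i, j) a 1)
    (er ▸ memLp_flux hu (i', j) a 0) (er ▸ memLp_flux hu (i', j) a 1)
    (isWeakDeriv_fluxDx hu (i, j) a) (isWeakDeriv_fluxDy hu (i, j) a)
    (er ▸ isWeakDeriv_fluxDx hu (i', j) a) (er ▸ isWeakDeriv_fluxDy hu (i', j) a) ?_
  · rw [← er, ← el] at key
    have hA : M.x i.succ - M.x i.castSucc = hx ((i, j) : M.Elem) := rfl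
    have hA' : M.x i'.succ - M.x i.succ = hx ((i', j) : M.Elem) := by rw [hii]; rfl
    rw [hA, hA'] at key
    have g1 : edgeFlux a u (i, j) 1 = (∫ p in interior ((i, j) : M.Elem),
      (fluxDx a u (i, j) p * (p.1 - M.x i.castSucc) + flux a u (i, j) 0 p)) / hx (i, j) := rfl
    have g2 : edgeFlux a u (i', j) 0 = (∫ p in interior ((i', j) : M.Elem),
      (fluxDx a u (i', j) p * (p.1 - M.x i'.succ) + flux a u (i', j) 0 p)) / hx (i', j) := rfl
    rw [g1, g2, div_eq_div_iff (hx_pos _).ne' (hx_pos _).ne']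
    linarith
  · intro φ hφ
    rw [← er, ← el]
    refine hs.two_elements hf hu hne ?_ ?_ ?_ ?_ ?_ hφ
    · exact Set.prod_mono (Set.Ioo_subset_Ioo (zero_le_x _) (x_le_one _))
        (Set.Ioo_subset_Ioo (zero_le_y _) (y_le_one _))
    · exact Set.prod_mono (Set.Ioo_subset_Ioo_right hr2.le) subset_rfl
    · rw [er]
      exact Set.prod_mono (Set.Ioo_subset_Ioo_left hl.le) subset_rfl
    · rintro ⟨k, l⟩ h1 h2
      by_cases hlj : l = j
      · subst hlj
        exact Set.disjoint_prod.2 (Or.inl (disjoint_Ioo_adjacent M.x_mono hii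
          (fun h => h1 (Prod.ext h rfl)) fun h => h2 (Prod.ext h rfl)))
      · exact Set.disjoint_prod.2 (Or.inr (disjoint_Ioo_of_ne M.y_mono hlj))
    · refine measure_mono_null ?_ (volume_vertical_line (M.x i.succ) Set.univ)
      rintro p ⟨hp, hn⟩
      rw [el, er] at hn
      exact ⟨Ioo_sdiff_subset hp.1 (fun h => hn (Or.inl ⟨h, hp.2⟩))
        fun h => hn (Or.inr ⟨h, hp.2⟩), trivial⟩

theorem IsSolution.edgeFlux_horizontal (hs : IsSolution a f g u)
    (hf : MemLp f 2 (volume.restrict Omega)) (hu : MemH 3 Omega u) (i : Fin M.n) {j j' : Fin M.m}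
    (hjj : j.succ = j'.castSucc) : edgeFlux a u (i, j) 3 = edgeFlux a u (i, j') 2 := by
  have hlt : j < j' := by
    have hv : (j : ℕ) + 1 = j' := by simpa [Fin.ext_iff] using hjj
    rw [Fin.lt_def]; omega
  have hne : ((i, j) : M.Elem) ≠ (i, j') := fun h => hlt.ne (congrArg Prod.snd h)
  have hl := y_lt (M := M) (i, j)
  have hr := y_lt (M := M) (i, j')
  have hx' := x_lt (M := M) (i, j)
  simp only at hl hr hx'
  have hr2 : M.y j.succ < M.y j'.succ := by rw [hjj]; exact hr
  have er : interior ((i, j') : M.Elem)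
      = rect (M.x i.castSucc) (M.x i.succ) (M.y j.succ) (M.y j'.succ) := by
    rw [interior_eq_rect, hjj]
  have el : interior ((i, j) : M.Elem)
      = rect (M.x i.castSucc) (M.x i.succ) (M.y j.castSucc) (M.y j.succ) := rfl
  have key := normal_flux_snd (q₁ := flux a u (i, j) 1) (q₂ := flux a u (i, j) 0)
    (p₁ := flux a u (i, j') 1) (p₂ := flux a u (i, j') 0) (qx := fluxDy a u (i, j))
    (qy := fluxDx a u (i, j)) (px := fluxDy a u (i, j')) (py := fluxDx a u (i, j')) hl hr2 hx'
    (memLp_flux hu (i, j) a 1) (memLp_flux hu (i, j) a 0)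
    (er ▸ memLp_flux hu (i, j') a 1) (er ▸ memLp_flux hu (i, j') a 0)
    (isWeakDeriv_fluxDy hu (i, j) a) (isWeakDeriv_fluxDx hu (i, j) a)
    (er ▸ isWeakDeriv_fluxDy hu (i, j') a) (er ▸ isWeakDeriv_fluxDx hu (i, j') a) ?_
  · rw [← er, ← el] at key
    have hA : M.y j.succ - M.y j.castSucc = hy ((i, j) : M.Elem) := rfl
    have hA' : M.y j'.succ - M.y j.succ = hy ((i, j') : M.Elem) := by rw [hjj]; rfl
    rw [hA, hA'] at key
    have g1 : edgeFlux a u (i, j) 3 = (∫ p in interior ((i, j) : M.Elem),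
      (fluxDy a u (i, j) p * (p.2 - M.y j.castSucc) + flux a u (i, j) 1 p)) / hy (i, j) := rfl
    have g2 : edgeFlux a u (i, j') 2 = (∫ p in interior ((i, j') : M.Elem),
      (fluxDy a u (i, j') p * (p.2 - M.y j'.succ) + flux a u (i, j') 1 p)) / hy (i, j') := rfl
    rw [g1, g2, div_eq_div_iff (hy_pos _).ne' (hy_pos _).ne']
    linarith
  · intro φ hφ
    rw [← er, ← el]
    have := hs.two_elements hf hu hne ?_ ?_ ?_ ?_ ?_ hφ
    · linarith
    · exact Set.prod_mono (Set.Ioo_subset_Ioo (zero_le_x _) (x_le_one _))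
        (Set.Ioo_subset_Ioo (zero_le_y _) (y_le_one _))
    · exact Set.prod_mono subset_rfl (Set.Ioo_subset_Ioo_right hr2.le)
    · rw [er]
      exact Set.prod_mono subset_rfl (Set.Ioo_subset_Ioo_left hl.le)
    · rintro ⟨k, l⟩ h1 h2
      by_cases hki : k = i
      · subst hki
        exact Set.disjoint_prod.2 (Or.inr (disjoint_Ioo_adjacent M.y_mono hjj
          (fun h => h1 (Prod.ext rfl h)) fun h => h2 (Prod.ext rfl h)))
      · exact Set.disjoint_prod.2 (Or.inl (disjoint_Ioo_of_ne M.x_mono hki))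
    · refine measure_mono_null ?_ (volume_horizontal_line (M.y j.succ) Set.univ)
      rintro p ⟨hp, hn⟩
      rw [el, er] at hn
      exact ⟨trivial, Ioo_sdiff_subset hp.2 (fun h => hn (Or.inl ⟨hp.1, h⟩))
        fun h => hn (Or.inr ⟨hp.1, h⟩)⟩

/-- Summation by parts along one row or column of elements, with one common flux `K` per node. -/
theorem sum_flux_telescope {n : ℕ} {FR FL : Fin n → ℝ} {v : Fin (n + 1) → ℝ} (h0 : v 0 = 0)
    (h1 : v (Fin.last n) = 0) (h : ∀ i i' : Fin n, i.succ = i'.castSucc → FR i = FL i') :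
    ∑ i, (FR i * v i.succ - FL i * v i.castSucc) = 0 := by
  -- The value of `K` at the last node is immaterial, since `v` vanishes there.
  set K : Fin (n + 1) → ℝ := Fin.lastCases 0 FL with hK
  have e1 : ∀ i : Fin n, FL i * v i.castSucc = K i.castSucc * v i.castSucc := fun i => by
    simp [hK]
  have e2 : ∀ i : Fin n, FR i * v i.succ = K i.succ * v i.succ := by
    intro i
    rcases i.succ.eq_castSucc_or_eq_last with ⟨i', hi⟩ | hi
    · rw [h i i' hi, hi]; simp [hK]
    · rw [hi, h1, mul_zero, mul_zero]
  simp only [e1, e2, Finset.sum_sub_distrib]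
  have s1 := Fin.sum_univ_succ fun i => K i * v i
  have s2 := Fin.sum_univ_castSucc fun i => K i * v i
  rw [h0, mul_zero, zero_add] at s1
  rw [h1, mul_zero, add_zero] at s2
  rw [← s1, ← s2, sub_self]

theorem IsSolution.sum_edgeFlux (hs : IsSolution a f g u)
    (hf : MemLp f 2 (volume.restrict Omega)) (hu : MemH 3 Omega u) {v : M.Edge → ℝ}
    (hv : ∀ e, IsBdry e → v e = 0) :
    ∑ T : M.Elem, (edgeFlux a u T 1 * v (edge T 1) - edgeFlux a u T 0 * v (edge T 0)
      + (edgeFlux a u T 3 * v (edge T 3) - edgeFlux a u T 2 * v (edge T 2))) = 0 := by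
  rw [Finset.sum_add_distrib, Fintype.sum_prod_type_right, Fintype.sum_prod_type]
  have e1 : ∀ j : Fin M.m, ∑ i : Fin M.n, (edgeFlux a u (i, j) 1 * v (edge (i, j) 1)
      - edgeFlux a u (i, j) 0 * v (edge (i, j) 0)) = 0 := fun j =>
    sum_flux_telescope (v := fun i => v (.inl (i, j))) (hv _ (Or.inl rfl)) (hv _ (Or.inr rfl))
      fun i i' h => hs.edgeFlux_vertical hf hu j h
  have e2 : ∀ i : Fin M.n, ∑ j : Fin M.m, (edgeFlux a u (i, j) 3 * v (edge (i, j) 3)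
      - edgeFlux a u (i, j) 2 * v (edge (i, j) 2)) = 0 := fun i =>
    sum_flux_telescope (v := fun j => v (.inr (i, j))) (hv _ (Or.inl rfl)) (hv _ (Or.inr rfl))
      fun j j' h => hs.edgeFlux_horizontal hf hu i h
  simp only [e1, e2, Finset.sum_const_zero, add_zero]

/-! ### The extension of edge functions -/

/-- `v_b - Q_b S(v_b)` equals `θ |e₃|` on the vertical and `-θ |e₁|` on the horizontal edges. -/
def defect (vb : M.Edge → ℝ) (T : M.Elem) : ℝ :=
  (vb (edge T 0) + vb (edge T 1) - vb (edge T 2) - vb (edge T 3)) / (2 * (hx T + hy T))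

theorem seg_edge_lt (T : M.Elem) (s : Fin 4) : (seg (edge T s)).lo < (seg (edge T s)).hi := by
  fin_cases s
  · exact y_lt T
  · exact y_lt T
  · exact x_lt T
  · exact x_lt T

theorem mean_affine_edge (c : Fin 3 → ℝ) (T : M.Elem) :
    (seg (edge T 0)).mean (affine c) = c 0 + c 1 * (xMid T - hx T / 2) + c 2 * yMid T ∧
    (seg (edge T 1)).mean (affine c) = c 0 + c 1 * (xMid T + hx T / 2) + c 2 * yMid T ∧
    (seg (edge T 2)).mean (affine c) = c 0 + c 1 * xMid T + c 2 * (yMid T - hy T / 2) ∧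
    (seg (edge T 3)).mean (affine c) = c 0 + c 1 * xMid T + c 2 * (yMid T + hy T / 2) := by
  refine ⟨?_, ?_, ?_, ?_⟩ <;> rw [mean_affine _ _ (seg_edge_lt T _)] <;>
    simp only [affine, edge, seg, Seg.pt, xMid, yMid, hx, hy, Matrix.cons_val_zero,
      Matrix.cons_val_one, Matrix.cons_val, if_true, Bool.false_eq_true, if_false] <;> ring

theorem extS_apply (vb : M.Edge → ℝ) (T : M.Elem) :
    extS vb T 0 = (hy T * (vb (edge T 0) + vb (edge T 1)) + hx T * (vb (edge T 2) + vb (edge T 3)))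
        / (2 * (hx T + hy T)) - weakGrad vb T 0 * xMid T - weakGrad vb T 1 * yMid T ∧
      extS vb T 1 = weakGrad vb T 0 ∧ extS vb T 2 = weakGrad vb T 1 :=
  ⟨rfl, rfl, rfl⟩

theorem weakGrad_apply (vb : M.Edge → ℝ) (T : M.Elem) :
    weakGrad vb T 0 = (vb (edge T 1) - vb (edge T 0)) / hx T ∧
      weakGrad vb T 1 = (vb (edge T 3) - vb (edge T 2)) / hy T :=
  ⟨rfl, rfl⟩

/-- Edge averages of linear polynomials fill a three-dimensional subspace of the four edge values,
and `S` projects onto it in the inner product weighted by edge lengths. The residual lies on the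
remaining line. -/
theorem sub_mean_extS (vb : M.Edge → ℝ) (T : M.Elem) :
    vb (edge T 0) - (seg (edge T 0)).mean (affine (extS vb T)) = defect vb T * hx T ∧
    vb (edge T 1) - (seg (edge T 1)).mean (affine (extS vb T)) = defect vb T * hx T ∧
    vb (edge T 2) - (seg (edge T 2)).mean (affine (extS vb T)) = -(defect vb T * hy T) ∧
    vb (edge T 3) - (seg (edge T 3)).mean (affine (extS vb T)) = -(defect vb T * hy T) := by
  obtain ⟨m0, m1, m2, m3⟩ := mean_affine_edge (extS vb T) T
  obtain ⟨s0, s1, s2⟩ := extS_apply vb T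
  obtain ⟨g0, g1⟩ := weakGrad_apply vb T
  have hA := (hx_pos T).ne'
  have hB := (hy_pos T).ne'
  have hAB := (add_pos (hx_pos T) (hy_pos T)).ne'
  rw [m0, m1, m2, m3, s0, s1, s2, g0, g1, defect]
  refine ⟨?_, ?_, ?_, ?_⟩ <;> field_simp <;> ring

theorem stab_extS_self (vb : M.Edge → ℝ) (T : M.Elem) :
    ∑ s : Fin 4, (seg (edge T s)).len *
      ((seg (edge T s)).mean (affine (extS vb T)) - vb (edge T s)) ^ 2
      = 2 * defect vb T ^ 2 * area T * (hx T + hy T) := by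
  obtain ⟨d0, d1, d2, d3⟩ := sub_mean_extS vb T
  have l0 : (seg (edge T 0)).len = hy T := rfl
  have l1 : (seg (edge T 1)).len = hy T := rfl
  have l2 : (seg (edge T 2)).len = hx T := rfl
  have l3 : (seg (edge T 3)).len = hx T := rfl
  rw [Fin.sum_univ_four, l0, l1, l2, l3, ← sub_eq_zero]
  simp only [← neg_sub (vb _), d0, d1, d2, d3, area]
  ring

/-- The polynomial `c` disappears because the residual is orthogonal to edge averages of linear
polynomials. This eliminates the interior unknown of the scheme. -/
theorem stab_extS (zb vb : M.Edge → ℝ) (c : Fin 3 → ℝ) (T : M.Elem) :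
    ∑ s : Fin 4, (seg (edge T s)).len *
      ((zb (edge T s) - (seg (edge T s)).mean (affine c)) *
        (vb (edge T s) - (seg (edge T s)).mean (affine (extS vb T))))
      = defect vb T * area T *
        (zb (edge T 0) + zb (edge T 1) - zb (edge T 2) - zb (edge T 3)) := by
  obtain ⟨d0, d1, d2, d3⟩ := sub_mean_extS vb T
  obtain ⟨m0, m1, m2, m3⟩ := mean_affine_edge c T
  have l0 : (seg (edge T 0)).len = hy T := rfl
  have l1 : (seg (edge T 1)).len = hy T := rfl
  have l2 : (seg (edge T 2)).len = hx T := rfl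
  have l3 : (seg (edge T 3)).len = hx T := rfl
  rw [Fin.sum_univ_four, l0, l1, l2, l3, d0, d1, d2, d3, m0, m1, m2, m3, area]
  ring

theorem affine_extS (vb : M.Edge → ℝ) (T : M.Elem) (p : ℝ × ℝ) :
    affine (extS vb T) p =
      (hy T * (vb (edge T 0) + vb (edge T 1)) + hx T * (vb (edge T 2) + vb (edge T 3)))
        / (2 * (hx T + hy T)) + weakGrad vb T 0 * (p.1 - xMid T)
        + weakGrad vb T 1 * (p.2 - yMid T) := by
  obtain ⟨s0, s1, s2⟩ := extS_apply vb T
  rw [affine, s0, s1, s2]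
  ring

/-! ### The consistency error on an element -/

theorem setIntegral_affine {T : M.Elem} {v : ℝ × ℝ → ℝ}
    (hv : MemLp v 2 (volume.restrict (interior T))) (c c₁ c₂ x₀ y₀ : ℝ) :
    ∫ p in interior T, v p * (c + c₁ * (p.1 - x₀) + c₂ * (p.2 - y₀)) =
      c * (∫ p in interior T, v p) + c₁ * (∫ p in interior T, v p * (p.1 - x₀))
        + c₂ * ∫ p in interior T, v p * (p.2 - y₀) := by
  have i0 : Integrable v (volume.restrict (interior T)) := hv.integrable (by norm_num)
  have i1 := integrable_mul_interior hv (κ := fun p => p.1 - x₀) (by fun_prop)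
  have i2 := integrable_mul_interior hv (κ := fun p => p.2 - y₀) (by fun_prop)
  rw [← integral_const_mul, ← integral_const_mul, ← integral_const_mul,
    ← integral_add (i0.const_mul c) (i1.const_mul c₁),
    ← integral_add (f := fun p => c * v p + c₁ * (v p * (p.1 - x₀)))
      ((i0.const_mul c).add (i1.const_mul c₁)) (i2.const_mul c₂)]
  congr 1; funext p; ring

theorem IsSolution.setIntegral_mul_extS (hs : IsSolution a f g u)
    (hf : MemLp f 2 (volume.restrict Omega)) (hu : MemH 3 Omega u) (vb : M.Edge → ℝ)
    (T : M.Elem) :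
    ∫ p in interior T, f p * affine (extS vb T) p =
      -((hy T * (vb (edge T 0) + vb (edge T 1)) + hx T * (vb (edge T 2) + vb (edge T 3)))
          / (2 * (hx T + hy T))
          * ((∫ p in interior T, fluxDx a u T p) + ∫ p in interior T, fluxDy a u T p)
        + weakGrad vb T 0 * ((∫ p in interior T, fluxDx a u T p * (p.1 - xMid T))
          + ∫ p in interior T, fluxDy a u T p * (p.1 - xMid T))
        + weakGrad vb T 1 * ((∫ p in interior T, fluxDx a u T p * (p.2 - yMid T))
          + ∫ p in interior T, fluxDy a u T p * (p.2 - yMid T))) := by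
  have hX := (isWeakDeriv_fluxDx hu T a).1
  have hY := (isWeakDeriv_fluxDy hu T a).1
  have e : ∫ p in interior T, f p * affine (extS vb T) p
      = -((∫ p in interior T, fluxDx a u T p * affine (extS vb T) p)
        + ∫ p in interior T, fluxDy a u T p * affine (extS vb T) p) := by
    have hc : Continuous (affine (extS vb T)) := by unfold affine; fun_prop
    rw [← integral_add (integrable_mul_interior hX hc) (integrable_mul_interior hY hc),
      ← integral_neg]
    refine integral_congr_ae ?_
    filter_upwards [hs.ae_eq hf hu T] with p hp
    rw [hp]; ring
  simp only [affine_extS] at e ⊢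
  rw [e, setIntegral_affine hX, setIntegral_affine hY]
  ring

theorem edgeFlux_eq (hu : MemH 3 Omega u) (T : M.Elem) :
    edgeFlux a u T 0 = ((∫ p in interior T, fluxDx a u T p * (p.1 - xMid T))
        + ∫ p in interior T, flux a u T 0 p) / hx T - (∫ p in interior T, fluxDx a u T p) / 2 ∧
    edgeFlux a u T 1 = ((∫ p in interior T, fluxDx a u T p * (p.1 - xMid T))
        + ∫ p in interior T, flux a u T 0 p) / hx T + (∫ p in interior T, fluxDx a u T p) / 2 ∧
    edgeFlux a u T 2 = ((∫ p in interior T, fluxDy a u T p * (p.2 - yMid T))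
        + ∫ p in interior T, flux a u T 1 p) / hy T - (∫ p in interior T, fluxDy a u T p) / 2 ∧
    edgeFlux a u T 3 = ((∫ p in interior T, fluxDy a u T p * (p.2 - yMid T))
        + ∫ p in interior T, flux a u T 1 p) / hy T + (∫ p in interior T, fluxDy a u T p) / 2 := by
  have hX := (isWeakDeriv_fluxDx hu T a).1
  have hY := (isWeakDeriv_fluxDy hu T a).1
  have hA := (hx_pos T).ne'
  have hB := (hy_pos T).ne'
  have ex : ∀ s, ∫ p in interior T, (fluxDx a u T p * (p.1 - s) + flux a u T 0 p)
      = (∫ p in interior T, fluxDx a u T p * (p.1 - xMid T)) + (xMid T - s) *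
        (∫ p in interior T, fluxDx a u T p) + ∫ p in interior T, flux a u T 0 p := by
    intro s
    have e := setIntegral_affine hX (xMid T - s) 1 0 (xMid T) 0
    rw [integral_add (integrable_mul_interior hX (by fun_prop))
      ((memLp_flux hu T a 0).integrable (by norm_num))]
    have e2 : ∀ p : ℝ × ℝ, p.1 - s = xMid T - s + 1 * (p.1 - xMid T) + 0 * (p.2 - 0) :=
      fun p => by ring
    simp only [e2]
    rw [e]; ring
  have ey : ∀ s, ∫ p in interior T, (fluxDy a u T p * (p.2 - s) + flux a u T 1 p)
      = (∫ p in interior T, fluxDy a u T p * (p.2 - yMid T)) + (yMid T - s) *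
        (∫ p in interior T, fluxDy a u T p) + ∫ p in interior T, flux a u T 1 p := by
    intro s
    have e := setIntegral_affine hY (yMid T - s) 0 1 0 (yMid T)
    rw [integral_add (integrable_mul_interior hY (by fun_prop))
      ((memLp_flux hu T a 1).integrable (by norm_num))]
    have e2 : ∀ p : ℝ × ℝ, p.2 - s = yMid T - s + 0 * (p.1 - 0) + 1 * (p.2 - yMid T) :=
      fun p => by ring
    simp only [e2]
    rw [e]; ring
  have x0 : xMid T - M.x T.1.succ = -(hx T) / 2 := by simp only [xMid, hx]; ring
  have x1 : xMid T - M.x T.1.castSucc = hx T / 2 := by simp only [xMid, hx]; ring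
  have y0 : yMid T - M.y T.2.succ = -(hy T) / 2 := by simp only [yMid, hy]; ring
  have y1 : yMid T - M.y T.2.castSucc = hy T / 2 := by simp only [yMid, hy]; ring
  refine ⟨?_, ?_, ?_, ?_⟩
  · simp only [edgeFlux, Matrix.cons_val_zero]
    rw [ex, x0]; field_simp; ring
  · simp only [edgeFlux, Matrix.cons_val_one, Matrix.cons_val_zero]
    rw [ex, x1]; field_simp; ring
  · simp only [edgeFlux, Matrix.cons_val]
    rw [ey, y0]; field_simp; ring
  · simp only [edgeFlux, Matrix.cons_val]
    rw [ey, y1]; field_simp; ring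

theorem setIntegral_linearComb {T : M.Elem} {v v' : ℝ × ℝ → ℝ}
    (hv : MemLp v 2 (volume.restrict (interior T)))
    (hv' : MemLp v' 2 (volume.restrict (interior T))) (r r' : ℝ) :
    ∫ p in interior T, (r * v p + r' * v' p) =
      r * (∫ p in interior T, v p) + r' * ∫ p in interior T, v' p := by
  have i0 : Integrable v (volume.restrict (interior T)) := hv.integrable (by norm_num)
  have i1 : Integrable v' (volume.restrict (interior T)) := hv'.integrable (by norm_num)
  rw [integral_add (i0.const_mul r) (i1.const_mul r'), integral_const_mul, integral_const_mul]

theorem IsEdgeProjection.traceMeans {Qu : M.Edge → ℝ} (hQ : IsEdgeProjection u Qu)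
    (hu : MemH 3 Omega u) (T : M.Elem) :
    (hy T * (Qu (edge T 1) - Qu (edge T 0)) = ∫ p in interior T, weakDeriv Omega 1 0 u p) ∧
    (hx T * (Qu (edge T 3) - Qu (edge T 2)) = ∫ p in interior T, weakDeriv Omega 0 1 u p) ∧
    area T * ((Qu (edge T 0) + Qu (edge T 1)) / 2 - (Qu (edge T 2) + Qu (edge T 3)) / 2) =
      (∫ p in interior T, weakDeriv Omega 1 0 u p * (p.1 - xMid T))
        - ∫ p in interior T, weakDeriv Omega 0 1 u p * (p.2 - yMid T) := by
  have hT := interior_subset_Omega T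
  have m0 : MemLp u 2 (volume.restrict (interior T)) :=
    hu.1.mono_measure (Measure.restrict_mono hT le_rfl)
  obtain ⟨v1, v2⟩ := traceMeans_vertical hT ae_eq_rfl ae_eq_rfl m0
    (memLp_weakDeriv hu T (by norm_num)) (hQ (edge T 0)) (hQ (edge T 1))
  obtain ⟨w1, w2⟩ := traceMeans_horizontal hT ae_eq_rfl ae_eq_rfl m0
    (memLp_weakDeriv hu T (by norm_num)) (hQ (edge T 2)) (hQ (edge T 3))
  exact ⟨v1, w1, by rw [mul_sub, v2, w2]; ring⟩

/-- The consistency error of the edge averages, tested with the extension of `vb`. -/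
theorem IsSolution.consistency (hs : IsSolution a f g u)
    (hf : MemLp f 2 (volume.restrict Omega)) (hu : MemH 3 Omega u) {Qu : M.Edge → ℝ}
    (hQ : IsEdgeProjection u Qu) (vb : M.Edge → ℝ) (T : M.Elem) :
    area T * ((a T).mulVec (weakGrad Qu T) ⬝ᵥ weakGrad vb T)
        - (∫ p in interior T, f p * affine (extS vb T) p)
        - (edgeFlux a u T 1 * vb (edge T 1) - edgeFlux a u T 0 * vb (edge T 0)
          + (edgeFlux a u T 3 * vb (edge T 3) - edgeFlux a u T 2 * vb (edge T 2)))
      = weakGrad vb T 0 * (∫ p in interior T, fluxDy a u T p * (p.1 - xMid T))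
        + weakGrad vb T 1 * (∫ p in interior T, fluxDx a u T p * (p.2 - yMid T))
        - defect vb T * (hx T * (∫ p in interior T, fluxDx a u T p)
          - hy T * ∫ p in interior T, fluxDy a u T p) := by
  obtain ⟨q1, q2, -⟩ := hQ.traceMeans hu T
  obtain ⟨f0, f1, f2, f3⟩ := edgeFlux_eq (a := a) hu T
  obtain ⟨g0, g1⟩ := weakGrad_apply vb T
  obtain ⟨k0, k1⟩ := weakGrad_apply Qu T
  have hA := (hx_pos T).ne'
  have hB := (hy_pos T).ne'
  have hAB := (add_pos (hx_pos T) (hy_pos T)).ne'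
  have m10 := memLp_weakDeriv hu T (α := 1) (β := 0) (by norm_num)
  have m01 := memLp_weakDeriv hu T (α := 0) (β := 1) (by norm_num)
  -- The discrete gradient of the edge averages is the exact mean of `∇u`, and `a` is constant on
  -- `T`; hence the discrete flux is the exact mean of `q`.
  have j0 : ∫ p in interior T, flux a u T 0 p = a T 0 0 * (hy T * (Qu (edge T 1) - Qu (edge T 0)))
      + a T 0 1 * (hx T * (Qu (edge T 3) - Qu (edge T 2))) := by
    rw [q1, q2]; exact setIntegral_linearComb m10 m01 _ _
  have j1 : ∫ p in interior T, flux a u T 1 p = a T 1 0 * (hy T * (Qu (edge T 1) - Qu (edge T 0)))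
      + a T 1 1 * (hx T * (Qu (edge T 3) - Qu (edge T 2))) := by
    rw [q1, q2]; exact setIntegral_linearComb m10 m01 _ _
  rw [hs.setIntegral_mul_extS hf hu vb T, f0, f1, f2, f3, j0, j1]
  simp only [dotProduct, Matrix.mulVec, Fin.sum_univ_two]
  rw [k0, k1, g0, g1, area, defect]
  field_simp
  ring

/-! ### Elementary inequalities -/

theorem mul_le_young {x y α : ℝ} (hα : 0 < α) : x * y ≤ α * x ^ 2 + y ^ 2 / (4 * α) := by
  have h : 0 ≤ (2 * α * x - y) ^ 2 / (4 * α) := by positivity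
  have e : (2 * α * x - y) ^ 2 / (4 * α) = α * x ^ 2 + y ^ 2 / (4 * α) - x * y := by
    field_simp; ring
  linarith

theorem sub_sq_le (x y : ℝ) : (x - y) ^ 2 ≤ 2 * x ^ 2 + 2 * y ^ 2 := by
  linarith [sq_nonneg (x + y)]

/-- The part of the consistency error that is bounded by the stabilizer. -/
theorem defect_term_le {A B h ρ N L x₁ y₁ x₂ y₂ x₃ y₃ θ : ℝ} (hA : 0 < A) (hB : 0 < B)
    (hAh : A ≤ h) (hBh : B ≤ h) (hρ : 0 < ρ) (hN : 0 ≤ N)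
    (b₁ : x₁ ^ 2 ≤ A ^ 6 / 4 * (A * B) * N) (c₁ : y₁ ^ 2 ≤ B ^ 6 / 4 * (A * B) * N)
    (b₂ : x₂ ^ 2 ≤ A ^ 2 * (A * B) * N) (c₂ : y₂ ^ 2 ≤ B ^ 2 * (A * B) * N)
    (b₃ : x₃ ^ 2 ≤ A ^ 2 * (A * B) * (2 * L ^ 2 * N))
    (c₃ : y₃ ^ 2 ≤ B ^ 2 * (A * B) * (2 * L ^ 2 * N)) :
    θ * (2 * (ρ / h) * (x₁ - y₁) + ρ / h * (B ^ 2 / 6 * x₂ - A ^ 2 / 6 * y₂) - B * x₃ + A * y₃)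
      ≤ ρ / h * (θ ^ 2 * (A * B) * (A + B)) + 2 * (85 * ρ ^ 2 + 20 * L ^ 2) / ρ * h ^ 4 * N := by
  -- In the application `A`, `B` are the side lengths and `N` is the squared norm of the third
  -- derivatives. The pair `x₁`, `y₁` stands for the moments of `u_x`, `u_y` without their leading
  -- parts; the other pairs are the moments of third derivatives of `u` and of `∂_x ∂_y q` that the
  -- correction brings in.
  have hh : 0 < h := hA.trans_le hAh
  set l := A + B with hl
  have hl0 : 0 < l := add_pos hA hB
  have hlh : l ≤ 2 * h := by linarith
  have hAl : A ≤ l := by linarith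
  have hBl : B ≤ l := by linarith
  set P := A * B with hP
  have hP0 : 0 < P := mul_pos hA hB
  have hPN : 0 ≤ P * N := mul_nonneg hP0.le hN
  set E := 2 * (ρ / h) * (x₁ - y₁) + ρ / h * (B ^ 2 / 6 * x₂ - A ^ 2 / 6 * y₂) - B * x₃ + A * y₃
    with hE
  have d₁ : (x₁ - y₁) ^ 2 ≤ l ^ 6 * (P * N) := by
    have h1 : A ^ 6 * (P * N) ≤ l ^ 6 * (P * N) := by gcongr
    have h2 : B ^ 6 * (P * N) ≤ l ^ 6 * (P * N) := by gcongr
    linarith [sub_sq_le x₁ y₁]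
  have d₂ : (B ^ 2 / 6 * x₂ - A ^ 2 / 6 * y₂) ^ 2 ≤ l ^ 6 * (P * N) := by
    have h1 : B ^ 4 * A ^ 2 * (P * N) ≤ l ^ 4 * l ^ 2 * (P * N) := by gcongr
    have h2 : A ^ 4 * B ^ 2 * (P * N) ≤ l ^ 4 * l ^ 2 * (P * N) := by gcongr
    have h3 : B ^ 4 * x₂ ^ 2 ≤ B ^ 4 * (A ^ 2 * P * N) := by gcongr
    have h4 : A ^ 4 * y₂ ^ 2 ≤ A ^ 4 * (B ^ 2 * P * N) := by gcongr
    have h5 : 0 ≤ l ^ 6 * (P * N) := by positivity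
    linarith [sub_sq_le (B ^ 2 / 6 * x₂) (A ^ 2 / 6 * y₂)]
  have d₃ : (B * x₃) ^ 2 ≤ 2 * L ^ 2 * l ^ 4 * (P * N) := by
    have h1 : B ^ 2 * x₃ ^ 2 ≤ B ^ 2 * (A ^ 2 * P * (2 * L ^ 2 * N)) := by gcongr
    have h2 : B ^ 2 * A ^ 2 * (2 * L ^ 2 * (P * N)) ≤ l ^ 2 * l ^ 2 * (2 * L ^ 2 * (P * N)) := by
      gcongr
    linarith
  have d₄ : (A * y₃) ^ 2 ≤ 2 * L ^ 2 * l ^ 4 * (P * N) := by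
    have h1 : A ^ 2 * y₃ ^ 2 ≤ A ^ 2 * (B ^ 2 * P * (2 * L ^ 2 * N)) := by gcongr
    have h2 : A ^ 2 * B ^ 2 * (2 * L ^ 2 * (P * N)) ≤ l ^ 2 * l ^ 2 * (2 * L ^ 2 * (P * N)) := by
      gcongr
    linarith
  have hr : (ρ / h) ^ 2 * l ^ 6 ≤ 4 * ρ ^ 2 * l ^ 4 := by
    have h1 : l ^ 2 ≤ (2 * h) ^ 2 := by gcongr
    have e : (ρ / h) ^ 2 * l ^ 6 = ρ ^ 2 * l ^ 4 / h ^ 2 * l ^ 2 := by ring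
    rw [e]
    calc ρ ^ 2 * l ^ 4 / h ^ 2 * l ^ 2 ≤ ρ ^ 2 * l ^ 4 / h ^ 2 * (2 * h) ^ 2 := by gcongr
      _ = 4 * ρ ^ 2 * l ^ 4 := by field_simp; ring
  -- The four terms contribute `4 (16 + 4) ρ²` and `4 (2 + 2) L²`; the stated constants leave some
  -- room.
  have hE2 : E ^ 2 ≤ (85 * ρ ^ 2 + 20 * L ^ 2) * l ^ 4 * (P * N) := by
    have s : ∀ p q r s : ℝ, (p + q - r + s) ^ 2 ≤ 4 * (p ^ 2 + q ^ 2 + r ^ 2 + s ^ 2) := by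
      intro p q r s
      linarith [sq_nonneg (p - q), sq_nonneg (p + r), sq_nonneg (p - s), sq_nonneg (q + r),
        sq_nonneg (q - s), sq_nonneg (r + s)]
    have s1 := s (2 * (ρ / h) * (x₁ - y₁)) (ρ / h * (B ^ 2 / 6 * x₂ - A ^ 2 / 6 * y₂))
      (B * x₃) (A * y₃)
    have t1 : (2 * (ρ / h) * (x₁ - y₁)) ^ 2 ≤ 16 * ρ ^ 2 * l ^ 4 * (P * N) := by
      calc (2 * (ρ / h) * (x₁ - y₁)) ^ 2 = 4 * (ρ / h) ^ 2 * (x₁ - y₁) ^ 2 := by ring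
        _ ≤ 4 * (ρ / h) ^ 2 * (l ^ 6 * (P * N)) := by gcongr
        _ = 4 * ((ρ / h) ^ 2 * l ^ 6) * (P * N) := by ring
        _ ≤ 4 * (4 * ρ ^ 2 * l ^ 4) * (P * N) := by gcongr
        _ = 16 * ρ ^ 2 * l ^ 4 * (P * N) := by ring
    have t2 : (ρ / h * (B ^ 2 / 6 * x₂ - A ^ 2 / 6 * y₂)) ^ 2 ≤ 4 * ρ ^ 2 * l ^ 4 * (P * N) := by
      calc (ρ / h * (B ^ 2 / 6 * x₂ - A ^ 2 / 6 * y₂)) ^ 2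
          = (ρ / h) ^ 2 * (B ^ 2 / 6 * x₂ - A ^ 2 / 6 * y₂) ^ 2 := by ring
        _ ≤ (ρ / h) ^ 2 * (l ^ 6 * (P * N)) := by gcongr
        _ = ((ρ / h) ^ 2 * l ^ 6) * (P * N) := by ring
        _ ≤ (4 * ρ ^ 2 * l ^ 4) * (P * N) := by gcongr
    have n1 : 0 ≤ ρ ^ 2 * l ^ 4 * (P * N) := by positivity
    have n2 : 0 ≤ L ^ 2 * l ^ 4 * (P * N) := by positivity
    rw [hE]
    linarith
  -- This weight is half of the stabilizer `2 (ρ / h) θ² P l` on the element. The area `P` then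
  -- cancels against the one in the bound for `E²`, and `l³ ≤ 8 h³` suffices without any condition
  -- on the shape of the rectangle.
  have hα : 0 < ρ / h * P * l := by positivity
  have y := mul_le_young (x := θ) (y := E) hα
  have y2 : E ^ 2 / (4 * (ρ / h * P * l)) ≤ 2 * (85 * ρ ^ 2 + 20 * L ^ 2) / ρ * h ^ 4 * N := by
    have h3 : l ^ 3 ≤ (2 * h) ^ 3 := by gcongr
    calc E ^ 2 / (4 * (ρ / h * P * l))
        ≤ (85 * ρ ^ 2 + 20 * L ^ 2) * l ^ 4 * (P * N) / (4 * (ρ / h * P * l)) := by gcongr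
      _ = (85 * ρ ^ 2 + 20 * L ^ 2) / (4 * ρ) * h * N * l ^ 3 := by field_simp
      _ ≤ (85 * ρ ^ 2 + 20 * L ^ 2) / (4 * ρ) * h * N * (2 * h) ^ 3 := by gcongr
      _ = 2 * (85 * ρ ^ 2 + 20 * L ^ 2) / ρ * h ^ 4 * N := by field_simp; ring
  calc θ * E ≤ ρ / h * P * l * θ ^ 2 + E ^ 2 / (4 * (ρ / h * P * l)) := y
    _ ≤ ρ / h * (θ ^ 2 * P * l) + 2 * (85 * ρ ^ 2 + 20 * L ^ 2) / ρ * h ^ 4 * N := by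
      rw [show ρ / h * P * l * θ ^ 2 = ρ / h * (θ ^ 2 * P * l) by ring]
      linarith

/-- The size of the discrete gradient of the correction. -/
theorem sq_correction_le {B h ρ P N L x y W : ℝ} (hB : 0 < B) (hBh : B ≤ h) (hρ : 0 < ρ)
    (hPN : 0 ≤ P * N) (hx : x ^ 2 ≤ P * N) (hy : y ^ 2 ≤ P * (2 * L ^ 2 * N))
    (hW : W = 1 / 12 * B * ρ⁻¹ * h⁻¹ * (ρ * h⁻¹ * B * x - 6 * y)) :
    W ^ 2 ≤ (1 + L ^ 2 / ρ ^ 2) * (P * N) := by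
  have hh : 0 < h := hB.trans_le hBh
  -- After expansion the edge length and `h` enter only through this ratio, which is at most one.
  set β := B / h with hβ
  have hβ0 : 0 ≤ β := by positivity
  have hβ1 : β ≤ 1 := (div_le_one hh).2 hBh
  have e : W = β ^ 2 * (x / 12) - β * (y / (2 * ρ)) := by
    rw [hW, hβ]; field_simp; ring
  have b2 : β ^ 2 ≤ 1 := pow_le_one₀ hβ0 hβ1
  have b4 : β ^ 4 ≤ 1 := pow_le_one₀ hβ0 hβ1
  have s1 : W ^ 2 ≤ 2 * (β ^ 4 * (x ^ 2 / 144)) + 2 * (β ^ 2 * (y ^ 2 / (4 * ρ ^ 2))) := by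
    rw [e]
    have e2 : y ^ 2 / (4 * ρ ^ 2) = (y / (2 * ρ)) ^ 2 := by field_simp; ring
    rw [e2]
    linarith [sub_sq_le (β ^ 2 * (x / 12)) (β * (y / (2 * ρ)))]
  have s2 : β ^ 4 * (x ^ 2 / 144) ≤ 1 * (P * N / 144) := by gcongr
  have s3 : β ^ 2 * (y ^ 2 / (4 * ρ ^ 2)) ≤ 1 * (P * (2 * L ^ 2 * N) / (4 * ρ ^ 2)) := by gcongr
  have e3 : 1 * (P * (2 * L ^ 2 * N) / (4 * ρ ^ 2)) = L ^ 2 / ρ ^ 2 * (P * N) / 2 := by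
    field_simp; ring
  rw [e3] at s3
  linarith

/-- The part of the consistency error that is bounded by the discrete gradient. -/
theorem gradient_term_le {h P N L K lam x y W₁ W₂ G₁ G₂ a₁₁ a₁₂ a₂₁ a₂₂ : ℝ} (hP : 0 < P)
    (hlam : 0 < lam) (bx : x ^ 2 ≤ h ^ 4 * P * (2 * L ^ 2 * N))
    (hby : y ^ 2 ≤ h ^ 4 * P * (2 * L ^ 2 * N)) (b₁ : W₁ ^ 2 ≤ K * (P * N))
    (b₂ : W₂ ^ 2 ≤ K * (P * N)) (h₁₁ : a₁₁ ^ 2 ≤ L ^ 2) (h₁₂ : a₁₂ ^ 2 ≤ L ^ 2)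
    (h₂₁ : a₂₁ ^ 2 ≤ L ^ 2) (h₂₂ : a₂₂ ^ 2 ≤ L ^ 2) :
    G₁ * x + G₂ * y + h ^ 2 * ((a₁₁ * W₁ + a₁₂ * W₂) * G₁ + (a₂₁ * W₁ + a₂₂ * W₂) * G₂)
      ≤ lam / 2 * (P * (G₁ ^ 2 + G₂ ^ 2)) + 6 * L ^ 2 * (1 + K) / lam * h ^ 4 * N := by
  have key : ∀ z α β : ℝ, z ^ 2 ≤ h ^ 4 * P * (2 * L ^ 2 * N) → α ^ 2 ≤ L ^ 2 → β ^ 2 ≤ L ^ 2 →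
      (z + h ^ 2 * (α * W₁ + β * W₂)) ^ 2 ≤ 6 * L ^ 2 * (1 + K) * h ^ 4 * (P * N) := by
    intro z α β hz hα hβ
    have s : (z + h ^ 2 * (α * W₁ + β * W₂)) ^ 2
        ≤ 3 * z ^ 2 + 3 * (h ^ 4 * (α ^ 2 * W₁ ^ 2)) + 3 * (h ^ 4 * (β ^ 2 * W₂ ^ 2)) := by
      linarith [sq_nonneg (z - h ^ 2 * (α * W₁)), sq_nonneg (z - h ^ 2 * (β * W₂)),
        sq_nonneg (h ^ 2 * (α * W₁) - h ^ 2 * (β * W₂))]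
    have s1 : h ^ 4 * (α ^ 2 * W₁ ^ 2) ≤ h ^ 4 * (L ^ 2 * (K * (P * N))) := by gcongr
    have s2 : h ^ 4 * (β ^ 2 * W₂ ^ 2) ≤ h ^ 4 * (L ^ 2 * (K * (P * N))) := by gcongr
    linarith
  -- With this weight the two squares use up half of the coercivity bound `lam * P * (G₁² + G₂²)`.
  have hα : 0 < lam / 2 * P := by positivity
  have y₁ := mul_le_young (x := G₁) (y := x + h ^ 2 * (a₁₁ * W₁ + a₁₂ * W₂)) hα
  have y₂ := mul_le_young (x := G₂) (y := y + h ^ 2 * (a₂₁ * W₁ + a₂₂ * W₂)) hα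
  have fin : ∀ z : ℝ, z ^ 2 ≤ 6 * L ^ 2 * (1 + K) * h ^ 4 * (P * N) →
      z ^ 2 / (4 * (lam / 2 * P)) ≤ 3 * L ^ 2 * (1 + K) / lam * h ^ 4 * N := by
    intro z hz
    calc z ^ 2 / (4 * (lam / 2 * P))
        ≤ 6 * L ^ 2 * (1 + K) * h ^ 4 * (P * N) / (4 * (lam / 2 * P)) := by gcongr
      _ = 3 * L ^ 2 * (1 + K) / lam * h ^ 4 * N := by field_simp; ring
  have z₁ := fin _ (key x a₁₁ a₁₂ bx h₁₁ h₁₂)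
  have z₂ := fin _ (key y a₂₁ a₂₂ hby h₂₁ h₂₂)
  have e : 6 * L ^ 2 * (1 + K) / lam * h ^ 4 * N
      = 3 * L ^ 2 * (1 + K) / lam * h ^ 4 * N + 3 * L ^ 2 * (1 + K) / lam * h ^ 4 * N := by ring
  rw [e]
  linarith

/-- The unit vectors give the diagonal entries; by symmetry, the values of the quadratic form at
`(1, 1)` and `(1, -1)` differ by four times the off-diagonal entry. -/
theorem IsCoeff.sq_entry_le {lam Lam : ℝ} (ha : IsCoeff lam Lam a) (hlam : 0 < lam) (T : M.Elem)
    (i j : Fin 2) : a T i j ^ 2 ≤ Lam ^ 2 := by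
  obtain ⟨hsym, hq⟩ := ha T
  have h01 : a T 1 0 = a T 0 1 := congrFun (congrFun hsym 0) 1
  have q0 := hq ![1, 0]
  have q1 := hq ![0, 1]
  have q2 := hq ![1, 1]
  have q3 := hq ![1, -1]
  simp [dotProduct, Matrix.mulVec, Fin.sum_univ_two] at q0 q1 q2 q3
  rw [h01] at q2 q3
  refine sq_le_sq' ?_ ?_ <;> fin_cases i <;> fin_cases j <;> simp <;> linarith

/-! ### Third derivatives -/

/-- The square of the `L²` norm of the third derivatives on `T`. -/
def thirdSq (u : ℝ × ℝ → ℝ) (T : M.Elem) : ℝ :=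
  (∫ p in interior T, weakDeriv Omega 3 0 u p ^ 2)
    + (∫ p in interior T, weakDeriv Omega 2 1 u p ^ 2)
    + (∫ p in interior T, weakDeriv Omega 1 2 u p ^ 2)
    + ∫ p in interior T, weakDeriv Omega 0 3 u p ^ 2

theorem setIntegral_sq_nonneg (S : Set (ℝ × ℝ)) (v : ℝ × ℝ → ℝ) : 0 ≤ ∫ p in S, v p ^ 2 :=
  integral_nonneg fun _ => sq_nonneg _

theorem setIntegral_sq_le_thirdSq (u : ℝ × ℝ → ℝ) (T : M.Elem) :
    (∫ p in interior T, weakDeriv Omega 3 0 u p ^ 2) ≤ thirdSq u T ∧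
    (∫ p in interior T, weakDeriv Omega 2 1 u p ^ 2) ≤ thirdSq u T ∧
    (∫ p in interior T, weakDeriv Omega 1 2 u p ^ 2) ≤ thirdSq u T ∧
    (∫ p in interior T, weakDeriv Omega 0 3 u p ^ 2) ≤ thirdSq u T := by
  have h1 := setIntegral_sq_nonneg (interior T) (weakDeriv Omega 3 0 u)
  have h2 := setIntegral_sq_nonneg (interior T) (weakDeriv Omega 2 1 u)
  have h3 := setIntegral_sq_nonneg (interior T) (weakDeriv Omega 1 2 u)
  have h4 := setIntegral_sq_nonneg (interior T) (weakDeriv Omega 0 3 u)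
  refine ⟨?_, ?_, ?_, ?_⟩ <;> simp only [thirdSq] <;> linarith

theorem thirdSq_nonneg (u : ℝ × ℝ → ℝ) (T : M.Elem) : 0 ≤ thirdSq u T :=
  (setIntegral_sq_nonneg _ _).trans (setIntegral_sq_le_thirdSq u T).1

theorem sum_thirdSq_le (hu : MemH 3 Omega u) :
    ∑ T : M.Elem, thirdSq u T ≤ sobolevNorm 3 Omega u ^ 2 := by
  have key : ∀ α β : ℕ, α + β ≤ 3 →
      ∑ T : M.Elem, ∫ p in interior T, weakDeriv Omega α β u p ^ 2
        ≤ ∫ p in Omega, weakDeriv Omega α β u p ^ 2 := fun α β h =>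
    sum_setIntegral_interior_le (fun p => sq_nonneg _) (hu.isWeakDeriv h).1.integrable_sq
  have n := fun α β : ℕ => setIntegral_sq_nonneg Omega (weakDeriv Omega α β u)
  simp only [thirdSq, Finset.sum_add_distrib]
  rw [sobolevNorm, Real.sq_sqrt (Finset.sum_nonneg fun α _ => Finset.sum_nonneg fun β _ => n α β)]
  simp only [Finset.sum_range_succ, Finset.sum_range_zero, zero_add, Nat.reduceSub, Nat.reduceAdd]
  linarith [key 3 0 (by norm_num), key 2 1 (by norm_num), key 1 2 (by norm_num),
    key 0 3 (by norm_num), n 0 0, n 0 1, n 0 2, n 1 0, n 1 1, n 2 0]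

theorem setIntegral_fluxDxy_sq_le (hu : MemH 3 Omega u) (T : M.Elem) {L : ℝ} (k : Fin 2)
    (ha : ∀ j, a T k j ^ 2 ≤ L ^ 2) :
    ∫ p in interior T, fluxDxy a u T k p ^ 2 ≤ 2 * L ^ 2 * thirdSq u T := by
  have m21 := memLp_weakDeriv hu T (α := 2) (β := 1) (by norm_num)
  have m12 := memLp_weakDeriv hu T (α := 1) (β := 2) (by norm_num)
  have m : MemLp (fluxDxy a u T k) 2 (volume.restrict (interior T)) :=
    (m21.const_mul _).add (m12.const_mul _)
  have h1 : ∫ p in interior T, fluxDxy a u T k p ^ 2 ≤ ∫ p in interior T,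
      (2 * L ^ 2 * weakDeriv Omega 2 1 u p ^ 2 + 2 * L ^ 2 * weakDeriv Omega 1 2 u p ^ 2) := by
    refine integral_mono m.integrable_sq
      ((m21.integrable_sq.const_mul _).add (m12.integrable_sq.const_mul _)) fun p => ?_
    have b0 := mul_le_mul_of_nonneg_right (ha 0) (sq_nonneg (weakDeriv Omega 2 1 u p))
    have b1 := mul_le_mul_of_nonneg_right (ha 1) (sq_nonneg (weakDeriv Omega 1 2 u p))
    simp only [fluxDxy]
    linarith [sq_nonneg (a T k 0 * weakDeriv Omega 2 1 u p - a T k 1 * weakDeriv Omega 1 2 u p)]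
  rw [integral_add (m21.integrable_sq.const_mul _) (m12.integrable_sq.const_mul _),
    integral_const_mul, integral_const_mul, ← mul_add] at h1
  refine h1.trans (mul_le_mul_of_nonneg_left ?_ (by positivity))
  have h2 := setIntegral_sq_nonneg (interior T) (weakDeriv Omega 3 0 u)
  have h3 := setIntegral_sq_nonneg (interior T) (weakDeriv Omega 0 3 u)
  simp only [thirdSq]
  linarith

/-! ### The correction on an element -/

/-- The difference across the element costs one more derivative, so the discrete gradient of `w` is
controlled by third derivatives. The sum retains the second derivatives that cancel the leading
terms of the consistency error. -/
theorem IsCorrection.vertical {ρ : ℝ} {w : M.Edge → ℝ} (hw : IsCorrection ρ a u w)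
    (hu : MemH 3 Omega u) (T : M.Elem) :
    hy T * (w (edge T 1) - w (edge T 0)) = 1 / 12 * hy T * ρ⁻¹ * M.h⁻¹ *
        (ρ * M.h⁻¹ * hy T * (∫ p in interior T, weakDeriv Omega 1 2 u p)
          - 6 * ∫ p in interior T, fluxDxy a u T 1 p) ∧
    area T * (w (edge T 0) + w (edge T 1)) = 1 / 6 * hy T * ρ⁻¹ * M.h⁻¹ *
        (ρ * M.h⁻¹ * hy T * ((∫ p in interior T, weakDeriv Omega 1 2 u p * (p.1 - xMid T))
            + ∫ p in interior T, weakDeriv Omega 0 2 u p)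
          - 6 * ((∫ p in interior T, fluxDxy a u T 1 p * (p.1 - xMid T))
            + ∫ p in interior T, fluxDy a u T p)) := by
  obtain ⟨r, t, hr, ht, e⟩ := (hw T).1 0 (Or.inl rfl)
  obtain ⟨r', t', hr', ht', e'⟩ := (hw T).1 1 (Or.inr rfl)
  have l0 : (seg (edge T 0)).len = hy T := rfl
  have l1 : (seg (edge T 1)).len = hy T := rfl
  have hO := isOpen_interior T
  have d := isWeakDeriv_succ_left hu T (α := 0) (β := 2) (by norm_num)
  have q := isWeakDeriv_fluxDy hu T a
  -- The derivative in the definition of `w` is a chosen representative on the element; it agrees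
  -- almost everywhere with the explicit `fluxDy`.
  have qq := q.weakDeriv.ae_eq hO q
  have q' := isWeakDeriv_fluxDxy_one hu T a
  obtain ⟨x1, x2⟩ := traceMeans_vertical subset_rfl (d.weakDeriv.ae_eq hO d) ae_eq_rfl
    (memLp_weakDeriv hu T (by norm_num)) d.1 hr hr'
  obtain ⟨y1, y2⟩ := traceMeans_vertical subset_rfl
    ((q'.congr qq.symm).weakDeriv.ae_eq hO (q'.congr qq.symm)) qq q.1 q'.1 ht ht'
  rw [e, e', l0, l1]
  constructor
  · rw [← x1, ← y1]; ring
  · rw [← x2, ← y2]; ring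

theorem IsCorrection.horizontal {ρ : ℝ} {w : M.Edge → ℝ} (hw : IsCorrection ρ a u w)
    (hu : MemH 3 Omega u) (T : M.Elem) :
    hx T * (w (edge T 3) - w (edge T 2)) = 1 / 12 * hx T * ρ⁻¹ * M.h⁻¹ *
        (ρ * M.h⁻¹ * hx T * (∫ p in interior T, weakDeriv Omega 2 1 u p)
          - 6 * ∫ p in interior T, fluxDxy a u T 0 p) ∧
    area T * (w (edge T 2) + w (edge T 3)) = 1 / 6 * hx T * ρ⁻¹ * M.h⁻¹ *
        (ρ * M.h⁻¹ * hx T * ((∫ p in interior T, weakDeriv Omega 2 1 u p * (p.2 - yMid T))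
            + ∫ p in interior T, weakDeriv Omega 2 0 u p)
          - 6 * ((∫ p in interior T, fluxDxy a u T 0 p * (p.2 - yMid T))
            + ∫ p in interior T, fluxDx a u T p)) := by
  obtain ⟨r, t, hr, ht, e⟩ := (hw T).2 2 (Or.inl rfl)
  obtain ⟨r', t', hr', ht', e'⟩ := (hw T).2 3 (Or.inr rfl)
  have l2 : (seg (edge T 2)).len = hx T := rfl
  have l3 : (seg (edge T 3)).len = hx T := rfl
  have hO := isOpen_interior T
  have d := isWeakDeriv_succ_right hu T (α := 2) (β := 0) (by norm_num)
  have q := isWeakDeriv_fluxDx hu T a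
  have qq := q.weakDeriv.ae_eq hO q
  have q' := isWeakDeriv_fluxDxy_zero hu T a
  obtain ⟨x1, x2⟩ := traceMeans_horizontal subset_rfl (d.weakDeriv.ae_eq hO d) ae_eq_rfl
    (memLp_weakDeriv hu T (by norm_num)) d.1 hr hr'
  obtain ⟨y1, y2⟩ := traceMeans_horizontal subset_rfl
    ((q'.congr qq.symm).weakDeriv.ae_eq hO (q'.congr qq.symm)) qq q.1 q'.1 ht ht'
  rw [e, e', l2, l3]
  constructor
  · rw [← x1, ← y1]; ring
  · rw [← x2, ← y2]; ring

/-! ### The estimate -/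

theorem sq_setIntegral_le {T : M.Elem} {v : ℝ × ℝ → ℝ}
    (hv : MemLp v 2 (volume.restrict (interior T))) :
    (∫ p in interior T, v p) ^ 2 ≤ area T * ∫ p in interior T, v p ^ 2 := by
  have := sq_integral_mul_le (κ := fun _ => 1) (K := 1) (x_lt T) (y_lt T) hv continuous_const
    fun p _ => by simp
  simp only [mul_one, one_pow, one_mul] at this
  exact this

/-- The constant in the estimate of the squared error. -/
def errorConst (ρ lam Lam : ℝ) : ℝ :=
  6 * Lam ^ 2 * (1 + (1 + Lam ^ 2 / ρ ^ 2)) / lam + 2 * (85 * ρ ^ 2 + 20 * Lam ^ 2) / ρ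

/-- In the application `zb` and `c` are the edge values and the interior polynomial of the discrete
solution. Summed over the elements, the left side is the full energy of `eb`: the scheme disposes of
the load and of the stabilizer of the discrete solution, and the edge fluxes add up to zero. -/
theorem element_estimate {ρ lam Lam : ℝ} (hρ : 0 < ρ) (hlam : 0 < lam) (ha : IsCoeff lam Lam a)
    (hf : MemLp f 2 (volume.restrict Omega)) (hu : MemH 3 Omega u) (hs : IsSolution a f g u)
    {w : M.Edge → ℝ} (hw : IsCorrection ρ a u w) {Qu : M.Edge → ℝ} (hQ : IsEdgeProjection u Qu)
    {eb zb : M.Edge → ℝ} (hez : ∀ e, eb e + zb e = Qu e + M.h ^ 2 * w e) (c : Fin 3 → ℝ)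
    (T : M.Elem) :
    area T * ((a T).mulVec (weakGrad Qu T) ⬝ᵥ weakGrad eb T)
        + M.h ^ 2 * (area T * ((a T).mulVec (weakGrad w T) ⬝ᵥ weakGrad eb T))
        + ρ * M.h⁻¹ * (∑ s : Fin 4, (seg (edge T s)).len *
          ((seg (edge T s)).mean (affine (extS eb T)) - eb (edge T s)) ^ 2)
        + ρ * M.h⁻¹ * (∑ s : Fin 4, (seg (edge T s)).len *
          ((zb (edge T s) - (seg (edge T s)).mean (affine c)) *
            (eb (edge T s) - (seg (edge T s)).mean (affine (extS eb T)))))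
        - (∫ p in interior T, f p * affine (extS eb T) p)
        - (edgeFlux a u T 1 * eb (edge T 1) - edgeFlux a u T 0 * eb (edge T 0)
          + (edgeFlux a u T 3 * eb (edge T 3) - edgeFlux a u T 2 * eb (edge T 2)))
      ≤ lam / 2 * (area T * (weakGrad eb T ⬝ᵥ weakGrad eb T))
        + 1 / 2 * (ρ * M.h⁻¹ * (∑ s : Fin 4, (seg (edge T s)).len *
          ((seg (edge T s)).mean (affine (extS eb T)) - eb (edge T s)) ^ 2))
        + errorConst ρ lam Lam * M.h ^ 4 * thirdSq u T := by
  have hcons := hs.consistency hf hu hQ eb T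
  have hcorrV := hw.vertical hu T
  have hcorrH := hw.horizontal hu T
  obtain ⟨-, -, hQ3⟩ := hQ.traceMeans hu T
  obtain ⟨n30, n21, n12, n03⟩ := setIntegral_sq_le_thirdSq u T
  have hN := thirdSq_nonneg u T
  have hA := hx_pos T
  have hB := hy_pos T
  have hP := area_pos T
  have hh := h_pos M
  have hAh := hx_le_h T
  have hBh := hy_le_h T
  have hx4 : hx T ^ 4 ≤ M.h ^ 4 := by gcongr
  have hy4 : hy T ^ 4 ≤ M.h ^ 4 := by gcongr
  have q0 := setIntegral_fluxDxy_sq_le hu T 0 fun j => ha.sq_entry_le hlam T 0 j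
  have q1 := setIntegral_fluxDxy_sq_le hu T 1 fun j => ha.sq_entry_le hlam T 1 j
  have m10 := memLp_weakDeriv hu T (α := 1) (β := 0) (by norm_num)
  have m01 := memLp_weakDeriv hu T (α := 0) (β := 1) (by norm_num)
  have m21 := memLp_weakDeriv hu T (α := 2) (β := 1) (by norm_num)
  have m12 := memLp_weakDeriv hu T (α := 1) (β := 2) (by norm_num)
  have dx0 := isWeakDeriv_fluxDx hu T a
  have dy1 := isWeakDeriv_fluxDy hu T a
  have dxy0 := isWeakDeriv_fluxDxy_zero hu T a
  have dxy1 := isWeakDeriv_fluxDxy_one hu T a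
  have bx : (∫ p in interior T, fluxDy a u T p * (p.1 - xMid T)) ^ 2
      ≤ M.h ^ 4 * area T * (2 * Lam ^ 2 * thirdSq u T) :=
    (IsWeakDeriv.sq_moment_fst_le (x_lt T) (y_lt T) dxy1 dy1.1).trans
      (mul_le_mul (mul_le_mul_of_nonneg_right hx4 hP.le) q1 (setIntegral_sq_nonneg _ _)
        (by positivity))
  have hby : (∫ p in interior T, fluxDx a u T p * (p.2 - yMid T)) ^ 2
      ≤ M.h ^ 4 * area T * (2 * Lam ^ 2 * thirdSq u T) :=
    (IsWeakDeriv.sq_moment_snd_le (x_lt T) (y_lt T) dxy0 dx0.1).trans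
      (mul_le_mul (mul_le_mul_of_nonneg_right hy4 hP.le) q0 (setIntegral_sq_nonneg _ _)
        (by positivity))
  have b₁ : ((∫ p in interior T, weakDeriv Omega 1 0 u p * (p.1 - xMid T))
      - hx T ^ 2 / 12 * ∫ p in interior T, weakDeriv Omega 2 0 u p) ^ 2
      ≤ hx T ^ 6 / 4 * (hx T * hy T) * thirdSq u T :=
    (sq_moment_fst_sub_le (x_lt T) (y_lt T) (isWeakDeriv_succ_left hu T (by norm_num))
      (isWeakDeriv_succ_left hu T (by norm_num)) m10).trans
      (mul_le_mul_of_nonneg_left n30 (by positivity))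
  have c₁ : ((∫ p in interior T, weakDeriv Omega 0 1 u p * (p.2 - yMid T))
      - hy T ^ 2 / 12 * ∫ p in interior T, weakDeriv Omega 0 2 u p) ^ 2
      ≤ hy T ^ 6 / 4 * (hx T * hy T) * thirdSq u T :=
    (sq_moment_snd_sub_le (x_lt T) (y_lt T) (isWeakDeriv_succ_right hu T (by norm_num))
      (isWeakDeriv_succ_right hu T (by norm_num)) m01).trans
      (mul_le_mul_of_nonneg_left n03 (by positivity))
  have b₂ : (∫ p in interior T, weakDeriv Omega 1 2 u p * (p.1 - xMid T)) ^ 2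
      ≤ hx T ^ 2 * (hx T * hy T) * thirdSq u T :=
    (sq_integral_sub_midpoint_fst_le (x_lt T) (y_lt T) m12).trans
      (mul_le_mul_of_nonneg_left n12 (by positivity))
  have c₂ : (∫ p in interior T, weakDeriv Omega 2 1 u p * (p.2 - yMid T)) ^ 2
      ≤ hy T ^ 2 * (hx T * hy T) * thirdSq u T :=
    (sq_integral_sub_midpoint_snd_le (x_lt T) (y_lt T) m21).trans
      (mul_le_mul_of_nonneg_left n21 (by positivity))
  have b₃ : (∫ p in interior T, fluxDxy a u T 1 p * (p.1 - xMid T)) ^ 2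
      ≤ hx T ^ 2 * (hx T * hy T) * (2 * Lam ^ 2 * thirdSq u T) :=
    (sq_integral_sub_midpoint_fst_le (x_lt T) (y_lt T) dxy1.1).trans
      (mul_le_mul_of_nonneg_left q1 (by positivity))
  have c₃ : (∫ p in interior T, fluxDxy a u T 0 p * (p.2 - yMid T)) ^ 2
      ≤ hy T ^ 2 * (hx T * hy T) * (2 * Lam ^ 2 * thirdSq u T) :=
    (sq_integral_sub_midpoint_snd_le (x_lt T) (y_lt T) dxy0.1).trans
      (mul_le_mul_of_nonneg_left q0 (by positivity))
  have hPN : 0 ≤ area T * thirdSq u T := mul_nonneg hP.le hN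
  have w₁ := sq_correction_le hB hBh hρ hPN
    ((sq_setIntegral_le m12).trans (mul_le_mul_of_nonneg_left n12 hP.le))
    ((sq_setIntegral_le dxy1.1).trans (mul_le_mul_of_nonneg_left q1 hP.le)) hcorrV.1
  have w₂ := sq_correction_le hA hAh hρ hPN
    ((sq_setIntegral_le m21).trans (mul_le_mul_of_nonneg_left n21 hP.le))
    ((sq_setIntegral_le dxy0.1).trans (mul_le_mul_of_nonneg_left q0 hP.le)) hcorrH.1
  have est₁ := gradient_term_le (G₁ := weakGrad eb T 0) (G₂ := weakGrad eb T 1) hP hlam bx hby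
    w₁ w₂ (ha.sq_entry_le hlam T 0 0) (ha.sq_entry_le hlam T 0 1) (ha.sq_entry_le hlam T 1 0)
    (ha.sq_entry_le hlam T 1 1)
  have est₂ := defect_term_le (θ := defect eb T) hA hB hAh hBh hρ hN b₁ c₁ b₂ c₂ b₃ c₃
  have hgw : area T * ((a T).mulVec (weakGrad w T) ⬝ᵥ weakGrad eb T) =
      (a T 0 0 * (hy T * (w (edge T 1) - w (edge T 0)))
          + a T 0 1 * (hx T * (w (edge T 3) - w (edge T 2)))) * weakGrad eb T 0
        + (a T 1 0 * (hy T * (w (edge T 1) - w (edge T 0)))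
          + a T 1 1 * (hx T * (w (edge T 3) - w (edge T 2)))) * weakGrad eb T 1 := by
    obtain ⟨k0, k1⟩ := weakGrad_apply w T
    simp only [dotProduct, Matrix.mulVec, Fin.sum_univ_two]
    rw [k0, k1, area]
    field_simp
  have hstab : 2 * defect eb T ^ 2 * area T * (hx T + hy T) = defect eb T * area T *
      (eb (edge T 0) + eb (edge T 1) - eb (edge T 2) - eb (edge T 3)) := by
    have hAB := (add_pos hA hB).ne'
    have : eb (edge T 0) + eb (edge T 1) - eb (edge T 2) - eb (edge T 3)
        = defect eb T * (2 * (hx T + hy T)) := by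
      rw [defect, div_mul_cancel₀ _ (mul_ne_zero two_ne_zero hAB)]
    rw [this]; ring
  have hdef : area T * (Qu (edge T 0) + Qu (edge T 1) - Qu (edge T 2) - Qu (edge T 3)
        + M.h ^ 2 * (w (edge T 0) + w (edge T 1) - w (edge T 2) - w (edge T 3)))
      = (eb (edge T 0) + eb (edge T 1) - eb (edge T 2) - eb (edge T 3)) * area T
        + (zb (edge T 0) + zb (edge T 1) - zb (edge T 2) - zb (edge T 3)) * area T := by
    linear_combination (-area T) * (hez (edge T 0) + hez (edge T 1) - hez (edge T 2)
      - hez (edge T 3))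
  -- Here the correction takes effect. Its parts with `u_xx`, `u_yy` supply the subtracted leading
  -- terms of the two moments, and its parts with `∂_x q₁`, `∂_y q₂` cancel the flux integrals on
  -- the left. Only integrals controlled by third derivatives survive.
  have hbr : ρ * M.h⁻¹ * (area T * (Qu (edge T 0) + Qu (edge T 1) - Qu (edge T 2) - Qu (edge T 3)
        + M.h ^ 2 * (w (edge T 0) + w (edge T 1) - w (edge T 2) - w (edge T 3))))
      - (hx T * (∫ p in interior T, fluxDx a u T p) - hy T * ∫ p in interior T, fluxDy a u T p)
      = 2 * (ρ / M.h) * (((∫ p in interior T, weakDeriv Omega 1 0 u p * (p.1 - xMid T))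
            - hx T ^ 2 / 12 * ∫ p in interior T, weakDeriv Omega 2 0 u p)
          - ((∫ p in interior T, weakDeriv Omega 0 1 u p * (p.2 - yMid T))
            - hy T ^ 2 / 12 * ∫ p in interior T, weakDeriv Omega 0 2 u p))
        + ρ / M.h * (hy T ^ 2 / 6 * (∫ p in interior T, weakDeriv Omega 1 2 u p * (p.1 - xMid T))
          - hx T ^ 2 / 6 * ∫ p in interior T, weakDeriv Omega 2 1 u p * (p.2 - yMid T))
        - hy T * (∫ p in interior T, fluxDxy a u T 1 p * (p.1 - xMid T))
        + hx T * ∫ p in interior T, fluxDxy a u T 0 p * (p.2 - yMid T) := by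
    have e : area T * (Qu (edge T 0) + Qu (edge T 1) - Qu (edge T 2) - Qu (edge T 3)
        + M.h ^ 2 * (w (edge T 0) + w (edge T 1) - w (edge T 2) - w (edge T 3)))
        = 2 * (area T * ((Qu (edge T 0) + Qu (edge T 1)) / 2
            - (Qu (edge T 2) + Qu (edge T 3)) / 2))
          + M.h ^ 2 * (area T * (w (edge T 0) + w (edge T 1))
            - area T * (w (edge T 2) + w (edge T 3))) := by ring
    rw [e, hQ3, hcorrV.2, hcorrH.2]
    field_simp
    ring
  have hgg : weakGrad eb T ⬝ᵥ weakGrad eb T = weakGrad eb T 0 ^ 2 + weakGrad eb T 1 ^ 2 := by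
    simp only [dotProduct, Fin.sum_univ_two]; ring
  rw [stab_extS_self, stab_extS, hgw, hgg, errorConst]
  rw [← hbr, hdef] at est₂
  have e4 : hx T * hy T = area T := rfl
  rw [e4, div_eq_mul_inv ρ M.h] at est₂
  have hst2 := congrArg (HMul.hMul (ρ * M.h⁻¹)) hstab
  linarith

/-! ### Summation over the elements and the energy estimate -/

theorem gradForm_eq (a : M.Elem → Matrix (Fin 2) (Fin 2) ℝ) {eb zb Qb wb : M.Edge → ℝ} {r : ℝ}
    (h : ∀ e, eb e + zb e = Qb e + r * wb e) (vb : M.Edge → ℝ) :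
    gradForm a eb vb + gradForm a zb vb = gradForm a Qb vb + r * gradForm a wb vb := by
  simp only [gradForm, Finset.mul_sum, ← Finset.sum_add_distrib]
  refine Finset.sum_congr rfl fun T _ => ?_
  have h0 := h (edge T 0)
  have h1 := h (edge T 1)
  have h2 := h (edge T 2)
  have h3 := h (edge T 3)
  have g0 : weakGrad eb T 0 + weakGrad zb T 0 = weakGrad Qb T 0 + r * weakGrad wb T 0 := by
    simp only [(weakGrad_apply _ T).1]
    rw [← add_div, mul_div_assoc', ← add_div]
    congr 1; linarith
  have g1 : weakGrad eb T 1 + weakGrad zb T 1 = weakGrad Qb T 1 + r * weakGrad wb T 1 := by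
    simp only [(weakGrad_apply _ T).2]
    rw [← add_div, mul_div_assoc', ← add_div]
    congr 1; linarith
  simp only [dotProduct, Matrix.mulVec, Fin.sum_univ_two]
  linear_combination area T * ((a T 0 0 * weakGrad vb T 0 + a T 1 0 * weakGrad vb T 1) * g0
    + (a T 0 1 * weakGrad vb T 0 + a T 1 1 * weakGrad vb T 1) * g1)

theorem gradNorm_sq (vb : M.Edge → ℝ) :
    gradNorm vb ^ 2 = ∑ T : M.Elem, area T * (weakGrad vb T ⬝ᵥ weakGrad vb T) :=
  Real.sq_sqrt (Finset.sum_nonneg fun T _ => mul_nonneg (area_pos T).le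
    (Finset.sum_nonneg fun _ _ => mul_self_nonneg _))

theorem stabNorm_sq {ρ : ℝ} (hρ : 0 < ρ) (vb : M.Edge → ℝ) :
    stabNorm ρ vb ^ 2 = ∑ T : M.Elem, ρ * M.h⁻¹ * ∑ s : Fin 4, (seg (edge T s)).len *
      ((seg (edge T s)).mean (affine (extS vb T)) - vb (edge T s)) ^ 2 := by
  rw [stabNorm, Real.sq_sqrt, Finset.mul_sum]
  have := h_pos M
  refine mul_nonneg (by positivity) (Finset.sum_nonneg fun T _ => Finset.sum_nonneg fun s _ =>
    mul_nonneg (sub_pos.2 (seg_edge_lt T s)).le (sq_nonneg _))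

theorem energy_estimate {ρ lam Lam : ℝ} (hρ : 0 < ρ) (hlam : 0 < lam) (ha : IsCoeff lam Lam a)
    (hf : MemLp f 2 (volume.restrict Omega)) (hu : MemH 3 Omega u) (hs : IsSolution a f g u)
    {w : M.Edge → ℝ} (hw : IsCorrection ρ a u w) {uh : WeakFun M}
    (huh : IsWGSolution ρ a f (fun e => (seg e).mean g + M.h ^ 2 * w e) uh)
    {Qu : M.Edge → ℝ} (hQ : IsEdgeProjection u Qu) :
    lam / 2 * gradNorm (fun e => Qu e + M.h ^ 2 * w e - uh.vb e) ^ 2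
        + 1 / 2 * stabNorm ρ (fun e => Qu e + M.h ^ 2 * w e - uh.vb e) ^ 2
      ≤ errorConst ρ lam Lam * M.h ^ 4 * sobolevNorm 3 Omega u ^ 2 := by
  set eb : M.Edge → ℝ := fun e => Qu e + M.h ^ 2 * w e - uh.vb e with heb
  have hez : ∀ e, eb e + uh.vb e = Qu e + M.h ^ 2 * w e := fun e => by simp only [heb]; ring
  -- The discrete boundary values already contain `h² w`, so only `Q_b u = Q_b g` on the boundary is
  -- needed.
  have hbd : ∀ e, IsBdry e → eb e = 0 := fun e he => by
    simp only [heb]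
    rw [huh.1 e he, hQ.eq_mean_of_isBdry hs.2 he]; ring
  -- The interior component `S(e_b)` is the choice for which the stabilizer does not see `u₀`.
  have scheme := huh.2 ⟨extS eb, eb⟩ hbd
  have hflux := hs.sum_edgeFlux hf hu hbd
  have hgrad := gradForm_eq a hez eb
  have hcoer : lam * gradNorm eb ^ 2 ≤ gradForm a eb eb := by
    rw [gradNorm_sq, gradForm, Finset.mul_sum]
    refine Finset.sum_le_sum fun T _ => ?_
    have := mul_le_mul_of_nonneg_left ((ha T).2 (weakGrad eb T)).1 (area_pos T).le
    linarith
  have hsum := Finset.sum_le_sum fun (T : M.Elem) (_ : T ∈ Finset.univ) =>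
    element_estimate hρ hlam ha hf hu hs hw hQ hez (uh.v0 T) T
  simp only [Finset.sum_add_distrib, Finset.sum_sub_distrib, ← Finset.mul_sum] at hsum
  simp only [Finset.sum_add_distrib, Finset.sum_sub_distrib] at hflux
  have hst := stabNorm_sq hρ eb
  rw [← Finset.mul_sum] at hst
  have hgn := gradNorm_sq eb
  simp only [stab] at scheme
  have hthird := sum_thirdSq_le (M := M) hu
  have hC : 0 ≤ errorConst ρ lam Lam * M.h ^ 4 := by
    have := h_pos M
    unfold errorConst; positivity
  have h3 := mul_le_mul_of_nonneg_left hthird hC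
  rw [← hgn, ← hst] at hsum
  simp only [gradForm] at hgrad scheme hcoer
  linarith

theorem errorConst_pos {ρ lam Lam : ℝ} (hρ : 0 < ρ) (hlam : 0 < lam) :
    0 < errorConst ρ lam Lam := by
  unfold errorConst; positivity

end WG

end

/-! ### The error estimate -/

theorem mainTheorem1 (ρ lam Lam : ℝ) (hρ : 0 < ρ) (hlam : 0 < lam) :
    ∃ C : ℝ, 0 < C ∧
      ∀ (M : WG.Mesh) (a : M.Elem → Matrix (Fin 2) (Fin 2) ℝ), WG.IsCoeff lam Lam a →
      ∀ f g u : ℝ × ℝ → ℝ, MemLp f 2 (volume.restrict WG.Omega) →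
        WG.MemH 3 WG.Omega u → WG.IsSolution a f g u →
      ∀ w : M.Edge → ℝ, WG.IsCorrection ρ a u w →
      ∀ uh : WG.WeakFun M,
        WG.IsWGSolution ρ a f (fun e => (WG.Mesh.seg e).mean g + M.h ^ 2 * w e) uh →
      ∀ Qu : M.Edge → ℝ, WG.IsEdgeProjection u Qu →
        WG.gradNorm (fun e => Qu e + M.h ^ 2 * w e - uh.vb e)
            + WG.stabNorm ρ (fun e => Qu e + M.h ^ 2 * w e - uh.vb e)
          ≤ C * M.h ^ 2 * WG.sobolevNorm 3 WG.Omega u := by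
  have hK : 0 < WG.errorConst ρ lam Lam := WG.errorConst_pos hρ hlam
  -- Each of the two nonnegative terms `lam / 2 * G²` and `1 / 2 * S²` of the energy estimate is
  -- bounded by `K h⁴ E²`; the square roots give the two summands.
  refine ⟨Real.sqrt (2 * WG.errorConst ρ lam Lam / lam) + Real.sqrt (2 * WG.errorConst ρ lam Lam),
    by positivity, ?_⟩
  intro M a ha f g u hf hu hs w hw uh huh Qu hQ
  have key := WG.energy_estimate hρ hlam ha hf hu hs hw huh hQ
  set G := WG.gradNorm (fun e => Qu e + M.h ^ 2 * w e - uh.vb e)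
  set S := WG.stabNorm ρ (fun e => Qu e + M.h ^ 2 * w e - uh.vb e)
  have hE : 0 ≤ WG.sobolevNorm 3 WG.Omega u := Real.sqrt_nonneg _
  set E := WG.sobolevNorm 3 WG.Omega u
  set K := WG.errorConst ρ lam Lam
  have hhE : 0 ≤ M.h ^ 2 * E := by positivity
  have hlG : 0 ≤ lam / 2 * G ^ 2 := by positivity
  have hG : G ≤ Real.sqrt (2 * K / lam) * (M.h ^ 2 * E) := by
    refine le_of_sq_le_sq ?_ (by positivity)
    rw [mul_pow, Real.sq_sqrt (by positivity), div_mul_eq_mul_div, le_div_iff₀ hlam]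
    nlinarith [sq_nonneg S]
  have hS : S ≤ Real.sqrt (2 * K) * (M.h ^ 2 * E) := by
    refine le_of_sq_le_sq ?_ (by positivity)
    rw [mul_pow, Real.sq_sqrt (by positivity)]
    nlinarith
  calc G + S ≤ Real.sqrt (2 * K / lam) * (M.h ^ 2 * E) + Real.sqrt (2 * K) * (M.h ^ 2 * E) :=
        add_le_add hG hS
    _ = (Real.sqrt (2 * K / lam) + Real.sqrt (2 * K)) * M.h ^ 2 * E := by ring
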